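/- A ONE-ONE-LQ instance $G$ is a bipartite graph with a set of agents and a set of resources in which every vertex ranks its neighbours in a strict order (its preference list), every resource has upper quota $1$ and lower quota $0$ or $1$, and the resources of lower quota $1$ are called LQ resources. Being unmatched is the least preferred option of every vertex. A matching $M$ is feasible if it matches every LQ resource. An edge $(a,b)\notin M$ blocks $M$ if $a$ prefers $b$ to its partner in $M$ and $b$ prefers $a$ to its partner in $M$; $M$ is stable if no edge blocks it, and relaxed stable if every agent that belongs to a blocking edge is matched in $M$ to an LQ resource. $M$ is envy-free if there are no edges $(a',b)\in M$ and $(a,b)$ of $G$ such that $a$ prefers $b$ to its partner in $M$ and $b$ prefers $a$ to $a'$. Let $s$ be the size of a stable matching of $G$ (all stable matchings have the same size), and let $t$ be the maximum, over all pairs of distinct agents, of the number of non-LQ resources that are in the preference lists of both ($t=0$ if there are fewer than two agents). Given $(G,k)$ with $k\in\mathbb{N}$, MAXEFM (respectively MAXRSM) asks whether $G$ has a feasible envy-free (respectively feasible relaxed stable) matching of size at least $k$. Theorem. (1) On ONE-ONE-LQ instances that admit a feasible envy-free matching, MAXEFM admits a polynomial kernel in $(s,t)$: there are a polynomial-time algorithm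 and a polynomial $p$ such that the algorithm turns every such input $(G,k)$ into an input $(G',k')$, where $G'$ again admits a feasible envy-free matching, such that $(G,k)$ is a yes-instance of MAXEFM if and only if $(G',k')$ is, and the number of vertices of $G'$ plus the number of edges of $G'$ plus $k'$ is at most $p(s,t)$. (2) On ONE-ONE-LQ instances that admit a feasible stable matching, MAXRSM admits a polynomial kernel in $s$: there are a polynomial-time algorithm and a polynomial $p$ such that the algorithm turns every such input $(G,k)$ into an input $(G',k')$, where $G'$ again admits a feasible stable matching, such that $(G,k)$ is a yes-instance of MAXRSM if and only if $(G',k')$ is, and the number of vertices of $G'$ plus the number of edges of $G'$ plus $k'$ is at most $p(s)$. -/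

import Mathlib

/-! ## Matchings with two-sided preferences and lower quotas -/

/-- A `ONE-ONE-LQ` instance.  The agents are `Fin nA`, the resources are `Fin nB`; each vertex has a
strict preference list over its neighbours, most preferred first, and acceptability is mutual.
Every upper quota is `1`; `lq b = true` means that the lower quota of `b` is `1` (`b` is an LQ
resource), `lq b = false` that it is `0`. -/
structure OneOneLQ where
  nA : ℕ
  nB : ℕ
  prefA : Fin nA → List (Fin nB)
  prefB : Fin nB → List (Fin nA)
  nodupA : ∀ a, (prefA a).Nodup
  nodupB : ∀ b, (prefB b).Nodup
  mutual_iff : ∀ a b, b ∈ prefA a ↔ a ∈ prefB b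
  lq : Fin nB → Bool

namespace OneOneLQ

variable (G : OneOneLQ)

/-- `(a, b)` is an edge: `a` and `b` are mutually acceptable. -/
def Edge (a : Fin G.nA) (b : Fin G.nB) : Prop := b ∈ G.prefA a

/-- `M` is a matching: a set of edges, no two of which share an agent or a resource. -/
structure IsMatching (M : Finset (Fin G.nA × Fin G.nB)) : Prop where
  edge : ∀ a b, (a, b) ∈ M → G.Edge a b
  agent_unique : ∀ a b b', (a, b) ∈ M → (a, b') ∈ M → b = b'
  resource_unique : ∀ a a' b, (a, b) ∈ M → (a', b) ∈ M → a = a'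

/-- `b ≻ₐ b'`, for neighbours `b`, `b'` of `a`. -/
def APref (a : Fin G.nA) (b b' : Fin G.nB) : Prop :=
  (G.prefA a).idxOf b < (G.prefA a).idxOf b'

/-- `a ≻_b a'`, for neighbours `a`, `a'` of `b`. -/
def BPref (b : Fin G.nB) (a a' : Fin G.nA) : Prop :=
  (G.prefB b).idxOf a < (G.prefB b).idxOf a'

/-- `b ≻ₐ M(a)`, for a neighbour `b` of `a`.  It holds if `a` is unmatched in `M`. -/
def AImproves (M : Finset (Fin G.nA × Fin G.nB)) (a : Fin G.nA) (b : Fin G.nB) : Prop :=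
  ∀ b', (a, b') ∈ M → G.APref a b b'

/-- `a ≻_b M(b)`, for a neighbour `a` of `b`.  It holds if `b` is unmatched in `M`. -/
def BImproves (M : Finset (Fin G.nA × Fin G.nB)) (b : Fin G.nB) (a : Fin G.nA) : Prop :=
  ∀ a', (a', b) ∈ M → G.BPref b a a'

/-- `(a, b) ∈ E \ M` is a blocking pair w.r.t. `M`. -/
def Blocks (M : Finset (Fin G.nA × Fin G.nB)) (a : Fin G.nA) (b : Fin G.nB) : Prop :=
  G.Edge a b ∧ (a, b) ∉ M ∧ G.AImproves M a b ∧ G.BImproves M b a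

/-- `M` is a stable matching (lower quotas are ignored). -/
def IsStable (M : Finset (Fin G.nA × Fin G.nB)) : Prop :=
  G.IsMatching M ∧ ∀ a b, ¬ G.Blocks M a b

/-- Every LQ resource is matched in `M`. -/
def IsFeasible (M : Finset (Fin G.nA × Fin G.nB)) : Prop :=
  ∀ b, G.lq b = true → ∃ a, (a, b) ∈ M

/-- `a` has justified envy towards the agent `a'`, which is matched in `M`. -/
def Envies (M : Finset (Fin G.nA × Fin G.nB)) (a a' : Fin G.nA) : Prop :=
  ∃ b, (a', b) ∈ M ∧ G.Edge a b ∧ G.AImproves M a b ∧ G.BPref b a a'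

/-- `M` is an envy-free matching. -/
def IsEnvyFree (M : Finset (Fin G.nA × Fin G.nB)) : Prop :=
  G.IsMatching M ∧ ∀ a a', ¬ G.Envies M a a'

/-- `M` is a relaxed stable matching: every agent that forms a blocking pair is matched, and matched
to an LQ resource. -/
def IsRelaxedStable (M : Finset (Fin G.nA × Fin G.nB)) : Prop :=
  G.IsMatching M ∧ ∀ a b, G.Blocks M a b → ∃ b', (a, b') ∈ M ∧ G.lq b' = true

/-- The question of `MAXEFM`: is there a feasible envy-free matching of size at least `k`? -/
def MaxEFM (k : ℕ) : Prop := ∃ M, G.IsFeasible M ∧ G.IsEnvyFree M ∧ k ≤ M.card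

/-- The question of `MAXRSM`: is there a feasible relaxed stable matching of size at least `k`? -/
def MaxRSM (k : ℕ) : Prop := ∃ M, G.IsFeasible M ∧ G.IsRelaxedStable M ∧ k ≤ M.card

/-- The parameter `s`, the size of a stable matching.  A stable matching always exists, and all
stable matchings have the same size, so the infimum is that common size. -/
noncomputable def stableSize : ℕ := sInf {s | ∃ M, G.IsStable M ∧ M.card = s}

/-- The non-LQ resources common to the preference lists of `a` and `a'`. -/
def commonNonLQ (a a' : Fin G.nA) : Finset (Fin G.nB) :=
  Finset.univ.filter fun b => b ∈ G.prefA a ∧ b ∈ G.prefA a' ∧ G.lq b = false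

/-- The parameter `t`, the largest number of non-LQ resources that are common to the preference
lists of two distinct agents (`0` if there are fewer than two agents). -/
def commonParam : ℕ :=
  (Finset.univ.filter fun p : Fin G.nA × Fin G.nA => p.1 ≠ p.2).sup
    fun p => (G.commonNonLQ p.1 p.2).card

/-- The number of vertices plus the number of edges. -/
def size : ℕ := G.nA + G.nB + ∑ a, (G.prefA a).length

/-- The instance `(G, k)` as a word: `k`, the numbers of agents and of resources, then for each agent
the length of its preference list and the list, then for each resource its lower quota, the length
of its preference list and the list. -/
def encode (k : ℕ) : List ℕ :=
  [k, G.nA, G.nB]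
    ++ (List.finRange G.nA).flatMap
        (fun a => (G.prefA a).length :: (G.prefA a).map (fun b => (b : ℕ)))
    ++ (List.finRange G.nB).flatMap
        (fun b => (G.lq b).toNat :: (G.prefB b).length :: (G.prefB b).map (fun a => (a : ℕ)))

end OneOneLQ

/-! ## A random access machine with a step count

Structured programs over natural-number variables and arrays.  The arithmetic operations are addition
and truncated subtraction only, so that numbers grow by at most one bit per step and the model is
polynomially equivalent to Turing machines. -/

namespace RAM

/-- Expressions. `get A e` is the entry with index `e` of the array `A`. -/
inductive Expr : Type
  | lit (n : ℕ)
  | var (x : ℕ)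
  | get (A : ℕ) (e : Expr)
  | add (e₁ e₂ : Expr)
  | sub (e₁ e₂ : Expr)
  | lt (e₁ e₂ : Expr)
  | eq (e₁ e₂ : Expr)

/-- Programs. `set x e` assigns to a variable, `put A e₁ e₂` writes the value of `e₂` into the entry
with index `e₁` of the array `A`; a test succeeds if its value is not `0`. -/
inductive Prog : Type
  | skip
  | set (x : ℕ) (e : Expr)
  | put (A : ℕ) (e₁ e₂ : Expr)
  | seq (p q : Prog)
  | branch (e : Expr) (p q : Prog)
  | loop (e : Expr) (p : Prog)

/-- Memory: the values of the variables and of the entries of the arrays. -/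
@[ext] structure State where
  vars : ℕ → ℕ
  arrs : ℕ → ℕ → ℕ

/-- The value of an expression. -/
def Expr.val (σ : State) : Expr → ℕ
  | .lit n => n
  | .var x => σ.vars x
  | .get A e => σ.arrs A (e.val σ)
  | .add e₁ e₂ => e₁.val σ + e₂.val σ
  | .sub e₁ e₂ => e₁.val σ - e₂.val σ
  | .lt e₁ e₂ => if e₁.val σ < e₂.val σ then 1 else 0
  | .eq e₁ e₂ => if e₁.val σ = e₂.val σ then 1 else 0

/-- The number of elementary operations in the evaluation of an expression. -/
def Expr.cost : Expr → ℕ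
  | .lit _ => 1
  | .var _ => 1
  | .get _ e => e.cost + 1
  | .add e₁ e₂ => e₁.cost + e₂.cost + 1
  | .sub e₁ e₂ => e₁.cost + e₂.cost + 1
  | .lt e₁ e₂ => e₁.cost + e₂.cost + 1
  | .eq e₁ e₂ => e₁.cost + e₂.cost + 1

/-- Assignment to a variable. -/
def State.setVar (σ : State) (x v : ℕ) : State :=
  { σ with vars := Function.update σ.vars x v }

/-- Assignment to an array entry. -/
def State.setArr (σ : State) (A i v : ℕ) : State :=
  { σ with arrs := Function.update σ.arrs A (Function.update (σ.arrs A) i v) }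

/-- `Exec p σ n τ`: started in `σ`, the program `p` halts in `τ` after exactly `n` steps. -/
inductive Exec : Prog → State → ℕ → State → Prop
  | skip (σ) : Exec .skip σ 1 σ
  | set (x e σ) : Exec (.set x e) σ (e.cost + 1) (σ.setVar x (e.val σ))
  | put (A e₁ e₂ σ) :
      Exec (.put A e₁ e₂) σ (e₁.cost + e₂.cost + 1) (σ.setArr A (e₁.val σ) (e₂.val σ))
  | seq {p q σ τ υ m n} : Exec p σ m τ → Exec q τ n υ → Exec (.seq p q) σ (m + n) υ
  | branch_true {e p q σ τ n} : e.val σ ≠ 0 → Exec p σ n τ →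
      Exec (.branch e p q) σ (e.cost + 1 + n) τ
  | branch_false {e p q σ τ n} : e.val σ = 0 → Exec q σ n τ →
      Exec (.branch e p q) σ (e.cost + 1 + n) τ
  | loop_done {e p σ} : e.val σ = 0 → Exec (.loop e p) σ (e.cost + 1) σ
  | loop_step {e p σ τ υ m n} : e.val σ ≠ 0 → Exec p σ m τ → Exec (.loop e p) τ n υ →
      Exec (.loop e p) σ (e.cost + 1 + m + n) υ

/-- The memory that holds the word `w`: its letters are in the array `0`, its length in the
variable `0`, and everything else is `0`. -/
def load (w : List ℕ) : State where
  vars := fun x => if x = 0 then w.length else 0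
  arrs := fun A i => if A = 0 then w.getD i 0 else 0

/-- The word held in the array `0`, with its length in the variable `0`. -/
def State.word (σ : State) : List ℕ := (List.range (σ.vars 0)).map (σ.arrs 0)

/-- On the input word `w`, the program `p` halts after `n` steps with the output word `w'`. -/
def Runs (p : Prog) (w : List ℕ) (n : ℕ) (w' : List ℕ) : Prop :=
  ∃ τ, Exec p (load w) n τ ∧ τ.word = w'

end RAM

/-! ## Polynomial kernels -/

/-- Consider the decision problem whose inputs are the pairs `(G, k)` with `G` in the class `C`, whose
yes-instances are those with `Q G k`, and whose parameters are `κ G 0, …, κ G (r - 1)`.  It admits a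
polynomial kernel if some program turns every input `(G, k)`, in time polynomial in the length of the
input, into an equivalent input `(G', k')` of the same problem whose size is at most a polynomial in
the parameters of `G`. -/
def AdmitsPolyKernel {r : ℕ} (C : OneOneLQ → Prop) (Q : OneOneLQ → ℕ → Prop)
    (κ : OneOneLQ → Fin r → ℕ) : Prop :=
  ∃ (P : RAM.Prog) (T : Polynomial ℕ) (p : MvPolynomial (Fin r) ℕ),
    ∀ (G : OneOneLQ) (k : ℕ), C G →
      ∃ (n : ℕ) (G' : OneOneLQ) (k' : ℕ),
        RAM.Runs P (G.encode k) n (G'.encode k') ∧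
        n ≤ T.eval (G.encode k).length ∧
        C G' ∧
        (Q G k ↔ Q G' k') ∧
        G'.size + k' ≤ MvPolynomial.eval (κ G) p

/-! The vertices matched by a stable matching `S` of size `s` form a vertex cover, as an edge
between two unmatched vertices would block (`IsStable.cover`). Hence every matching has size at most
`2 * s`. The vertices of any maximal matching `K` are also a cover, so `L = 2 * |K| + 1 ≤ 4 * s + 1`
exceeds the size of every matching. A greedy pass finds such an `L`, and the kernel never has to
compute `S`. Both kernels delete edges by a rule depending on `L`, drop the isolated vertices, and
replace `k` by `min k L`, which is harmless because no matching has `L` edges.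

For `MaxEFM`: every agent above the partner of `b` on the list of `b` is matched, since it would
otherwise envy that partner. So only the first `L` agents of each list matter. A non-LQ resource
with a single neighbour is private: it causes no envy and can be replaced by the agent's best
private resource (`IsEnvyFree.exists_efmKeep`). Conversely, envy in `G` against a matching of kept
edges uses an edge that is itself kept (`IsRestriction.isEnvyFree_push_efm`). A surviving resource
is matched in `S`, or LQ, or the best private one of an agent of `S`, or a non-LQ resource shared by
two agents of `S`; the last kind is counted by `t` (`IsRestriction.nB_le_efm`).

For `MaxRSM`: an unmatched agent belongs to no blocking pair, so again only the first `L` agents of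
each list matter. An agent matched to a non-LQ resource does not block either, so that resource is
among its first `L`. The rule nevertheless keeps the first `2 * L` resources of each agent. Fewer
than `L` resources have degree at least `L` and fewer than `L` are matched, so an agent with a long
list sees among its first `2 * L` an unmatched resource of small degree, along a kept edge. This
shows that deleted edges cannot violate relaxed stability
(`IsRestriction.isRelaxedStable_push_rsm`).

The algorithmic half is a program logic `Ok` that bounds running time by a polynomial in the largest
number of loop rounds; for the kernelization the input length bounds those rounds. `kernelize_ok`
determines the output word, `exists_isRestriction` recognises it as the code of the restricted
instance, and `admitsPolyKernel_of_decides` joins the two halves. -/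

namespace OneOneLQ

/-! ### Matchings -/

section Matchings

variable {G : OneOneLQ} {M : Finset (Fin G.nA × Fin G.nB)}

theorem edge_iff_mem_prefB {a : Fin G.nA} {b : Fin G.nB} : G.Edge a b ↔ a ∈ G.prefB b :=
  G.mutual_iff a b

theorem IsMatching.injOn_fst (hM : G.IsMatching M) :
    Set.InjOn Prod.fst (M : Set (Fin G.nA × Fin G.nB)) := by
  rintro ⟨a, b⟩ h ⟨a', b'⟩ h' e
  obtain rfl : a = a' := e
  rw [hM.agent_unique a b b' (by simpa using h) (by simpa using h')]

theorem IsMatching.injOn_snd (hM : G.IsMatching M) :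
    Set.InjOn Prod.snd (M : Set (Fin G.nA × Fin G.nB)) := by
  rintro ⟨a, b⟩ h ⟨a', b'⟩ h' e
  obtain rfl : b = b' := e
  rw [hM.resource_unique a a' b (by simpa using h) (by simpa using h')]

theorem IsMatching.card_image_fst (hM : G.IsMatching M) : (M.image Prod.fst).card = M.card :=
  Finset.card_image_of_injOn hM.injOn_fst

theorem IsMatching.card_image_snd (hM : G.IsMatching M) : (M.image Prod.snd).card = M.card :=
  Finset.card_image_of_injOn hM.injOn_snd

/-- A matching is at most as large as a vertex cover. -/
theorem IsMatching.card_le_of_cover (hM : G.IsMatching M) (X : Finset (Fin G.nA))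
    (Y : Finset (Fin G.nB)) (h : ∀ a b, G.Edge a b → a ∈ X ∨ b ∈ Y) :
    M.card ≤ X.card + Y.card := by
  have h1 : (M.filter fun p => p.1 ∈ X).card ≤ X.card :=
    Finset.card_le_card_of_injOn Prod.fst (fun p hp => (Finset.mem_filter.1 hp).2)
      (hM.injOn_fst.mono fun p hp => (Finset.mem_filter.1 hp).1)
  have h2 : (M.filter fun p => p.2 ∈ Y).card ≤ Y.card :=
    Finset.card_le_card_of_injOn Prod.snd (fun p hp => (Finset.mem_filter.1 hp).2)
      (hM.injOn_snd.mono fun p hp => (Finset.mem_filter.1 hp).1)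
  have h3 : M ⊆ (M.filter fun p => p.1 ∈ X) ∪ (M.filter fun p => p.2 ∈ Y) := by
    rintro ⟨a, b⟩ hp
    rcases h a b (hM.edge a b hp) with h | h <;> simp [hp, h]
  exact (Finset.card_le_card h3).trans ((Finset.card_union_le _ _).trans (by omega))

/-- An edge with both ends unmatched blocks. All bounds in terms of `s` come from this vertex cover.
-/
theorem IsStable.cover (hM : G.IsStable M) {a : Fin G.nA} {b : Fin G.nB} (hab : G.Edge a b) :
    a ∈ M.image Prod.fst ∨ b ∈ M.image Prod.snd := by
  by_contra! hc
  have hc1 : ∀ b', (a, b') ∉ M := fun b' h => hc.1 (Finset.mem_image_of_mem Prod.fst h)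
  have hc2 : ∀ a', (a', b) ∉ M := fun a' h => hc.2 (Finset.mem_image_of_mem Prod.snd h)
  exact hM.2 a b ⟨hab, hc1 b, fun b' h => absurd h (hc1 b'), fun a' h => absurd h (hc2 a')⟩

theorem isEnvyFree_empty : G.IsEnvyFree ∅ :=
  ⟨⟨by simp, by simp, by simp⟩, by rintro a a' ⟨b, h, -⟩; simp at h⟩

theorem idxOf_prefA_lt {a : Fin G.nA} {b : Fin G.nB} (h : G.Edge a b) :
    (G.prefA a).idxOf b < G.nB :=
  (List.idxOf_lt_length_of_mem h).trans_le (by simpa using (G.nodupA a).length_le_card)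

/-- Satisfying the best agent that prefers an unmatched resource keeps envy-freeness. -/
theorem IsEnvyFree.reassign (hM : G.IsEnvyFree M) {a : Fin G.nA} {b : Fin G.nB}
    (hab : G.Edge a b) (himp : G.AImproves M a b) (hb : ∀ a', (a', b) ∉ M)
    (hbest : ∀ a', G.Edge a' b → G.AImproves M a' b → ¬ G.BPref b a' a) :
    G.IsEnvyFree (insert (a, b) (M.filter fun p => p.1 ≠ a)) := by
  obtain ⟨hM, hE⟩ := hM
  have hmem : ∀ x y, (x, y) ∈ insert (a, b) (M.filter fun p => p.1 ≠ a) ↔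
      (x = a ∧ y = b) ∨ ((x, y) ∈ M ∧ x ≠ a) := by simp
  -- No agent is worse off after the change: `a` moves up and nobody else moves. So envy at an old
  -- edge was there before, and envy at the new edge contradicts the choice of `a`.
  have hle : ∀ x y, G.AImproves (insert (a, b) (M.filter fun p => p.1 ≠ a)) x y →
      G.AImproves M x y := by
    intro x y h b' hb'
    by_cases hx : x = a
    · subst hx
      have h1 := h b (by simp)
      exact h1.trans (himp b' hb')
    · exact h b' ((hmem _ _).2 (Or.inr ⟨hb', hx⟩))
  refine ⟨⟨fun x y h => ?_, fun x y y' h h' => ?_, fun x x' y h h' => ?_⟩, ?_⟩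
  · rcases (hmem _ _).1 h with ⟨rfl, rfl⟩ | ⟨h, -⟩
    exacts [hab, hM.edge _ _ h]
  · rcases (hmem _ _).1 h with ⟨rfl, rfl⟩ | ⟨h, hx⟩ <;>
      rcases (hmem _ _).1 h' with ⟨h1, h2⟩ | ⟨h', hx'⟩
    · exact h2.symm
    · exact absurd rfl hx'
    · exact absurd h1 hx
    · exact hM.agent_unique _ _ _ h h'
  · rcases (hmem _ _).1 h with ⟨rfl, rfl⟩ | ⟨h, hx⟩ <;>
      rcases (hmem _ _).1 h' with ⟨h1, h2⟩ | ⟨h', hx'⟩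
    · exact h1.symm
    · exact absurd h' (hb _)
    · exact absurd (h2 ▸ h) (hb _)
    · exact hM.resource_unique _ _ _ h h'
  · rintro x x' ⟨y, h1, h2, h3, h4⟩
    rcases (hmem _ _).1 h1 with ⟨rfl, rfl⟩ | ⟨h, hx⟩
    · exact hbest x h2 (hle _ _ h3) h4
    · exact hE x x' ⟨y, h, h2, hle _ _ h3, h4⟩

/-- A stable matching exists: an envy-free matching that is best possible for the agents. -/
theorem exists_isStable (G : OneOneLQ) : ∃ M, G.IsStable M := by
  classical
  -- The potential: each matched agent contributes more the better its partner, and a positive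
  -- amount in any case, since a neighbour has position below `nB`.
  let f : Finset (Fin G.nA × Fin G.nB) → ℕ := fun M =>
    ∑ p ∈ M, (G.nB - (G.prefA p.1).idxOf p.2)
  obtain ⟨M, hM, hmax⟩ := Finset.exists_max_image
    (Finset.univ.filter fun M => G.IsEnvyFree M) f ⟨∅, by simp [isEnvyFree_empty]⟩
  simp only [Finset.mem_filter, Finset.mem_univ, true_and] at hM hmax
  refine ⟨M, hM.1, fun a₀ b hbl => ?_⟩
  -- A partner of `b` would be envied by `a₀`.
  have hb : ∀ a', (a', b) ∉ M := fun a' h =>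
    hM.2 a₀ a' ⟨b, h, hbl.1, hbl.2.2.1, hbl.2.2.2 a' h⟩
  obtain ⟨a, ha, hbest⟩ := Finset.exists_min_image
    (Finset.univ.filter fun a => G.Edge a b ∧ G.AImproves M a b)
    (fun a => (G.prefB b).idxOf a) ⟨a₀, by simp [hbl.1, hbl.2.2.1]⟩
  simp only [Finset.mem_filter, Finset.mem_univ, true_and] at ha hbest
  have hM' := hM.reassign ha.1 ha.2 hb
    (fun a' h1 h2 h3 => absurd (hbest a' ⟨h1, h2⟩) (not_le.2 h3))
  refine absurd (hmax _ hM') (not_le.2 ?_)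
  -- Reassigning `a` changes only its own contribution to the potential, which strictly grows.
  have hsplit : f M = ∑ p ∈ M.filter (fun p => p.1 ≠ a), (G.nB - (G.prefA p.1).idxOf p.2) +
      ∑ p ∈ M.filter (fun p => ¬ p.1 ≠ a), (G.nB - (G.prefA p.1).idxOf p.2) :=
    (Finset.sum_filter_add_sum_filter_not _ _ _).symm
  have hins : f (insert (a, b) (M.filter fun p => p.1 ≠ a)) =
      (G.nB - (G.prefA a).idxOf b) +
        ∑ p ∈ M.filter (fun p => p.1 ≠ a), (G.nB - (G.prefA p.1).idxOf p.2) :=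
    Finset.sum_insert (by simp)
  have hlt := idxOf_prefA_lt ha.1
  have : ∑ p ∈ M.filter (fun p => ¬ p.1 ≠ a), (G.nB - (G.prefA p.1).idxOf p.2) <
      G.nB - (G.prefA a).idxOf b := by
    by_cases hm : ∃ b', (a, b') ∈ M
    · obtain ⟨b', hb'⟩ := hm
      have : M.filter (fun p => ¬ p.1 ≠ a) = {(a, b')} := by
        ext ⟨x, y⟩
        simp only [ne_eq, not_not, Finset.mem_filter, Finset.mem_singleton, Prod.mk.injEq]
        constructor
        · rintro ⟨h, rfl⟩; exact ⟨rfl, hM.1.agent_unique _ _ _ h hb'⟩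
        · rintro ⟨rfl, rfl⟩; exact ⟨hb', rfl⟩
      rw [this, Finset.sum_singleton]
      dsimp only
      have h1 : (G.prefA a).idxOf b < (G.prefA a).idxOf b' := ha.2 b' hb'
      omega
    · have : M.filter (fun p => ¬ p.1 ≠ a) = ∅ := by
        ext ⟨x, y⟩
        simp only [ne_eq, not_not, Finset.mem_filter, Finset.notMem_empty, iff_false, not_and]
        rintro h rfl
        exact hm ⟨_, h⟩
      rw [this, Finset.sum_empty]; omega
  omega

/-- Only attainment of the infimum is needed: the bounds use one stable matching of that size. -/
theorem exists_isStable_card_eq (G : OneOneLQ) : ∃ M, G.IsStable M ∧ M.card = G.stableSize := by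
  obtain ⟨M, hM⟩ := G.exists_isStable
  exact Nat.sInf_mem (s := {s | ∃ M, G.IsStable M ∧ M.card = s}) ⟨M.card, M, hM, rfl⟩

theorem IsFeasible.card_lq_le (hF : G.IsFeasible M) :
    (Finset.univ.filter fun b => G.lq b = true).card ≤ M.card := by
  refine le_trans (Finset.card_le_card fun b hb => ?_) (Finset.card_image_le (f := Prod.snd))
  obtain ⟨a, ha⟩ := hF b (by simpa using hb)
  exact Finset.mem_image_of_mem Prod.snd ha

end Matchings

/-! ### Restriction to a set of edges -/

/-- `G'` is `G` restricted to the edges selected by `keep`, without the isolated vertices;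
`eA` and `eB` send the vertices of `G'` to those of `G`. -/
structure IsRestriction (G G' : OneOneLQ) (keep : Fin G.nA → Fin G.nB → Bool)
    (eA : Fin G'.nA → Fin G.nA) (eB : Fin G'.nB → Fin G.nB) : Prop where
  injA : Function.Injective eA
  injB : Function.Injective eB
  prefA_map : ∀ a, (G'.prefA a).map eB = (G.prefA (eA a)).filter (keep (eA a))
  prefB_map : ∀ b, (G'.prefB b).map eA = (G.prefB (eB b)).filter (fun a => keep a (eB b))
  lq_eq : ∀ b, G'.lq b = G.lq (eB b)
  surjA : ∀ a b, G.Edge a b → keep a b = true → ∃ a', eA a' = a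
  surjB : ∀ a b, G.Edge a b → keep a b = true → ∃ b', eB b' = b
  ne_nilA : ∀ a, G'.prefA a ≠ []
  ne_nilB : ∀ b, G'.prefB b ≠ []

/-- Filtering shifts positions but keeps the relative order of the survivors, and preferences are
comparisons of positions. -/
theorem _root_.List.idxOf_filter_lt_idxOf_filter {α : Type*} [DecidableEq α] {p : α → Bool}
    {l : List α} {x y : α} (hx : p x = true) (hy : p y = true) :
    (l.filter p).idxOf x < (l.filter p).idxOf y ↔ l.idxOf x < l.idxOf y := by
  induction l with
  | nil => simp
  | cons z l ih =>
    by_cases hz : p z = true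
    · rw [List.filter_cons_of_pos hz]
      by_cases h1 : z = x <;> by_cases h2 : z = y <;> simp_all
    · have h1 : z ≠ x := by rintro rfl; exact hz hx
      have h2 : z ≠ y := by rintro rfl; exact hz hy
      rw [List.filter_cons_of_neg hz, List.idxOf_cons_ne _ h1, List.idxOf_cons_ne _ h2, ih]
      simp

theorem _root_.List.idxOf_map_of_injective' {α β : Type*} [DecidableEq α] [DecidableEq β]
    {f : α → β} (hf : Function.Injective f) (l : List α) (x : α) :
    (l.map f).idxOf (f x) = l.idxOf x := by
  induction l with
  | nil => simp
  | cons z l ih => by_cases h : z = x <;> simp [ih, h, hf.eq_iff]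

namespace IsRestriction

variable {G G' : OneOneLQ} {keep : Fin G.nA → Fin G.nB → Bool}
  {eA : Fin G'.nA → Fin G.nA} {eB : Fin G'.nB → Fin G.nB}

theorem edge_iff (h : IsRestriction G G' keep eA eB) {a : Fin G'.nA} {b : Fin G'.nB} :
    G'.Edge a b ↔ G.Edge (eA a) (eB b) ∧ keep (eA a) (eB b) = true := by
  unfold Edge
  rw [← List.mem_map_of_injective h.injB, h.prefA_map, List.mem_filter]

theorem aPref_iff (h : IsRestriction G G' keep eA eB) {a : Fin G'.nA} {b b' : Fin G'.nB}
    (hb : G'.Edge a b) (hb' : G'.Edge a b') :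
    G'.APref a b b' ↔ G.APref (eA a) (eB b) (eB b') := by
  unfold APref
  rw [← List.idxOf_map_of_injective' h.injB, ← List.idxOf_map_of_injective' h.injB, h.prefA_map,
    List.idxOf_filter_lt_idxOf_filter (h.edge_iff.1 hb).2 (h.edge_iff.1 hb').2]

theorem bPref_iff (h : IsRestriction G G' keep eA eB) {b : Fin G'.nB} {a a' : Fin G'.nA}
    (ha : G'.Edge a b) (ha' : G'.Edge a' b) :
    G'.BPref b a a' ↔ G.BPref (eB b) (eA a) (eA a') := by
  unfold BPref
  rw [← List.idxOf_map_of_injective' h.injA, ← List.idxOf_map_of_injective' h.injA, h.prefB_map,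
    List.idxOf_filter_lt_idxOf_filter (p := fun a => keep a (eB b)) (h.edge_iff.1 ha).2
      (h.edge_iff.1 ha').2]

variable (eA eB) in
/-- The image of a matching of the restriction. -/
def push (M : Finset (Fin G'.nA × Fin G'.nB)) : Finset (Fin G.nA × Fin G.nB) :=
  M.image (Prod.map eA eB)

variable {M : Finset (Fin G'.nA × Fin G'.nB)}

theorem mem_push (h : IsRestriction G G' keep eA eB) {a : Fin G'.nA} {b : Fin G'.nB} :
    (eA a, eB b) ∈ push eA eB M ↔ (a, b) ∈ M :=
  (h.injA.prodMap h.injB).mem_finset_image (a := (a, b))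

theorem exists_of_mem_push {x : Fin G.nA} {y : Fin G.nB} (hxy : (x, y) ∈ push eA eB M) :
    ∃ a b, eA a = x ∧ eB b = y ∧ (a, b) ∈ M := by
  obtain ⟨⟨a, b⟩, hab, e⟩ := Finset.mem_image.1 hxy
  exact ⟨a, b, congrArg Prod.fst e, congrArg Prod.snd e, hab⟩

theorem card_push (h : IsRestriction G G' keep eA eB) : (push eA eB M).card = M.card :=
  Finset.card_image_of_injective _ (h.injA.prodMap h.injB)

theorem isMatching_push (h : IsRestriction G G' keep eA eB) :
    G'.IsMatching M ↔
      G.IsMatching (push eA eB M) ∧ ∀ a b, (a, b) ∈ push eA eB M → keep a b = true := by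
  constructor
  · intro hM
    refine ⟨⟨fun x y hxy => ?_, fun x y y' hxy hxy' => ?_, fun x x' y hxy hxy' => ?_⟩,
      fun x y hxy => ?_⟩
    · obtain ⟨a, b, rfl, rfl, hab⟩ := exists_of_mem_push hxy
      exact (h.edge_iff.1 (hM.edge _ _ hab)).1
    · obtain ⟨a, b, rfl, rfl, hab⟩ := exists_of_mem_push hxy
      obtain ⟨a', b', e, rfl, hab'⟩ := exists_of_mem_push hxy'
      obtain rfl := h.injA e
      rw [hM.agent_unique _ _ _ hab hab']
    · obtain ⟨a, b, rfl, rfl, hab⟩ := exists_of_mem_push hxy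
      obtain ⟨a', b', rfl, e, hab'⟩ := exists_of_mem_push hxy'
      obtain rfl := h.injB e
      rw [hM.resource_unique _ _ _ hab hab']
    · obtain ⟨a, b, rfl, rfl, hab⟩ := exists_of_mem_push hxy
      exact (h.edge_iff.1 (hM.edge _ _ hab)).2
  · rintro ⟨hM, hk⟩
    refine ⟨fun a b hab => ?_, fun a b b' hab hab' => ?_, fun a a' b hab hab' => ?_⟩
    · exact h.edge_iff.2 ⟨hM.edge _ _ (h.mem_push.2 hab), hk _ _ (h.mem_push.2 hab)⟩
    · exact h.injB (hM.agent_unique _ _ _ (h.mem_push.2 hab) (h.mem_push.2 hab'))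
    · exact h.injA (hM.resource_unique _ _ _ (h.mem_push.2 hab) (h.mem_push.2 hab'))

/-- A matching along kept edges touches only surviving vertices, so its preimage loses nothing. -/
theorem exists_push_eq (h : IsRestriction G G' keep eA eB) {N : Finset (Fin G.nA × Fin G.nB)}
    (hN : G.IsMatching N) (hk : ∀ a b, (a, b) ∈ N → keep a b = true) :
    ∃ M, G'.IsMatching M ∧ push eA eB M = N := by
  have hpush : push eA eB (Finset.univ.filter fun p => (eA p.1, eB p.2) ∈ N) = N := by
    ext ⟨x, y⟩
    constructor
    · intro hxy
      obtain ⟨a, b, rfl, rfl, hab⟩ := exists_of_mem_push hxy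
      simpa using hab
    · intro hxy
      obtain ⟨a, rfl⟩ := h.surjA _ _ (hN.edge _ _ hxy) (hk _ _ hxy)
      obtain ⟨b, rfl⟩ := h.surjB _ _ (hN.edge _ _ hxy) (hk _ _ hxy)
      exact h.mem_push.2 (by simpa using hxy)
  exact ⟨_, h.isMatching_push.2 (by rw [hpush]; exact ⟨hN, hk⟩), hpush⟩

/-- Partners in `M` are neighbours in `G'`, so every comparison involved is between ends of kept
edges. -/
theorem aImproves_push (h : IsRestriction G G' keep eA eB) (hM : G'.IsMatching M)
    {a : Fin G'.nA} {b : Fin G'.nB} (hab : G'.Edge a b) :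
    G.AImproves (push eA eB M) (eA a) (eB b) ↔ G'.AImproves M a b := by
  constructor
  · intro hi b' hb'
    exact (h.aPref_iff hab (hM.edge _ _ hb')).2 (hi _ (h.mem_push.2 hb'))
  · intro hi y hy
    obtain ⟨a', b', e, rfl, hab'⟩ := exists_of_mem_push hy
    obtain rfl := h.injA e
    exact (h.aPref_iff hab (hM.edge _ _ hab')).1 (hi _ hab')

theorem bImproves_push (h : IsRestriction G G' keep eA eB) (hM : G'.IsMatching M)
    {a : Fin G'.nA} {b : Fin G'.nB} (hab : G'.Edge a b) :
    G.BImproves (push eA eB M) (eB b) (eA a) ↔ G'.BImproves M b a := by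
  constructor
  · intro hi b' hb'
    exact (h.bPref_iff hab (hM.edge _ _ hb')).2 (hi _ (h.mem_push.2 hb'))
  · intro hi y hy
    obtain ⟨a', b', rfl, e, hab'⟩ := exists_of_mem_push hy
    obtain rfl := h.injB e
    exact (h.bPref_iff hab (hM.edge _ _ hab')).1 (hi _ hab')

theorem blocks_push (h : IsRestriction G G' keep eA eB) (hM : G'.IsMatching M)
    {a : Fin G'.nA} {b : Fin G'.nB} :
    G'.Blocks M a b ↔
      G.Blocks (push eA eB M) (eA a) (eB b) ∧ keep (eA a) (eB b) = true := by
  unfold Blocks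
  constructor
  · rintro ⟨he, hm, h1, h2⟩
    exact ⟨⟨(h.edge_iff.1 he).1, mt h.mem_push.1 hm, (h.aImproves_push hM he).2 h1,
      (h.bImproves_push hM he).2 h2⟩, (h.edge_iff.1 he).2⟩
  · rintro ⟨⟨he, hm, h1, h2⟩, hk⟩
    have he := h.edge_iff.2 ⟨he, hk⟩
    exact ⟨he, mt h.mem_push.2 hm, (h.aImproves_push hM he).1 h1, (h.bImproves_push hM he).1 h2⟩

/-- Every blocking pair along a selected edge comes from the restriction. -/
theorem exists_blocks_of_keep (h : IsRestriction G G' keep eA eB) (hM : G'.IsMatching M)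
    {x : Fin G.nA} {y : Fin G.nB} (hb : G.Blocks (push eA eB M) x y) (hk : keep x y = true) :
    ∃ a b, eA a = x ∧ eB b = y ∧ G'.Blocks M a b := by
  obtain ⟨a, rfl⟩ := h.surjA _ _ hb.1 hk
  obtain ⟨b, rfl⟩ := h.surjB _ _ hb.1 hk
  exact ⟨a, b, rfl, rfl, (h.blocks_push hM).2 ⟨hb, hk⟩⟩

/-- Fewer edges give fewer reasons for envy or blocking, so this direction holds for every choice of
`keep`. The way back from `G'` to `G` depends on the deletion rule. -/
theorem isEnvyFree_of_push (h : IsRestriction G G' keep eA eB) (hM : G'.IsMatching M)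
    (hE : G.IsEnvyFree (push eA eB M)) : G'.IsEnvyFree M := by
  refine ⟨hM, fun a a' => ?_⟩
  rintro ⟨b, h1, h2, h3, h4⟩
  exact hE.2 (eA a) (eA a') ⟨eB b, h.mem_push.2 h1, (h.edge_iff.1 h2).1,
    (h.aImproves_push hM h2).2 h3, (h.bPref_iff h2 (hM.edge _ _ h1)).1 h4⟩

theorem isStable_of_push (h : IsRestriction G G' keep eA eB) (hM : G'.IsMatching M)
    (hS : G.IsStable (push eA eB M)) : G'.IsStable M :=
  ⟨hM, fun _ _ hb => hS.2 _ _ ((h.blocks_push hM).1 hb).1⟩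

theorem isRelaxedStable_of_push (h : IsRestriction G G' keep eA eB) (hM : G'.IsMatching M)
    (hS : G.IsRelaxedStable (push eA eB M)) : G'.IsRelaxedStable M := by
  refine ⟨hM, fun a b hb => ?_⟩
  obtain ⟨y, hy, hl⟩ := hS.2 _ _ ((h.blocks_push hM).1 hb).1
  obtain ⟨a', b', e, rfl, hab'⟩ := exists_of_mem_push hy
  obtain rfl := h.injA e
  exact ⟨b', hab', by rw [h.lq_eq, hl]⟩

theorem isFeasible_of_push (h : IsRestriction G G' keep eA eB)
    (hF : G.IsFeasible (push eA eB M)) : G'.IsFeasible M := by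
  intro b hb
  obtain ⟨x, hx⟩ := hF (eB b) (by rw [← h.lq_eq, hb])
  obtain ⟨a', b', rfl, e, hab'⟩ := exists_of_mem_push hx
  obtain rfl := h.injB e
  exact ⟨a', hab'⟩

theorem isFeasible_push (h : IsRestriction G G' keep eA eB)
    (hs : ∀ b, G.lq b = true → ∃ b', eB b' = b) (hF : G'.IsFeasible M) :
    G.IsFeasible (push eA eB M) := by
  intro y hy
  obtain ⟨b, rfl⟩ := hs y hy
  obtain ⟨a, ha⟩ := hF b (by rw [h.lq_eq, hy])
  exact ⟨eA a, h.mem_push.2 ha⟩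

/-- Losing an LQ resource would weaken the feasibility requirement; one feasible matching of kept
edges rules this out. -/
theorem surjB_of_isFeasible (h : IsRestriction G G' keep eA eB)
    {N : Finset (Fin G.nA × Fin G.nB)} (hN : G.IsMatching N)
    (hk : ∀ a b, (a, b) ∈ N → keep a b = true) (hF : G.IsFeasible N) :
    ∀ b, G.lq b = true → ∃ b', eB b' = b := by
  intro b hb
  obtain ⟨a, ha⟩ := hF b hb
  exact h.surjB a b (hN.edge _ _ ha) (hk _ _ ha)

end IsRestriction

end OneOneLQ

/-! ### Deletion rules and the edges that solutions use -/

namespace OneOneLQ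

section Kernels

variable {G G' : OneOneLQ} {L : ℕ}

/-- Pigeonhole. Usually `X` is the set of matched vertices on one side, and the result is an
unmatched vertex near the top of a list. -/
theorem _root_.List.Nodup.exists_idxOf_lt_notMem {α : Type*} [DecidableEq α] {l : List α}
    (hl : l.Nodup) {X : Finset α} {n : ℕ} (hX : X.card < n) (hn : n ≤ l.length) :
    ∃ x ∈ l, l.idxOf x < n ∧ x ∉ X := by
  by_contra! hc
  have h1 : (l.take n).toFinset ⊆ X := fun x hx => by
    have hx : x ∈ l.take n := by simpa using hx
    exact hc x (List.mem_of_mem_take hx)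
      ((List.mem_take_iff_idxOf_lt (List.mem_of_mem_take hx)).1 hx)
  have h2 := Finset.card_le_card h1
  rw [List.toFinset_card_of_nodup (hl.sublist (List.take_sublist n l)), List.length_take] at h2
  omega

/-- Otherwise one of the first `L` agents on the list of `b` is unmatched and envies `a`. -/
theorem IsEnvyFree.idxOf_lt {M : Finset (Fin G.nA × Fin G.nB)} (hM : G.IsEnvyFree M)
    (hL : M.card < L) {a : Fin G.nA} {b : Fin G.nB} (hab : (a, b) ∈ M) :
    (G.prefB b).idxOf a < L := by
  by_contra! hc
  have ha := edge_iff_mem_prefB.1 (hM.1.edge _ _ hab)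
  obtain ⟨x, hx, hlt, hu⟩ := (G.nodupB b).exists_idxOf_lt_notMem
    (hM.1.card_image_fst.trans_lt hL) (hc.trans (List.idxOf_lt_length_of_mem ha).le)
  exact hM.2 x a ⟨b, hab, edge_iff_mem_prefB.2 hx,
    fun b' h => absurd (Finset.mem_image_of_mem Prod.fst h) hu, hlt.trans_le hc⟩

/-- Agents above `M(b)` on the list of `b` are matched in a relaxed stable matching. -/
theorem IsRelaxedStable.idxOf_lt {M : Finset (Fin G.nA × Fin G.nB)} (hM : G.IsRelaxedStable M)
    (hL : M.card < L) {a : Fin G.nA} {b : Fin G.nB} (hab : (a, b) ∈ M) :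
    (G.prefB b).idxOf a < L := by
  by_contra! hc
  have ha := edge_iff_mem_prefB.1 (hM.1.edge _ _ hab)
  obtain ⟨x, hx, hlt, hu⟩ := (G.nodupB b).exists_idxOf_lt_notMem
    (hM.1.card_image_fst.trans_lt hL) (hc.trans (List.idxOf_lt_length_of_mem ha).le)
  have hu' : ∀ b', (x, b') ∉ M := fun b' h => hu (Finset.mem_image_of_mem Prod.fst h)
  obtain ⟨b', hb', -⟩ := hM.2 x b ⟨edge_iff_mem_prefB.2 hx, hu' b, fun b' h => absurd h (hu' b'),
    fun a' h => by rw [hM.1.resource_unique _ _ _ h hab]; exact hlt.trans_le hc⟩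
  exact hu' b' hb'

/-- As `a` is matched to a non-LQ resource it belongs to no blocking pair, so no resource it prefers
to `b` is unmatched. -/
theorem IsRelaxedStable.idxOf_lt_of_lq {M : Finset (Fin G.nA × Fin G.nB)}
    (hM : G.IsRelaxedStable M) (hL : M.card < L) {a : Fin G.nA} {b : Fin G.nB}
    (hab : (a, b) ∈ M) (hb : G.lq b = false) : (G.prefA a).idxOf b < L := by
  by_contra! hc
  have ha : b ∈ G.prefA a := hM.1.edge _ _ hab
  obtain ⟨x, hx, hlt, hu⟩ := (G.nodupA a).exists_idxOf_lt_notMem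
    (hM.1.card_image_snd.trans_lt hL) (hc.trans (List.idxOf_lt_length_of_mem ha).le)
  have hu' : ∀ a', (a', x) ∉ M := fun a' h => hu (Finset.mem_image_of_mem Prod.snd h)
  obtain ⟨b', hb', hl⟩ := hM.2 a x ⟨hx, hu' a,
    fun b' h => by rw [hM.1.agent_unique _ _ _ h hab]; exact hlt.trans_le hc,
    fun a' h => absurd h (hu' a')⟩
  rw [hM.1.agent_unique _ _ _ hb' hab, hb] at hl
  exact absurd hl (by simp)

theorem IsStable.isRelaxedStable {M : Finset (Fin G.nA × Fin G.nB)} (hM : G.IsStable M) :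
    G.IsRelaxedStable M :=
  ⟨hM.1, fun a b h => absurd h (hM.2 a b)⟩

variable (G L) in
/-- A resource of lower quota `0` with a single neighbour. -/
def isPrivate (b : Fin G.nB) : Bool := decide ((G.prefB b).length = 1 ∧ G.lq b = false)

variable (G L) in
/-- The edges that are kept by the kernel for `MaxEFM`: the agent is among the first `L` on the list
of the resource, and the resource is not private unless it is the agent's best private one. -/
def efmKeep (a : Fin G.nA) (b : Fin G.nB) : Bool :=
  decide ((G.prefB b).idxOf a < L ∧ ¬ (G.isPrivate b = true ∧
    ∃ b' ∈ G.prefA a, G.isPrivate b' = true ∧ (G.prefA a).idxOf b' < (G.prefA a).idxOf b))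

variable (G L) in
/-- The edges that are kept by the kernel for `MaxRSM`. -/
def rsmKeep (a : Fin G.nA) (b : Fin G.nB) : Bool :=
  decide ((G.prefB b).idxOf a < L ∧ (G.lq b = true ∨ (G.prefA a).idxOf b < L + L))

theorem eq_of_isPrivate {a a' : Fin G.nA} {b : Fin G.nB} (hb : G.isPrivate b = true)
    (h : G.Edge a b) (h' : G.Edge a' b) : a = a' := by
  obtain ⟨x, hx⟩ := List.length_eq_one_iff.1 (of_decide_eq_true hb).1
  rw [edge_iff_mem_prefB, hx, List.mem_singleton] at h h'
  rw [h, h']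

/-- Phrased for all pairs `a`, `b`, so that `choose` yields a replacement map that fixes the
resources that are not private. -/
theorem exists_best_private (a : Fin G.nA) (b : Fin G.nB) : ∃ c,
    (G.isPrivate b = false → c = b) ∧ (G.Edge a b → G.isPrivate b = true →
      G.Edge a c ∧ G.isPrivate c = true ∧ ∀ b', G.Edge a b' → G.isPrivate b' = true →
        (G.prefA a).idxOf c ≤ (G.prefA a).idxOf b') := by
  by_cases h : G.Edge a b ∧ G.isPrivate b = true
  · obtain ⟨c, hc, hm⟩ := Finset.exists_min_image
      (Finset.univ.filter fun b => b ∈ G.prefA a ∧ G.isPrivate b = true)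
      (fun b => (G.prefA a).idxOf b) ⟨b, by simpa [Edge] using h⟩
    simp only [Finset.mem_filter, Finset.mem_univ, true_and] at hc hm
    exact ⟨c, fun h' => by simp [h.2] at h', fun _ _ => ⟨hc.1, hc.2, fun b' h1 h2 => hm _ ⟨h1, h2⟩⟩⟩
  · exact ⟨b, fun _ => rfl, fun h1 h2 => absurd ⟨h1, h2⟩ h⟩

/-- Private resources can be replaced by best private ones. -/
theorem IsEnvyFree.exists_efmKeep {M : Finset (Fin G.nA × Fin G.nB)} (hM : G.IsEnvyFree M)
    (hF : G.IsFeasible M) (hL : M.card < L) :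
    ∃ N, G.IsEnvyFree N ∧ G.IsFeasible N ∧ N.card = M.card ∧
      ∀ a b, (a, b) ∈ N → G.efmKeep L a b = true := by
  choose g hg using exists_best_private (G := G)
  have hcard : (M.image fun p => (p.1, g p.1 p.2)).card = M.card := by
    refine Finset.card_image_of_injOn ?_
    rintro ⟨a, b⟩ h ⟨a', b'⟩ h' e
    exact hM.1.injOn_fst h h' (congrArg Prod.fst e :)
  have hmem : ∀ x y, (x, y) ∈ M.image (fun p => (p.1, g p.1 p.2)) ↔
      ∃ b, (x, b) ∈ M ∧ g x b = y := by simp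
  generalize M.image (fun p => (p.1, g p.1 p.2)) = N at hcard hmem
  -- Only private resources are exchanged, and only for private ones that the agent likes at least
  -- as much.
  have hpriv : ∀ x b, (x, b) ∈ M → g x b ≠ b → G.isPrivate (g x b) = true := by
    intro x b h hne
    by_cases hb : G.isPrivate b = true
    · exact ((hg x b).2 (hM.1.edge _ _ h) hb).2.1
    · exact absurd ((hg x b).1 (by simpa using hb)) hne
  have hedge : ∀ x b, (x, b) ∈ M → G.Edge x (g x b) := by
    intro x b h
    by_cases hb : G.isPrivate b = true
    · exact ((hg x b).2 (hM.1.edge _ _ h) hb).1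
    · rw [(hg x b).1 (by simpa using hb)]; exact hM.1.edge _ _ h
  have hidx : ∀ x b, (x, b) ∈ M → (G.prefA x).idxOf (g x b) ≤ (G.prefA x).idxOf b := by
    intro x b h
    by_cases hb : G.isPrivate b = true
    · exact ((hg x b).2 (hM.1.edge _ _ h) hb).2.2 _ (hM.1.edge _ _ h) hb
    · rw [(hg x b).1 (by simpa using hb)]
  have hE : G.IsEnvyFree N := by
    refine ⟨⟨fun x y h => ?_, fun x y y' h h' => ?_, fun x x' y h h' => ?_⟩, ?_⟩
    · obtain ⟨b, hb, rfl⟩ := (hmem _ _).1 h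
      exact hedge _ _ hb
    · obtain ⟨b, hb, rfl⟩ := (hmem _ _).1 h
      obtain ⟨b', hb', rfl⟩ := (hmem _ _).1 h'
      rw [hM.1.agent_unique _ _ _ hb hb']
    · obtain ⟨b, hb, rfl⟩ := (hmem _ _).1 h
      obtain ⟨b', hb', e⟩ := (hmem _ _).1 h'
      by_cases hp : G.isPrivate (g x b) = true
      -- No collisions: a private resource has one neighbour, and any other resource has not been
      -- exchanged.
      · exact eq_of_isPrivate hp (hedge _ _ hb) (e ▸ hedge _ _ hb')
      · have h1 : g x b = b := by_contra fun hne => hp (hpriv _ _ hb hne)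
        have h2 : g x' b' = b' := by_contra fun hne => hp (e ▸ hpriv _ _ hb' hne)
        have h3 : b = b' := by rw [← h1, ← h2, e]
        exact hM.1.resource_unique x x' b hb (h3 ▸ hb')
    · rintro x x' ⟨y, h1, h2, h3, h4⟩
      obtain ⟨b, hb, rfl⟩ := (hmem _ _).1 h1
      by_cases hp : G.isPrivate (g x' b) = true
      · obtain rfl := eq_of_isPrivate hp (hedge _ _ hb) h2
        exact lt_irrefl _ h4
      -- The envied resource is unchanged and the agents have only improved (`hidx`), so this envy
      -- already existed in `M`.
      · have h5 : g x' b = b := by_contra fun hne => hp (hpriv _ _ hb hne)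
        rw [h5] at h2 h3 h4
        exact hM.2 x x' ⟨b, hb, h2, fun b' hb' =>
          lt_of_lt_of_le (h3 _ ((hmem _ _).2 ⟨b', hb', rfl⟩)) (hidx _ _ hb'), h4⟩
  refine ⟨N, hE, fun b hb => ?_, hcard, fun x y h => ?_⟩
  · obtain ⟨a, ha⟩ := hF b hb
    exact ⟨a, (hmem _ _).2 ⟨b, ha, (hg a b).1 (by simp [isPrivate, hb])⟩⟩
  · refine decide_eq_true ⟨hE.idxOf_lt (hcard.trans_lt hL) h, ?_⟩
    rintro ⟨h1, b', h2, h3, h4⟩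
    obtain ⟨b, hb, rfl⟩ := (hmem _ _).1 h
    by_cases hp : G.isPrivate b = true
    · exact absurd (((hg x b).2 (hM.1.edge _ _ hb) hp).2.2 b' h2 h3) (not_le.2 h4)
    · rw [(hg x b).1 (by simpa using hp)] at h1
      exact hp h1

theorem IsRelaxedStable.rsmKeep {M : Finset (Fin G.nA × Fin G.nB)} (hM : G.IsRelaxedStable M)
    (hL : M.card < L) {a : Fin G.nA} {b : Fin G.nB} (hab : (a, b) ∈ M) :
    G.rsmKeep L a b = true := by
  refine decide_eq_true ⟨hM.idxOf_lt hL hab, ?_⟩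
  by_cases hb : G.lq b = true
  · exact Or.inl hb
  -- Position below `L` is what holds here; the slack up to `L + L` serves the converse direction.
  · exact Or.inr ((hM.idxOf_lt_of_lq hL hab (by simpa using hb)).trans_le (by omega))

/-! ### Correctness and size of the kernel for `MaxEFM` -/

section EFM

variable {eA : Fin G'.nA → Fin G.nA} {eB : Fin G'.nB → Fin G.nB}

/-- Envy at `y` involves two neighbours of `y`, so `y` is not private; the envying agent stands
above a kept partner, so its position is below `L`. The envying edge is therefore kept and the envy
is visible in `G'`. -/
theorem IsRestriction.isEnvyFree_push_efm (h : IsRestriction G G' (G.efmKeep L) eA eB)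
    {M : Finset (Fin G'.nA × Fin G'.nB)} (hM : G'.IsEnvyFree M) :
    G.IsEnvyFree (IsRestriction.push eA eB M) := by
  have hP := h.isMatching_push.1 hM.1
  refine ⟨hP.1, ?_⟩
  rintro x x' ⟨y, h1, h2, h3, h4⟩
  have hk := of_decide_eq_true (hP.2 _ _ h1)
  have hk' : G.efmKeep L x y = true := by
    refine decide_eq_true ⟨h4.trans hk.1, ?_⟩
    rintro ⟨hp, -⟩
    obtain rfl := eq_of_isPrivate hp h2 (hP.1.edge _ _ h1)
    exact lt_irrefl _ h4
  obtain ⟨a', b, rfl, rfl, hab⟩ := IsRestriction.exists_of_mem_push h1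
  obtain ⟨a, rfl⟩ := h.surjA _ _ h2 hk'
  have he := h.edge_iff.2 ⟨h2, hk'⟩
  exact hM.2 a a' ⟨b, hab, he, (h.aImproves_push hM.1 he).1 h3,
    (h.bPref_iff he (hM.1.edge _ _ hab)).2 h4⟩

/-- The cut-off at `L` is exact: matchings of `G'` push forward to matchings of `G` of the same
size, so they too have fewer than `L` edges. -/
theorem IsRestriction.efm_kernel (h : IsRestriction G G' (G.efmKeep L) eA eB)
    (hL : ∀ M, G.IsMatching M → M.card < L) (hC : ∃ M, G.IsFeasible M ∧ G.IsEnvyFree M) (k : ℕ) :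
    (∃ M, G'.IsFeasible M ∧ G'.IsEnvyFree M) ∧ (G.MaxEFM k ↔ G'.MaxEFM (min k L)) := by
  have key : ∀ M, G.IsFeasible M → G.IsEnvyFree M →
      ∃ M', G'.IsFeasible M' ∧ G'.IsEnvyFree M' ∧ M'.card = M.card ∧
        ∀ b, G.lq b = true → ∃ b', eB b' = b := by
    intro M hF hE
    obtain ⟨N, hN, hNF, hc, hk⟩ := hE.exists_efmKeep hF (hL M hE.1)
    obtain ⟨M', hM', rfl⟩ := h.exists_push_eq hN.1 hk
    exact ⟨M', h.isFeasible_of_push hNF, h.isEnvyFree_of_push hM' hN, by rw [← hc, h.card_push],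
      h.surjB_of_isFeasible hN.1 hk hNF⟩
  obtain ⟨M, hF, hE⟩ := hC
  obtain ⟨M', hF', hE', -, hs⟩ := key M hF hE
  refine ⟨⟨M', hF', hE'⟩, ?_, ?_⟩
  · rintro ⟨M, hF, hE, hk⟩
    obtain ⟨M', hF', hE', hc, -⟩ := key M hF hE
    exact ⟨M', hF', hE', by omega⟩
  · rintro ⟨M', hF', hE', hk⟩
    have hE := h.isEnvyFree_push_efm hE'
    have := hL _ hE.1
    rw [h.card_push] at this
    exact ⟨_, h.isFeasible_push hs hF', hE, by rw [h.card_push]; omega⟩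

/-- Each surviving agent has a kept edge. Either the agent is in the cover, or the resource is and
the agent is among the first `L` on its list. -/
theorem IsRestriction.nA_le (keep : Fin G.nA → Fin G.nB → Bool)
    (h : IsRestriction G G' keep eA eB)
    (hk : ∀ a b, keep a b = true → (G.prefB b).idxOf a < L) :
    G'.nA ≤ G.stableSize + G.stableSize * L := by
  obtain ⟨S, hS, hs⟩ := G.exists_isStable_card_eq
  have h1 : Finset.univ.image eA ⊆ S.image Prod.fst ∪
      (S.image Prod.snd).biUnion (fun b => ((G.prefB b).take L).toFinset) := by
    intro x hx
    obtain ⟨a, -, rfl⟩ := Finset.mem_image.1 hx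
    obtain ⟨b, hb⟩ := List.exists_mem_of_ne_nil _ (h.ne_nilA a)
    have he := h.edge_iff.1 hb
    rcases hS.cover he.1 with h2 | h2
    · exact Finset.mem_union_left _ h2
    · refine Finset.mem_union_right _ (Finset.mem_biUnion.2 ⟨_, h2, ?_⟩)
      rw [List.mem_toFinset, List.mem_take_iff_idxOf_lt (edge_iff_mem_prefB.1 he.1)]
      exact hk _ _ he.2
  have h2 := Finset.card_le_card h1
  rw [Finset.card_image_of_injective _ h.injA, Finset.card_univ, Fintype.card_fin] at h2
  refine h2.trans ((Finset.card_union_le _ _).trans (Nat.add_le_add ?_ ?_))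
  · rw [hS.1.card_image_fst, hs]
  · refine (Finset.card_biUnion_le_card_mul _ _ L fun b _ => ?_).trans ?_
    · exact (List.toFinset_card_le _).trans (by simp)
    · rw [hS.1.card_image_snd, hs]

theorem commonNonLQ_card_le {a a' : Fin G.nA} (h : a ≠ a') :
    (G.commonNonLQ a a').card ≤ G.commonParam :=
  Finset.le_sup (f := fun p : Fin G.nA × Fin G.nA => (G.commonNonLQ p.1 p.2).card)
    (Finset.mem_filter.2 ⟨Finset.mem_univ (a, a'), h⟩)

/-- The four summands count the resources matched in `S`, the LQ resources, one private resource per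
agent of `S`, and the non-LQ resources common to two agents of `S`. -/
theorem IsRestriction.nB_le_efm (h : IsRestriction G G' (G.efmKeep L) eA eB)
    (hL : ∀ M, G.IsMatching M → M.card < L) (hC : ∃ M, G.IsFeasible M ∧ G.IsMatching M) :
    G'.nB ≤ G.stableSize + L + G.stableSize + G.stableSize * G.stableSize * G.commonParam := by
  obtain ⟨S, hS, hs⟩ := G.exists_isStable_card_eq
  obtain ⟨F, hF, hFM⟩ := hC
  have h1 : Finset.univ.image eB ⊆ S.image Prod.snd ∪
      Finset.univ.filter (fun b => G.lq b = true) ∪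
      (S.image Prod.fst).biUnion (fun a => Finset.univ.filter fun b =>
        b ∈ G.prefA a ∧ G.isPrivate b = true ∧ G.efmKeep L a b = true) ∪
      ((S.image Prod.fst ×ˢ S.image Prod.fst).filter fun p => p.1 ≠ p.2).biUnion
        (fun p => G.commonNonLQ p.1 p.2) := by
    intro y hy
    obtain ⟨b, -, rfl⟩ := Finset.mem_image.1 hy
    obtain ⟨a, ha⟩ := List.exists_mem_of_ne_nil _ (h.ne_nilB b)
    have he := h.edge_iff.1 (edge_iff_mem_prefB.2 ha)
    by_cases hb : eB b ∈ S.image Prod.snd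
    · simp only [Finset.mem_union, hb, true_or]
    -- All neighbours of a resource that is unmatched in `S` are in the agent side of the cover.
    have hA : ∀ x, G.Edge x (eB b) → x ∈ S.image Prod.fst := fun x hx =>
      (hS.cover hx).resolve_right hb
    by_cases hq : G.lq (eB b) = true
    · exact Finset.mem_union_left _ (Finset.mem_union_left _ (Finset.mem_union_right _
        (by simpa using hq)))
    rw [Bool.not_eq_true] at hq
    by_cases hp : G.isPrivate (eB b) = true
    · refine Finset.mem_union_left _ (Finset.mem_union_right _ (Finset.mem_biUnion.2
        ⟨eA a, hA _ he.1, ?_⟩))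
      simpa using ⟨he.1, hp, he.2⟩
    -- Not LQ and not private, so there is a second neighbour and `t` applies to the pair.
    · obtain ⟨x, hx, hne⟩ : ∃ x, G.Edge x (eB b) ∧ eA a ≠ x := by
        by_contra! hcon
        refine hp (decide_eq_true ⟨le_antisymm ?_ ?_, hq⟩)
        · have := List.toFinset_card_of_nodup (G.nodupB (eB b))
          rw [← this]
          refine Finset.card_le_one.2 fun x hx y hy => ?_
          rw [← hcon x (edge_iff_mem_prefB.2 (by simpa using hx)),
            ← hcon y (edge_iff_mem_prefB.2 (by simpa using hy))]
        · exact List.length_pos_of_mem (edge_iff_mem_prefB.1 he.1)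
      refine Finset.mem_union_right _ (Finset.mem_biUnion.2 ⟨(eA a, x), ?_, ?_⟩)
      · simpa [hne] using ⟨by simpa using hA _ he.1, by simpa using hA _ hx⟩
      · exact Finset.mem_filter.2 ⟨Finset.mem_univ _, he.1, hx, hq⟩
  have h2 := Finset.card_le_card h1
  rw [Finset.card_image_of_injective _ h.injB, Finset.card_univ, Fintype.card_fin] at h2
  have hSf : (S.image Prod.fst).card = G.stableSize := by rw [hS.1.card_image_fst, hs]
  refine h2.trans ((Finset.card_union_le _ _).trans (Nat.add_le_add
    ((Finset.card_union_le _ _).trans (Nat.add_le_add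
      ((Finset.card_union_le _ _).trans (Nat.add_le_add ?_ ?_)) ?_)) ?_))
  · rw [hS.1.card_image_snd, hs]
  · exact hF.card_lq_le.trans (hL _ hFM).le
  · refine (Finset.card_biUnion_le_card_mul _ _ 1 fun a _ => ?_).trans (by rw [hSf, mul_one])
    refine Finset.card_le_one.2 fun b hb b' hb' => ?_
    simp only [Finset.mem_filter, Finset.mem_univ, true_and] at hb hb'
    have e1 := (of_decide_eq_true hb.2.2).2
    have e2 := (of_decide_eq_true hb'.2.2).2
    -- Two kept private resources of one agent would each have to be the best, so they have the same
    -- position.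
    have e3 : ¬ (G.prefA a).idxOf b' < (G.prefA a).idxOf b := fun hlt =>
      e1 ⟨hb.2.1, b', hb'.1, hb'.2.1, hlt⟩
    have e4 : ¬ (G.prefA a).idxOf b < (G.prefA a).idxOf b' := fun hlt =>
      e2 ⟨hb'.2.1, b, hb.1, hb.2.1, hlt⟩
    exact (List.idxOf_inj hb.1).1 (by omega)
  · refine (Finset.card_biUnion_le_card_mul _ _ G.commonParam fun p hp => ?_).trans ?_
    · exact commonNonLQ_card_le (Finset.mem_filter.1 hp).2
    · refine Nat.mul_le_mul_right _ ((Finset.card_filter_le _ _).trans ?_)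
      rw [Finset.card_product, hSf]

end EFM

/-! ### Correctness and size of the kernel for `MaxRSM` -/

section RSM

variable {eA : Fin G'.nA → Fin G.nA} {eB : Fin G'.nB → Fin G.nB}

/-- There are fewer than `L` resources with at least `L` neighbours. -/
theorem exists_cover_of_large_degree (hL : ∀ M, G.IsMatching M → M.card < L) :
    ∃ D : Finset (Fin G.nB), D.card < L ∧ ∀ b, L ≤ (G.prefB b).length → b ∈ D := by
  obtain ⟨S, hS⟩ := G.exists_isStable
  refine ⟨S.image Prod.snd, by rw [hS.1.card_image_snd]; exact hL _ hS.1, fun b hb => ?_⟩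
  by_contra hc
  -- With `L` neighbours, `b` has one that is unmatched in `S`; the cover property then forces `b`
  -- to be matched.
  obtain ⟨x, hx, -, hu⟩ := (G.nodupB b).exists_idxOf_lt_notMem
    (hS.1.card_image_fst.trans_lt (hL _ hS.1)) hb
  rcases hS.cover (edge_iff_mem_prefB.2 hx) with h | h
  exacts [hu h, hc h]

/-- Kept blocking edges are handled inside `G'`. A deleted blocking edge either starts at an agent
matched to an LQ resource or forces an unmatched agent with a long list or a kept edge between
unmatched vertices, both impossible. -/
theorem IsRestriction.isRelaxedStable_push_rsm (h : IsRestriction G G' (G.rsmKeep L) eA eB)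
    (hL : ∀ M, G.IsMatching M → M.card < L) {M : Finset (Fin G'.nA × Fin G'.nB)}
    (hM : G'.IsRelaxedStable M) : G.IsRelaxedStable (IsRestriction.push eA eB M) := by
  have hP := h.isMatching_push.1 hM.1
  have hkeep : ∀ x y, G.Blocks (IsRestriction.push eA eB M) x y → G.rsmKeep L x y = true →
      ∃ y', (x, y') ∈ IsRestriction.push eA eB M ∧ G.lq y' = true := by
    intro x y hb hk
    obtain ⟨a, b, rfl, rfl, hb'⟩ := h.exists_blocks_of_keep hM.1 hb hk
    obtain ⟨b', hab', hl⟩ := hM.2 a b hb'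
    exact ⟨eB b', h.mem_push.2 hab', by rw [← h.lq_eq, hl]⟩
  generalize hN : IsRestriction.push eA eB M = N at *
  clear hN
  have hcard := hL N hP.1
  -- A kept edge between unmatched vertices would block, but its agent has no partner at all.
  have hunm : ∀ x y, (∀ y', (x, y') ∉ N) → (∀ x', (x', y) ∉ N) → G.Edge x y →
      G.rsmKeep L x y = true → False := by
    intro x y hx hy he hk
    obtain ⟨y', hy', -⟩ := hkeep x y ⟨he, hx y, fun b' h => absurd h (hx b'),
      fun a' h => absurd h (hy a')⟩ hk
    exact hx y' hy'
  -- Here `L + L` is needed: excluding fewer than `L` matched resources and fewer than `L` of large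
  -- degree leaves some `y` among the first `L + L`. The degree of `y` is below `L`, so `x` is
  -- within its first `L` and the edge is kept.
  have hlong : ∀ x, (∀ y', (x, y') ∉ N) → L + L ≤ (G.prefA x).length → False := by
    intro x hx hlen
    obtain ⟨D, hD, hD'⟩ := exists_cover_of_large_degree hL
    have hc : (N.image Prod.snd ∪ D).card < L + L :=
      (Finset.card_union_le _ _).trans_lt (by rw [hP.1.card_image_snd]; omega)
    obtain ⟨y, hy, hlt, hu⟩ := (G.nodupA x).exists_idxOf_lt_notMem hc hlen
    rw [Finset.mem_union, not_or] at hu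
    refine hunm x y hx (fun x' h => hu.1 (Finset.mem_image_of_mem Prod.snd h)) hy
      (decide_eq_true ⟨?_, Or.inr hlt⟩)
    have h1 := List.idxOf_lt_length_of_mem (edge_iff_mem_prefB.1 (show G.Edge x y from hy))
    have h2 := mt (hD' y) hu.2
    omega
  refine ⟨hP.1, fun x y hb => ?_⟩
  by_cases hk : G.rsmKeep L x y = true
  · exact hkeep x y hb hk
  by_cases h1 : (G.prefB y).idxOf x < L
  · have h2 : ¬ (G.lq y = true ∨ (G.prefA x).idxOf y < L + L) := fun h2 =>
      hk (decide_eq_true ⟨h1, h2⟩)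
    rw [not_or, not_lt] at h2
    by_cases hx : ∃ y', (x, y') ∈ N
    · obtain ⟨y', hy'⟩ := hx
      -- The partner `y'` comes after `y`, hence beyond the first `L + L`; such an edge is kept only
      -- if `y'` is LQ.
      refine ⟨y', hy', ((of_decide_eq_true (hP.2 _ _ hy')).2).resolve_right ?_⟩
      have h3 : (G.prefA x).idxOf y < (G.prefA x).idxOf y' := hb.2.2.1 y' hy'
      omega
    · push Not at hx
      exact (hlong x hx (h2.2.trans (List.idxOf_lt_length_of_mem hb.1).le)).elim
  · exfalso
    rw [not_lt] at h1
    -- A partner of `y` has position below `L`, so `y` would prefer it to `x`.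
    have hy : ∀ x', (x', y) ∉ N := by
      intro x' hx'
      have h2 : (G.prefB y).idxOf x < (G.prefB y).idxOf x' := hb.2.2.2 x' hx'
      have h3 := (of_decide_eq_true (hP.2 _ _ hx')).1
      omega
    obtain ⟨z, hz, hlt, hu⟩ := (G.nodupB y).exists_idxOf_lt_notMem
      (hP.1.card_image_fst.trans_lt hcard)
      (h1.trans (List.idxOf_lt_length_of_mem (edge_iff_mem_prefB.1 hb.1)).le)
    have hz' : ∀ y', (z, y') ∉ N := fun y' h => hu (Finset.mem_image_of_mem Prod.fst h)
    have hzy := edge_iff_mem_prefB.2 hz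
    by_cases h2 : (G.prefA z).idxOf y < L + L
    · exact hunm z y hz' hy hzy (decide_eq_true ⟨hlt, Or.inr h2⟩)
    · exact hlong z hz' ((not_lt.1 h2).trans (List.idxOf_lt_length_of_mem hzy).le)

/-- A stable matching is relaxed stable, so the edges of the given feasible one survive. This keeps
both `G'` in the class and all LQ resources. -/
theorem IsRestriction.rsm_kernel (h : IsRestriction G G' (G.rsmKeep L) eA eB)
    (hL : ∀ M, G.IsMatching M → M.card < L) (hC : ∃ M, G.IsFeasible M ∧ G.IsStable M) (k : ℕ) :
    (∃ M, G'.IsFeasible M ∧ G'.IsStable M) ∧ (G.MaxRSM k ↔ G'.MaxRSM (min k L)) := by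
  obtain ⟨S, hF, hS⟩ := hC
  have hk : ∀ a b, (a, b) ∈ S → G.rsmKeep L a b = true := fun a b hab =>
    hS.isRelaxedStable.rsmKeep (hL _ hS.1) hab
  have hs := h.surjB_of_isFeasible hS.1 hk hF
  obtain ⟨S', hS', rfl⟩ := h.exists_push_eq hS.1 hk
  refine ⟨⟨S', h.isFeasible_of_push hF, h.isStable_of_push hS' hS⟩, ?_, ?_⟩
  · rintro ⟨M, hF, hE, hk⟩
    obtain ⟨M', hM', rfl⟩ := h.exists_push_eq hE.1 (fun a b hab => hE.rsmKeep (hL _ hE.1) hab)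
    refine ⟨M', h.isFeasible_of_push hF, h.isRelaxedStable_of_push hM' hE, ?_⟩
    rw [h.card_push] at hk
    omega
  · rintro ⟨M', hF', hE', hk⟩
    have hE := h.isRelaxedStable_push_rsm hL hE'
    have := hL _ hE.1
    rw [h.card_push] at this
    exact ⟨_, h.isFeasible_push hs hF', hE, by rw [h.card_push]; omega⟩

/-- A surviving resource outside `S` has a kept edge to an agent of `S`; it is LQ or among the first
`L + L` of that agent. -/
theorem IsRestriction.nB_le_rsm (h : IsRestriction G G' (G.rsmKeep L) eA eB)
    (hL : ∀ M, G.IsMatching M → M.card < L) (hC : ∃ M, G.IsFeasible M ∧ G.IsMatching M) :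
    G'.nB ≤ G.stableSize + L + G.stableSize * (L + L) := by
  obtain ⟨S, hS, hs⟩ := G.exists_isStable_card_eq
  obtain ⟨F, hF, hFM⟩ := hC
  have h1 : Finset.univ.image eB ⊆ S.image Prod.snd ∪
      Finset.univ.filter (fun b => G.lq b = true) ∪
      (S.image Prod.fst).biUnion (fun a => ((G.prefA a).take (L + L)).toFinset) := by
    intro y hy
    obtain ⟨b, -, rfl⟩ := Finset.mem_image.1 hy
    obtain ⟨a, ha⟩ := List.exists_mem_of_ne_nil _ (h.ne_nilB b)
    have he := h.edge_iff.1 (edge_iff_mem_prefB.2 ha)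
    rcases hS.cover he.1 with hA | hB
    · rcases (of_decide_eq_true he.2).2 with hq | hi
      · exact Finset.mem_union_left _ (Finset.mem_union_right _ (by simpa using hq))
      · refine Finset.mem_union_right _ (Finset.mem_biUnion.2 ⟨_, hA, ?_⟩)
        rw [List.mem_toFinset, List.mem_take_iff_idxOf_lt he.1]
        exact hi
    · exact Finset.mem_union_left _ (Finset.mem_union_left _ hB)
  have h2 := Finset.card_le_card h1
  rw [Finset.card_image_of_injective _ h.injB, Finset.card_univ, Fintype.card_fin] at h2
  refine h2.trans ((Finset.card_union_le _ _).trans (Nat.add_le_add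
      ((Finset.card_union_le _ _).trans (Nat.add_le_add ?_ ?_)) ?_))
  · rw [hS.1.card_image_snd, hs]
  · exact hF.card_lq_le.trans (hL _ hFM).le
  · refine (Finset.card_biUnion_le_card_mul _ _ (L + L) fun b _ => ?_).trans ?_
    · exact (List.toFinset_card_le _).trans (by simp)
    · rw [hS.1.card_image_fst, hs]

end RSM

theorem size_le (G : OneOneLQ) : G.size ≤ G.nA + G.nB + G.nA * G.nB := by
  refine Nat.add_le_add_left ((Finset.sum_le_card_nsmul _ _ G.nB fun a _ => ?_).trans ?_) _
  · simpa using (G.nodupA a).length_le_card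
  · simp

/-- Every matching is at most twice as large as a maximal one. -/
theorem IsMatching.card_lt_of_maximal {K M : Finset (Fin G.nA × Fin G.nB)} (hK : G.IsMatching K)
    (hmax : ∀ a b, G.Edge a b → a ∈ K.image Prod.fst ∨ b ∈ K.image Prod.snd)
    (hM : G.IsMatching M) : M.card < K.card + K.card + 1 := by
  have := hM.card_le_of_cover _ _ hmax
  rw [hK.card_image_fst, hK.card_image_snd] at this
  omega

/-- Applied to the greedy matching, this bounds the computed threshold by `4 * s + 1`. -/
theorem IsMatching.card_le_stableSize {K : Finset (Fin G.nA × Fin G.nB)} (hK : G.IsMatching K) :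
    K.card ≤ G.stableSize + G.stableSize := by
  obtain ⟨S, hS, hs⟩ := G.exists_isStable_card_eq
  have := hK.card_le_of_cover _ _ fun a b => hS.cover (a := a) (b := b)
  rwa [hS.1.card_image_fst, hS.1.card_image_snd, hs] at this

end Kernels

end OneOneLQ

/-! ### A program logic with frames and running times -/

namespace RAM

@[simp] theorem State.setVar_vars (σ : State) (x v y : ℕ) :
    (σ.setVar x v).vars y = if y = x then v else σ.vars y := by
  simp [State.setVar, Function.update_apply]

@[simp] theorem State.setVar_arrs (σ : State) (x v : ℕ) : (σ.setVar x v).arrs = σ.arrs := rfl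

@[simp] theorem State.setArr_vars (σ : State) (A i v : ℕ) : (σ.setArr A i v).vars = σ.vars := rfl

@[simp] theorem State.setArr_arrs (σ : State) (A i v B j : ℕ) :
    (σ.setArr A i v).arrs B j = if B = A ∧ j = i then v else σ.arrs B j := by
  by_cases h : B = A
  · subst h; by_cases h' : j = i <;> simp [State.setArr, h']
  · simp [State.setArr, h]

theorem State.setArr_arrs_of_ne (σ : State) {A B : ℕ} (i v : ℕ) (h : B ≠ A) :
    (σ.setArr A i v).arrs B = σ.arrs B := by
  simp [State.setArr, h]

/-- The variables that a program may change. -/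
def Prog.wvars : Prog → List ℕ
  | .skip => []
  | .set x _ => [x]
  | .put _ _ _ => []
  | .seq p q => p.wvars ++ q.wvars
  | .branch _ p q => p.wvars ++ q.wvars
  | .loop _ p => p.wvars

/-- The arrays that a program may change. -/
def Prog.warrs : Prog → List ℕ
  | .skip => []
  | .set _ _ => []
  | .put A _ _ => [A]
  | .seq p q => p.warrs ++ q.warrs
  | .branch _ p q => p.warrs ++ q.warrs
  | .loop _ p => p.warrs

/-- `τ` agrees with `σ` on everything that `p` does not write to. -/
def Frame (p : Prog) (σ τ : State) : Prop :=
  (∀ x, x ∉ p.wvars → τ.vars x = σ.vars x) ∧ ∀ A, A ∉ p.warrs → τ.arrs A = σ.arrs A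

theorem Frame.refl (p : Prog) (σ : State) : Frame p σ σ := ⟨fun _ _ => rfl, fun _ _ => rfl⟩

theorem Frame.trans {p : Prog} {σ τ υ : State} (h : Frame p σ τ) (h' : Frame p τ υ) :
    Frame p σ υ :=
  ⟨fun x hx => (h'.1 x hx).trans (h.1 x hx), fun A hA => (h'.2 A hA).trans (h.2 A hA)⟩

theorem Frame.mono {p q : Prog} {σ τ : State} (h : Frame p σ τ) (hv : p.wvars ⊆ q.wvars)
    (ha : p.warrs ⊆ q.warrs) : Frame q σ τ :=
  ⟨fun x hx => h.1 x fun h' => hx (hv h'), fun A hA => h.2 A fun h' => hA (ha h')⟩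

theorem Exec.frame {p : Prog} {σ τ : State} {n : ℕ} (h : Exec p σ n τ) : Frame p σ τ := by
  induction h with
  | skip => exact Frame.refl _ _
  | set x e σ =>
    refine ⟨fun y hy => ?_, fun _ _ => rfl⟩
    have : y ≠ x := by simpa [Prog.wvars] using hy
    simp [this]
  | put A e₁ e₂ σ =>
    refine ⟨fun _ _ => rfl, fun B hB => ?_⟩
    have : B ≠ A := by simpa [Prog.warrs] using hB
    exact State.setArr_arrs_of_ne _ _ _ this
  | seq _ _ h₁ h₂ =>
    exact (h₁.mono (List.subset_append_left _ _) (List.subset_append_left _ _)).trans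
      (h₂.mono (List.subset_append_right _ _) (List.subset_append_right _ _))
  | branch_true _ _ h =>
    exact h.mono (List.subset_append_left _ _) (List.subset_append_left _ _)
  | branch_false _ _ h =>
    exact h.mono (List.subset_append_right _ _) (List.subset_append_right _ _)
  | loop_done => exact Frame.refl _ _
  | loop_step _ _ _ h₁ h₂ => exact Frame.trans (p := .loop _ _) ⟨h₁.1, h₁.2⟩ h₂

/-- A bound on the running time, as a polynomial in a bound on the number of rounds of each loop. -/
noncomputable def Prog.time : Prog → Polynomial ℕ
  | .skip => 1
  | .set _ e => Polynomial.C (e.cost + 1)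
  | .put _ e₁ e₂ => Polynomial.C (e₁.cost + e₂.cost + 1)
  | .seq p q => p.time + q.time
  | .branch e p q => Polynomial.C (e.cost + 1) + p.time + q.time
  | .loop e p => (Polynomial.X + 1) * (Polynomial.C (e.cost + 1) + p.time)

/-- Started in `σ`, the program `p` halts in a state with `Q`, each of its loops being run through
at most `N` times whenever it is entered. -/
def Ok (N : ℕ) (p : Prog) (σ : State) (Q : State → Prop) : Prop :=
  ∃ n τ, Exec p σ n τ ∧ n ≤ p.time.eval N ∧ Q τ

variable {N : ℕ} {p q : Prog} {σ : State} {Q R : State → Prop} {e : Expr}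

/-- The frame comes for free with every weakening, so specifications need not mention the memory
that a program leaves alone. -/
theorem Ok.mono (h : Ok N p σ Q) (hQ : ∀ τ, Frame p σ τ → Q τ → R τ) : Ok N p σ R := by
  obtain ⟨n, τ, h1, h2, h3⟩ := h
  exact ⟨n, τ, h1, h2, hQ τ h1.frame h3⟩

theorem Ok.skip (h : Q σ) : Ok N .skip σ Q :=
  ⟨_, _, .skip σ, by simp [Prog.time], h⟩

theorem Ok.set {x : ℕ} (h : Q (σ.setVar x (e.val σ))) : Ok N (.set x e) σ Q :=
  ⟨_, _, .set x e σ, by simp [Prog.time], h⟩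

theorem Ok.put {A : ℕ} {e₁ e₂ : Expr} (h : Q (σ.setArr A (e₁.val σ) (e₂.val σ))) :
    Ok N (.put A e₁ e₂) σ Q :=
  ⟨_, _, .put A e₁ e₂ σ, by simp [Prog.time], h⟩

theorem Ok.seq (h : Ok N p σ fun τ => Ok N q τ Q) : Ok N (.seq p q) σ Q := by
  obtain ⟨m, τ, h1, h2, n, υ, h3, h4, h5⟩ := h
  exact ⟨_, _, h1.seq h3, by simpa [Prog.time] using Nat.add_le_add h2 h4, h5⟩

theorem Ok.branch (h : e.val σ ≠ 0 → Ok N p σ Q) (h' : e.val σ = 0 → Ok N q σ Q) :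
    Ok N (.branch e p q) σ Q := by
  by_cases he : e.val σ = 0
  · obtain ⟨n, τ, h1, h2, h3⟩ := h' he
    refine ⟨_, _, .branch_false he h1, ?_, h3⟩
    simp only [Prog.time, Polynomial.eval_add, Polynomial.eval_C]
    omega
  · obtain ⟨n, τ, h1, h2, h3⟩ := h he
    refine ⟨_, _, .branch_true he h1, ?_, h3⟩
    simp only [Prog.time, Polynomial.eval_add, Polynomial.eval_C]
    omega

/-- A loop that is run through exactly `n` times. -/
theorem Ok.loop {n : ℕ} (hn : n ≤ N) (I : ℕ → State → Prop) (h0 : I 0 σ)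
    (hstep : ∀ i < n, ∀ τ, Frame p σ τ → I i τ → e.val τ ≠ 0 ∧ Ok N p τ (I (i + 1)))
    (hend : ∀ τ, Frame p σ τ → I n τ → e.val τ = 0 ∧ Q τ) : Ok N (.loop e p) σ Q := by
  -- Induction on the number `j` of rounds still to come; the extra `e.cost + 1` is the final
  -- failing test.
  have key : ∀ j ≤ n, ∀ τ, Frame p σ τ → I (n - j) τ → ∃ m υ, Exec (.loop e p) τ m υ ∧
      m ≤ j * (e.cost + 1 + p.time.eval N) + (e.cost + 1) ∧ Q υ := by
    intro j
    induction j with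
    | zero =>
      intro _ τ hF hI
      obtain ⟨h1, h2⟩ := hend τ hF hI
      exact ⟨_, _, .loop_done h1, by omega, h2⟩
    | succ j ih =>
      intro hj τ hF hI
      obtain ⟨h1, m, υ, h2, h3, h4⟩ := hstep (n - (j + 1)) (by omega) τ hF hI
      obtain ⟨m', υ', h5, h6, h7⟩ := ih (by omega) υ (hF.trans h2.frame)
        (by rwa [show n - j = n - (j + 1) + 1 by omega])
      refine ⟨_, _, .loop_step h1 h2 h5, ?_, h7⟩
      rw [Nat.succ_mul]
      omega
  obtain ⟨m, υ, h1, h2, h3⟩ := key n le_rfl σ (Frame.refl _ _) (by simpa using h0)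
  refine ⟨m, υ, h1, h2.trans ?_, h3⟩
  -- The failing test is covered by the `1` in the factor `X + 1` of `Prog.time`.
  have := Nat.mul_le_mul_right (e.cost + 1 + p.time.eval N) hn
  simp only [Prog.time, Polynomial.eval_mul, Polynomial.eval_add, Polynomial.eval_X,
    Polynomial.eval_one, Polynomial.eval_C]
  rw [Nat.add_one_mul]
  omega

/-- `for x := 0, …, y - 1 do p` -/
def Prog.forLt (x y : ℕ) (p : Prog) : Prog :=
  .seq (.set x (.lit 0))
    (.loop (.lt (.var x) (.var y)) (.seq p (.set x (.add (.var x) (.lit 1)))))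

theorem Ok.forLt {x y : ℕ} (I : ℕ → State → Prop) (hy : σ.vars y ≤ N) (hxy : y ≠ x)
    (hx : x ∉ p.wvars) (hyp : y ∉ p.wvars) (h0 : I 0 (σ.setVar x 0))
    (hstep : ∀ i < σ.vars y, ∀ τ, Frame (.forLt x y p) σ τ → τ.vars x = i → I i τ →
      Ok N p τ fun υ => I (i + 1) (υ.setVar x (i + 1)))
    (hend : ∀ τ, Frame (.forLt x y p) σ τ → I (σ.vars y) τ → Q τ) :
    Ok N (.forLt x y p) σ Q := by
  have hf : ∀ τ, Frame (.seq p (.set x (.add (.var x) (.lit 1)))) (σ.setVar x 0) τ →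
      Frame (.forLt x y p) σ τ := by
    intro τ hτ
    refine ⟨fun z hz => ?_, fun A hA => hτ.2 A hA⟩
    have hz' : z ≠ x ∧ z ∉ p.wvars := by
      simp only [Prog.forLt, Prog.wvars, List.mem_append, List.mem_singleton] at hz
      tauto
    rw [hτ.1 z (by simp [Prog.wvars, hz'])]
    simp [hz'.1]
  refine Ok.seq (Ok.set (Ok.loop hy (fun i τ => τ.vars x = i ∧ I i τ) ⟨by simp [Expr.val], h0⟩
    (fun i hi τ hF hI => ?_) (fun τ hF hI => ?_)))
  · have hfy : τ.vars y = σ.vars y :=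
      (hf τ hF).1 y (by simp [Prog.forLt, Prog.wvars, hxy, hyp])
    refine ⟨by simp [Expr.val, hI.1, hfy, hi], Ok.seq ((hstep i hi τ (hf τ hF) hI.1 hI.2).mono
      fun υ hF' hI' => Ok.set ?_)⟩
    have : υ.vars x = i := (hF'.1 x hx).trans hI.1
    simpa [Expr.val, this] using hI'
  · have hfy : τ.vars y = σ.vars y :=
      (hf τ hF).1 y (by simp [Prog.forLt, Prog.wvars, hxy, hyp])
    exact ⟨by simp [Expr.val, hI.1, hfy], hend τ (hf τ hF) hI.2⟩

end RAM

/-! ### The input word and the positions of its parts -/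

namespace OneOneLQ

variable (G : OneOneLQ)

/-- The preference list of the agent `a`, as a list of numbers. -/
def listA (a : ℕ) : List ℕ := if h : a < G.nA then (G.prefA ⟨a, h⟩).map (↑) else []

/-- The preference list of the resource `b`, as a list of numbers. -/
def listB (b : ℕ) : List ℕ := if h : b < G.nB then (G.prefB ⟨b, h⟩).map (↑) else []

/-- The lower quota of the resource `b`. -/
def quota (b : ℕ) : ℕ := if h : b < G.nB then (G.lq ⟨b, h⟩).toNat else 0

theorem listA_coe (a : Fin G.nA) : G.listA a = (G.prefA a).map (↑) := by simp [listA]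

theorem listB_coe (b : Fin G.nB) : G.listB b = (G.prefB b).map (↑) := by simp [listB]

theorem quota_coe (b : Fin G.nB) : G.quota b = (G.lq b).toNat := by simp [quota]

/-- The part of the word of `G` for the agent `a`. -/
def codeA (a : ℕ) : List ℕ := (G.listA a).length :: G.listA a

/-- The part of the word of `G` for the resource `b`. -/
def codeB (b : ℕ) : List ℕ := G.quota b :: (G.listB b).length :: G.listB b

theorem _root_.List.coe_fin_eq_map {n : ℕ} (l : List (Fin n)) :
    (do let a ← l; pure (a : ℕ) : List ℕ) = l.map (↑) := by
  induction l <;> simp_all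

theorem encode_eq (k : ℕ) : G.encode k = [k, G.nA, G.nB] ++ (List.range G.nA).flatMap G.codeA ++
    (List.range G.nB).flatMap G.codeB := by
  simp only [encode, ← List.map_coe_finRange_eq_range, List.flatMap_map, codeA, codeB, listA_coe,
    listB_coe, quota_coe, List.length_map, List.coe_fin_eq_map, List.map_id']

/-- The position of the part for the agent `a`. -/
def offA (a : ℕ) : ℕ := 3 + ((List.range a).flatMap G.codeA).length

/-- The position of the part for the resource `b`. -/
def offB (b : ℕ) : ℕ := G.offA G.nA + ((List.range b).flatMap G.codeB).length

theorem offA_succ (a : ℕ) : G.offA (a + 1) = G.offA a + (G.listA a).length + 1 := by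
  simp [offA, List.range_succ, codeA]; omega

/-- Two letters precede a resource's list, the quota and the length; for an agent there is only the
length. -/
theorem offB_succ (b : ℕ) : G.offB (b + 1) = G.offB b + (G.listB b).length + 2 := by
  simp [offB, List.range_succ, codeB]; omega

theorem _root_.List.flatMap_range_split {α : Type*} (f : ℕ → List α) {a n : ℕ} (h : a < n) :
    ∃ r, (List.range n).flatMap f = (List.range a).flatMap f ++ (f a ++ r) := by
  obtain ⟨m, rfl⟩ := Nat.exists_eq_add_of_le (Nat.succ_le_of_lt h)
  exact ⟨_, by rw [List.range_add, List.flatMap_append, List.range_succ, List.flatMap_append,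
    List.flatMap_singleton, List.append_assoc]⟩

theorem encode_getD_offA (k : ℕ) {a i : ℕ} (ha : a < G.nA) (hi : i < (G.codeA a).length) :
    (G.encode k).getD (G.offA a + i) 0 = (G.codeA a).getD i 0 := by
  obtain ⟨r, hr⟩ := List.flatMap_range_split G.codeA ha
  rw [encode_eq, hr, offA]
  have : [k, G.nA, G.nB] ++ ((List.range a).flatMap G.codeA ++ (G.codeA a ++ r)) ++
      (List.range G.nB).flatMap G.codeB = ([k, G.nA, G.nB] ++ (List.range a).flatMap G.codeA) ++
      (G.codeA a ++ (r ++ (List.range G.nB).flatMap G.codeB)) := by simp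
  rw [this, List.getD_append_right _ _ _ _ (by simp; omega), List.getD_append _ _ _ _ (by simp; omega)]
  congr 1
  simp; omega

theorem encode_getD_offB (k : ℕ) {b i : ℕ} (hb : b < G.nB) (hi : i < (G.codeB b).length) :
    (G.encode k).getD (G.offB b + i) 0 = (G.codeB b).getD i 0 := by
  obtain ⟨r, hr⟩ := List.flatMap_range_split G.codeB hb
  rw [encode_eq, hr, offB, offA]
  rw [← List.append_assoc ([k, G.nA, G.nB] ++ (List.range G.nA).flatMap G.codeA),
    List.getD_append_right _ _ _ _ (by simp; omega), List.getD_append _ _ _ _ (by simp; omega)]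
  congr 1
  simp; omega

/-- All loops over `G` have at most `N` rounds. -/
structure Fits (N : ℕ) : Prop where
  nA_le : G.nA ≤ N
  nB_le : G.nB ≤ N
  lenA_le : ∀ a, (G.listA a).length ≤ N
  lenB_le : ∀ b, (G.listB b).length ≤ N

theorem listA_of_le {a : ℕ} (h : G.nA ≤ a) : G.listA a = [] := by simp [listA, h]

theorem listB_of_le {b : ℕ} (h : G.nB ≤ b) : G.listB b = [] := by simp [listB, h]

theorem offA_mono : Monotone G.offA :=
  monotone_nat_of_le_succ fun a => by rw [offA_succ]; omega

theorem offB_mono : Monotone G.offB :=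
  monotone_nat_of_le_succ fun a => by rw [offB_succ]; omega

theorem le_offA (a : ℕ) : a ≤ G.offA a := by
  induction a with
  | zero => exact Nat.zero_le _
  | succ a ih => rw [offA_succ]; omega

theorem le_offB (b : ℕ) : b ≤ G.offB b := by
  induction b with
  | zero => exact Nat.zero_le _
  | succ a ih => rw [offB_succ]; omega

theorem length_encode (k : ℕ) : (G.encode k).length = G.offB G.nB := by
  rw [encode_eq]; simp [offB, offA]; omega

/-- Every vertex contributes at least one letter and every list is a block of the word. This makes
the word length a valid bound for the loops over vertices and lists. -/
theorem fits (k : ℕ) : G.Fits (G.encode k).length := by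
  rw [length_encode]
  have h0 : G.offA G.nA = G.offB 0 := by simp [offB]
  have h1 := G.offB_mono (Nat.zero_le G.nB)
  refine ⟨(G.le_offA _).trans (h0.trans_le h1), G.le_offB _, fun a => ?_, fun b => ?_⟩
  · by_cases ha : a < G.nA
    · have := G.offA_mono (Nat.succ_le_of_lt ha)
      rw [Nat.succ_eq_add_one, offA_succ] at this; omega
    · simp [G.listA_of_le (not_lt.1 ha)]
  · by_cases hb : b < G.nB
    · have := G.offB_mono (Nat.succ_le_of_lt hb)
      rw [Nat.succ_eq_add_one, offB_succ] at this; omega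
    · simp [G.listB_of_le (not_lt.1 hb)]

theorem mem_listA {a b : ℕ} : b ∈ G.listA a ↔ ∃ (x : Fin G.nA) (y : Fin G.nB),
    (x : ℕ) = a ∧ (y : ℕ) = b ∧ G.Edge x y := by
  constructor
  · intro h
    by_cases ha : a < G.nA
    · lift a to Fin G.nA using ha
      rw [listA_coe] at h
      obtain ⟨y, hy, rfl⟩ := List.mem_map.1 h
      exact ⟨a, y, rfl, rfl, hy⟩
    · simp [G.listA_of_le (not_lt.1 ha)] at h
  · rintro ⟨x, y, rfl, rfl, h⟩
    rw [listA_coe]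
    exact List.mem_map_of_mem h

theorem mem_listB {a b : ℕ} : a ∈ G.listB b ↔ b ∈ G.listA a := by
  rw [mem_listA]
  constructor
  · intro h
    by_cases hb : b < G.nB
    · lift b to Fin G.nB using hb
      rw [listB_coe] at h
      obtain ⟨x, hx, rfl⟩ := List.mem_map.1 h
      exact ⟨x, b, rfl, rfl, edge_iff_mem_prefB.2 hx⟩
    · simp [G.listB_of_le (not_lt.1 hb)] at h
  · rintro ⟨x, y, rfl, rfl, h⟩
    rw [listB_coe]
    exact List.mem_map_of_mem (edge_iff_mem_prefB.1 h)

theorem lt_of_mem_listA {a b : ℕ} (h : b ∈ G.listA a) : a < G.nA ∧ b < G.nB := by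
  obtain ⟨x, y, rfl, rfl, -⟩ := G.mem_listA.1 h
  exact ⟨x.2, y.2⟩

end OneOneLQ

/-! ### The instance in memory and loops over preference lists -/

namespace RAM

open OneOneLQ

/-- The memory holds `G`: variables `2` and `3` hold the numbers of agents and of resources,
arrays `1` and `2` the positions in array `0` of the parts for the agents and the resources. -/
structure Holds (G : OneOneLQ) (σ : State) : Prop where
  nA : σ.vars 2 = G.nA
  nB : σ.vars 3 = G.nB
  lenA : ∀ a < G.nA, σ.arrs 0 (σ.arrs 1 a) = (G.listA a).length
  getA : ∀ a < G.nA, ∀ i < (G.listA a).length,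
    σ.arrs 0 (σ.arrs 1 a + 1 + i) = (G.listA a).getD i 0
  quota : ∀ b < G.nB, σ.arrs 0 (σ.arrs 2 b) = G.quota b
  lenB : ∀ b < G.nB, σ.arrs 0 (σ.arrs 2 b + 1) = (G.listB b).length
  getB : ∀ b < G.nB, ∀ i < (G.listB b).length,
    σ.arrs 0 (σ.arrs 2 b + 2 + i) = (G.listB b).getD i 0

theorem Holds.congr {G : OneOneLQ} {σ τ : State} (h : Holds G σ) (h2 : τ.vars 2 = σ.vars 2)
    (h3 : τ.vars 3 = σ.vars 3) (h0 : τ.arrs 0 = σ.arrs 0) (h1 : τ.arrs 1 = σ.arrs 1)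
    (h2' : τ.arrs 2 = σ.arrs 2) : Holds G τ := by
  obtain ⟨a, b, c, d, e, f, g⟩ := h
  constructor <;> rw [← h2, ← h3, ← h0, ← h1, ← h2'] at * <;> assumption

/-- The program changes neither the representation of `G` nor the control variables of the loops
over the preference lists. -/
structure Safe (p : Prog) : Prop where
  vars : ∀ x ∈ p.wvars, x = 4 ∨ 8 ≤ x ∧ x ≤ 12 ∨ 30 ≤ x
  arrs : ∀ A ∈ p.warrs, 3 ≤ A

theorem Holds.frame {G : OneOneLQ} {σ τ : State} {p : Prog} (h : Holds G σ) (hF : Frame p σ τ)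
    (hv : 2 ∉ p.wvars ∧ 3 ∉ p.wvars) (ha : 0 ∉ p.warrs ∧ 1 ∉ p.warrs ∧ 2 ∉ p.warrs) :
    Holds G τ :=
  h.congr (hF.1 _ hv.1) (hF.1 _ hv.2) (hF.2 _ ha.1) (hF.2 _ ha.2.1) (hF.2 _ ha.2.2)

/-- Run through the preference list of the agent in variable `13`, with the current resource in
variable `14`. -/
def Prog.eachA (p : Prog) : Prog :=
  .seq (.set 7 (.get 0 (.get 1 (.var 13)))) <|
  .forLt 6 7 <|
  .seq (.set 14 (.get 0 (.add (.add (.get 1 (.var 13)) (.lit 1)) (.var 6)))) p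

/-- Run through the preference list of the resource in variable `14`, with the current agent in
variable `13`. -/
def Prog.eachB (p : Prog) : Prog :=
  .seq (.set 7 (.get 0 (.add (.get 2 (.var 14)) (.lit 1)))) <|
  .forLt 6 7 <|
  .seq (.set 13 (.get 0 (.add (.add (.get 2 (.var 14)) (.lit 2)) (.var 6)))) p

theorem mem_wvars_eachA {p : Prog} {x : ℕ} :
    x ∈ p.eachA.wvars ↔ x = 6 ∨ x = 7 ∨ x = 14 ∨ x ∈ p.wvars := by
  simp only [Prog.eachA, Prog.forLt, Prog.wvars, List.mem_append, List.mem_singleton]; tauto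

theorem mem_wvars_eachB {p : Prog} {x : ℕ} :
    x ∈ p.eachB.wvars ↔ x = 6 ∨ x = 7 ∨ x = 13 ∨ x ∈ p.wvars := by
  simp only [Prog.eachB, Prog.forLt, Prog.wvars, List.mem_append, List.mem_singleton]; tauto

@[simp] theorem warrs_eachA (p : Prog) : p.eachA.warrs = p.warrs := by
  simp [Prog.eachA, Prog.forLt, Prog.warrs]

@[simp] theorem warrs_eachB (p : Prog) : p.eachB.warrs = p.warrs := by
  simp [Prog.eachB, Prog.forLt, Prog.warrs]

variable {G : OneOneLQ} {N : ℕ} {p : Prog} {σ : State} {Q : State → Prop}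

theorem Safe.holds_eachA (hp : Safe p) (h : Holds G σ) {τ : State} (hF : Frame p.eachA σ τ) :
    Holds G τ := by
  refine h.frame hF ⟨?_, ?_⟩ ⟨?_, ?_, ?_⟩
  · rw [mem_wvars_eachA]; have := hp.vars 2; grind
  · rw [mem_wvars_eachA]; have := hp.vars 3; grind
  · rw [warrs_eachA]; have := hp.arrs 0; grind
  · rw [warrs_eachA]; have := hp.arrs 1; grind
  · rw [warrs_eachA]; have := hp.arrs 2; grind

theorem Safe.holds_eachB (hp : Safe p) (h : Holds G σ) {τ : State} (hF : Frame p.eachB σ τ) :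
    Holds G τ := by
  refine h.frame hF ⟨?_, ?_⟩ ⟨?_, ?_, ?_⟩
  · rw [mem_wvars_eachB]; have := hp.vars 2; grind
  · rw [mem_wvars_eachB]; have := hp.vars 3; grind
  · rw [warrs_eachB]; have := hp.arrs 0; grind
  · rw [warrs_eachB]; have := hp.arrs 1; grind
  · rw [warrs_eachB]; have := hp.arrs 2; grind

/-- The invariant is indexed by the prefix already processed, so a filter or map of the list can be
built up letter by letter. It must not depend on the control variables `6`, `7`, `14`. -/
theorem Ok.eachA (hN : G.Fits N) (hp : Safe p) (h : Holds G σ) {a : ℕ} (ha : σ.vars 13 = a)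
    (haG : a < G.nA) (I : List ℕ → State → Prop)
    (hI : ∀ l τ x v, x = 6 ∨ x = 7 ∨ x = 14 → I l τ → I l (τ.setVar x v)) (h0 : I [] σ)
    (hstep : ∀ pre b, pre ++ [b] <+: G.listA a → ∀ τ, Frame p.eachA σ τ → Holds G τ →
      τ.vars 13 = a → τ.vars 14 = b → I pre τ → Ok N p τ (I (pre ++ [b])))
    (hend : ∀ τ, Frame p.eachA σ τ → I (G.listA a) τ → Q τ) : Ok N p.eachA σ Q := by
  have hv6 : 6 ∉ p.wvars := by have := hp.vars 6; grind
  have hv7 : 7 ∉ p.wvars := by have := hp.vars 7; grind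
  have hv13 : 13 ∉ p.eachA.wvars := by rw [mem_wvars_eachA]; have := hp.vars 13; grind
  have hlen : (σ.setVar 7 ((Expr.get 0 (.get 1 (.var 13))).val σ)).vars 7 = (G.listA a).length := by
    simp [Expr.val, ha, h.lenA a haG]
  have hfr : ∀ τ, Frame (.forLt 6 7
      (.seq (.set 14 (.get 0 (.add (.add (.get 1 (.var 13)) (.lit 1)) (.var 6)))) p))
      (σ.setVar 7 ((Expr.get 0 (.get 1 (.var 13))).val σ)) τ → Frame p.eachA σ τ := by
    intro τ hF
    refine ⟨fun x hx => ?_, fun A hA => ?_⟩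
    · have h7 : x ≠ 7 := fun e => hx (by rw [mem_wvars_eachA]; omega)
      rw [hF.1 x (fun h' => hx (List.mem_append_right _ h'))]
      simp [h7]
    · rw [hF.2 A (fun h' => hA (List.mem_append_right _ h'))]; rfl
  refine Ok.seq (Ok.set (Ok.forLt (fun i τ => I ((G.listA a).take i) τ) ?_ (by decide) ?_ ?_ ?_ ?_
    ?_))
  · rw [hlen]; exact hN.lenA_le a
  · simpa [Prog.wvars] using hv6
  · simpa [Prog.wvars] using hv7
  · exact hI _ _ _ _ (by simp) (hI _ _ _ _ (by simp) h0)
  · rw [hlen]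
    intro i hi τ hF h6 hIi
    have hF' := hfr τ hF
    have hH := hp.holds_eachA h hF'
    have h13 : τ.vars 13 = a := (hF'.1 13 hv13).trans ha
    refine Ok.seq (Ok.set ?_)
    have hb : (Expr.get 0 (.add (.add (.get 1 (.var 13)) (.lit 1)) (.var 6))).val τ =
        (G.listA a)[i] := by
      simp only [Expr.val, h13, h6, hH.getA a haG i hi]
      simp [hi]
    have htake : (G.listA a).take (i + 1) = (G.listA a).take i ++ [(G.listA a)[i]] := by
      simp
    rw [hb]
    refine (hstep _ _ (htake ▸ List.take_prefix _ _) (τ.setVar 14 (G.listA a)[i]) ?_ ?_ ?_ ?_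
      (hI _ _ _ _ (by simp) hIi)).mono fun υ _ hυ => ?_
    · refine hF'.trans ⟨fun x hx => ?_, fun _ _ => rfl⟩
      have h14 : x ≠ 14 := fun e => hx (by rw [mem_wvars_eachA]; omega)
      simp [h14]
    · exact hH.congr (by simp) (by simp) rfl rfl rfl
    · simp [h13]
    · simp
    · rw [← htake] at hυ
      exact hI _ _ _ _ (by simp) hυ
  · rw [hlen]
    intro τ hF hIτ
    rw [List.take_length] at hIτ
    exact hend τ (hfr τ hF) hIτ

theorem Ok.eachB (hN : G.Fits N) (hp : Safe p) (h : Holds G σ) {b : ℕ} (hb : σ.vars 14 = b)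
    (hbG : b < G.nB) (I : List ℕ → State → Prop)
    (hI : ∀ l τ x v, x = 6 ∨ x = 7 ∨ x = 13 → I l τ → I l (τ.setVar x v)) (h0 : I [] σ)
    (hstep : ∀ pre a, pre ++ [a] <+: G.listB b → ∀ τ, Frame p.eachB σ τ → Holds G τ →
      τ.vars 13 = a → τ.vars 14 = b → I pre τ → Ok N p τ (I (pre ++ [a])))
    (hend : ∀ τ, Frame p.eachB σ τ → I (G.listB b) τ → Q τ) : Ok N p.eachB σ Q := by
  have hv6 : 6 ∉ p.wvars := by have := hp.vars 6; grind
  have hv7 : 7 ∉ p.wvars := by have := hp.vars 7; grind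
  have hv14 : 14 ∉ p.eachB.wvars := by rw [mem_wvars_eachB]; have := hp.vars 14; grind
  have hlen : (σ.setVar 7 ((Expr.get 0 (.add (.get 2 (.var 14)) (.lit 1))).val σ)).vars 7 =
      (G.listB b).length := by
    simp [Expr.val, hb, h.lenB b hbG]
  have hfr : ∀ τ, Frame (.forLt 6 7
      (.seq (.set 13 (.get 0 (.add (.add (.get 2 (.var 14)) (.lit 2)) (.var 6)))) p))
      (σ.setVar 7 ((Expr.get 0 (.add (.get 2 (.var 14)) (.lit 1))).val σ)) τ →
      Frame p.eachB σ τ := by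
    intro τ hF
    refine ⟨fun x hx => ?_, fun A hA => ?_⟩
    · have h7 : x ≠ 7 := fun e => hx (by rw [mem_wvars_eachB]; omega)
      rw [hF.1 x (fun h' => hx (List.mem_append_right _ h'))]
      simp [h7]
    · rw [hF.2 A (fun h' => hA (List.mem_append_right _ h'))]; rfl
  refine Ok.seq (Ok.set (Ok.forLt (fun i τ => I ((G.listB b).take i) τ) ?_ (by decide) ?_ ?_ ?_ ?_
    ?_))
  · rw [hlen]; exact hN.lenB_le b
  · simpa [Prog.wvars] using hv6
  · simpa [Prog.wvars] using hv7
  · exact hI _ _ _ _ (by simp) (hI _ _ _ _ (by simp) h0)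
  · rw [hlen]
    intro i hi τ hF h6 hIi
    have hF' := hfr τ hF
    have hH := hp.holds_eachB h hF'
    have h14 : τ.vars 14 = b := (hF'.1 14 hv14).trans hb
    refine Ok.seq (Ok.set ?_)
    have ha : (Expr.get 0 (.add (.add (.get 2 (.var 14)) (.lit 2)) (.var 6))).val τ =
        (G.listB b)[i] := by
      simp only [Expr.val, h14, h6, hH.getB b hbG i hi]
      simp [hi]
    have htake : (G.listB b).take (i + 1) = (G.listB b).take i ++ [(G.listB b)[i]] := by
      simp
    rw [ha]
    refine (hstep _ _ (htake ▸ List.take_prefix _ _) (τ.setVar 13 (G.listB b)[i]) ?_ ?_ ?_ ?_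
      (hI _ _ _ _ (by simp) hIi)).mono fun υ _ hυ => ?_
    · refine hF'.trans ⟨fun x hx => ?_, fun _ _ => rfl⟩
      have h13 : x ≠ 13 := fun e => hx (by rw [mem_wvars_eachB]; omega)
      simp [h13]
    · exact hH.congr (by simp) (by simp) rfl rfl rfl
    · simp
    · simp [h14]
    · rw [← htake] at hυ
      exact hI _ _ _ _ (by simp) hυ
  · rw [hlen]
    intro τ hF hIτ
    rw [List.take_length] at hIτ
    exact hend τ (hfr τ hF) hIτ

/-- Compute the positions of the preference lists. -/
def parse : Prog :=
  .seq (.set 1 (.get 0 (.lit 0))) <|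
  .seq (.set 2 (.get 0 (.lit 1))) <|
  .seq (.set 3 (.get 0 (.lit 2))) <|
  .seq (.set 4 (.lit 3)) <|
  .seq (.forLt 5 2 <|
    .seq (.put 1 (.var 5) (.var 4)) <|
    .set 4 (.add (.add (.var 4) (.get 0 (.var 4))) (.lit 1))) <|
  .forLt 5 3 <|
    .seq (.put 2 (.var 5) (.var 4)) <|
    .set 4 (.add (.add (.var 4) (.get 0 (.add (.var 4) (.lit 1)))) (.lit 2))

theorem parse_ok (G : OneOneLQ) (k : ℕ) (hN : G.Fits N) :
    Ok N parse (load (G.encode k)) fun τ => Holds G τ ∧ τ.vars 1 = k := by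
  have hcA : ∀ a < G.nA, (G.encode k).getD (G.offA a) 0 = (G.listA a).length := fun a ha => by
    simpa [codeA] using G.encode_getD_offA k (i := 0) ha (by simp [codeA])
  have hcB : ∀ b < G.nB, (G.encode k).getD (G.offB b + 1) 0 = (G.listB b).length := fun b hb => by
    simpa [codeB] using G.encode_getD_offB k (i := 1) hb (by simp [codeB])
  refine Ok.seq (Ok.set (Ok.seq (Ok.set (Ok.seq (Ok.set (Ok.seq (Ok.set (Ok.seq ?_))))))))
  have e0 : (G.encode k).getD 0 0 = k := by simp [encode]
  have e1 : (G.encode k).getD 1 0 = G.nA := by simp [encode]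
  have e2 : (G.encode k).getD 2 0 = G.nB := by simp [encode]
  refine Ok.forLt (fun i τ => τ.vars 4 = G.offA i ∧ ∀ a < i, τ.arrs 1 a = G.offA a)
    ?_ (by decide) (by decide) (by decide) ?_ ?_ ?_
  · simpa [Expr.val, load, -List.getD_eq_getElem?_getD, e1] using hN.nA_le
  · simp [Expr.val, offA]
  · intro i hi τ hF h5 hI
    replace hi : i < G.nA := by simpa [Expr.val, load, -List.getD_eq_getElem?_getD, e1] using hi
    have h0 : τ.arrs 0 = (load (G.encode k)).arrs 0 := by
      rw [hF.2 0 (by decide)]; rfl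
    refine Ok.seq (Ok.put (Ok.set ⟨?_, fun a ha => ?_⟩))
    · simp [Expr.val, hI.1, h0, load, -List.getD_eq_getElem?_getD, hcA i hi, G.offA_succ]
    · by_cases hai : a = i
      · subst hai; simp [Expr.val, h5, hI.1]
      · simp [Expr.val, h5, hai, hI.2 a (by omega)]
  intro τ hF hI
  have h0 : τ.arrs 0 = (load (G.encode k)).arrs 0 := by
    rw [hF.2 0 (by decide)]; rfl
  have h1 : τ.vars 1 = k := by
    rw [hF.1 1 (by decide)]; simp [Expr.val, load, -List.getD_eq_getElem?_getD, e0]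
  have h2 : τ.vars 2 = G.nA := by
    rw [hF.1 2 (by decide)]; simp [Expr.val, load, -List.getD_eq_getElem?_getD, e1]
  have h3 : τ.vars 3 = G.nB := by
    rw [hF.1 3 (by decide)]; simp [Expr.val, load, -List.getD_eq_getElem?_getD, e2]
  have hA : τ.vars 4 = G.offA G.nA ∧ ∀ a < G.nA, τ.arrs 1 a = G.offA a := by
    simpa [Expr.val, load, -List.getD_eq_getElem?_getD, e1] using hI
  -- Variable `4` carries over from the first loop because `offB 0 = offA nA`.
  refine Ok.forLt (fun i τ => τ.vars 4 = G.offB i ∧ ∀ b < i, τ.arrs 2 b = G.offB b)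
    ?_ (by decide) (by decide) (by decide) ?_ ?_ ?_
  · rw [h3]; exact hN.nB_le
  · simp [hA.1, offB]
  · intro i hi υ hF' h5 hI
    rw [h3] at hi
    have h0' : υ.arrs 0 = (load (G.encode k)).arrs 0 := by
      rw [hF'.2 0 (by decide), h0]
    refine Ok.seq (Ok.put (Ok.set ⟨?_, fun a ha => ?_⟩))
    · simp [Expr.val, hI.1, h0', load, -List.getD_eq_getElem?_getD, hcB i hi, G.offB_succ]
    · by_cases hai : a = i
      · subst hai; simp [Expr.val, h5, hI.1]
      · simp [Expr.val, h5, hai, hI.2 a (by omega)]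
  · intro υ hF' hI
    rw [h3] at hI
    have h0' : ∀ i, υ.arrs 0 i = (G.encode k).getD i 0 := by
      intro i; rw [hF'.2 0 (by decide), h0]; simp [load]
    have h1' : ∀ a < G.nA, υ.arrs 1 a = G.offA a := by
      rw [hF'.2 1 (by decide)]; exact hA.2
    refine ⟨⟨by rw [hF'.1 2 (by decide), h2], by rw [hF'.1 3 (by decide), h3],
      fun a ha => ?_, fun a ha i hi => ?_, fun b hb => ?_, fun b hb => ?_, fun b hb i hi => ?_⟩,
      by rw [hF'.1 1 (by decide), h1]⟩
    · rw [h0', h1' a ha, hcA a ha]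
    · rw [h0', h1' a ha, add_assoc, G.encode_getD_offA k ha (by simp [codeA]; omega), codeA,
        add_comm 1 i, List.getD_cons_succ]
    · rw [h0', hI.2 b hb]
      simpa [codeB] using G.encode_getD_offB k (i := 0) hb (by simp [codeB])
    · rw [h0', hI.2 b hb, hcB b hb]
    · rw [h0', hI.2 b hb, add_assoc, G.encode_getD_offB k hb (by simp [codeB]; omega), codeB,
        show 2 + i = i + 1 + 1 by omega, List.getD_cons_succ, List.getD_cons_succ]

end RAM

namespace RAM

open OneOneLQ

variable {G : OneOneLQ} {N : ℕ} {σ : State} {Q : State → Prop}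

/-! ### A maximal matching -/

/-- Match the agent in variable `13` with the resource in variable `14` if both are unmatched. -/
def matchStep : Prog :=
  .branch (.add (.get 3 (.var 13)) (.get 4 (.var 14))) .skip <|
  .seq (.put 3 (.var 13) (.lit 1)) <|
  .seq (.put 4 (.var 14) (.lit 1)) <|
  .set 9 (.add (.var 9) (.lit 1))

/-- Compute twice the size of a maximal matching plus one, in variable `9`. -/
def greedy : Prog :=
  .seq (.forLt 5 2 (.seq (.set 13 (.var 5)) matchStep.eachA)) <|
  .set 9 (.add (.add (.var 9) (.var 9)) (.lit 1))

/-- The memory holds a matching that is maximal with respect to the edges that have been seen. -/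
def GreedyInv (G : OneOneLQ) (i : ℕ) (pre : List ℕ) (τ : State) : Prop :=
  ∃ K : Finset (Fin G.nA × Fin G.nB), G.IsMatching K ∧ τ.vars 9 = K.card ∧
    (∀ a : Fin G.nA, τ.arrs 3 a = 0 ↔ a ∉ K.image Prod.fst) ∧
    (∀ b : Fin G.nB, τ.arrs 4 b = 0 ↔ b ∉ K.image Prod.snd) ∧
    ∀ a b, G.Edge a b → (a : ℕ) < i ∨ ((a : ℕ) = i ∧ (b : ℕ) ∈ pre) →
      a ∈ K.image Prod.fst ∨ b ∈ K.image Prod.snd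

theorem safe_matchStep : Safe matchStep :=
  ⟨by simp [matchStep, Prog.wvars], by simp [matchStep, Prog.warrs]⟩

theorem GreedyInv.setVar {i x v : ℕ} {pre : List ℕ} {τ : State} (h : GreedyInv G i pre τ)
    (hx : 9 ≠ x) : GreedyInv G i pre (τ.setVar x v) := by
  obtain ⟨K, h1, h2, h3⟩ := h
  exact ⟨K, h1, by simpa [hx] using h2, h3⟩

/-- If the edge is skipped, one of its ends is already matched; otherwise it joins the matching.
Either way it is covered afterwards. -/
theorem matchStep_ok {i b : ℕ} {pre : List ℕ} (hab : b ∈ G.listA i) (h13 : σ.vars 13 = i)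
    (h14 : σ.vars 14 = b) (hI : GreedyInv G i pre σ) :
    Ok N matchStep σ (GreedyInv G i (pre ++ [b])) := by
  obtain ⟨x, y, rfl, rfl, hxy⟩ := G.mem_listA.1 hab
  obtain ⟨K, hK, h9, h3, h4, hc⟩ := hI
  refine Ok.branch (fun hb => Ok.skip ⟨K, hK, h9, h3, h4, ?_⟩) (fun hb => ?_)
  · intro a b hab h
    rw [List.mem_append, List.mem_singleton] at h
    rcases h with h | ⟨ha, h | h⟩
    · exact hc a b hab (Or.inl h)
    · exact hc a b hab (Or.inr ⟨ha, h⟩)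
    · obtain rfl := Fin.ext ha
      obtain rfl := Fin.ext h
      by_contra hcon
      rw [not_or, ← h3, ← h4] at hcon
      exact hb (by simp [Expr.val, h13, h14, hcon])
  · have hb' : x ∉ K.image Prod.fst ∧ y ∉ K.image Prod.snd := by
      rw [← h3, ← h4]
      simpa [Expr.val, h13, h14] using hb
    have hx : ∀ b, (x, b) ∉ K := fun b h => hb'.1 (Finset.mem_image_of_mem Prod.fst h)
    have hy : ∀ a, (a, y) ∉ K := fun a h => hb'.2 (Finset.mem_image_of_mem Prod.snd h)
    refine Ok.seq (Ok.put (Ok.seq (Ok.put (Ok.set ⟨insert (x, y) K, ⟨?_, ?_, ?_⟩, ?_, ?_, ?_, ?_⟩))))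
    · intro a b h
      rcases Finset.mem_insert.1 h with h | h
      · rw [Prod.mk.injEq] at h
        rw [h.1, h.2]; exact hxy
      · exact hK.edge _ _ h
    · intro a b b' h h'
      rcases Finset.mem_insert.1 h with h | h <;> rcases Finset.mem_insert.1 h' with h' | h' <;>
        (try simp only [Prod.mk.injEq] at h) <;> (try simp only [Prod.mk.injEq] at h')
      · rw [h.2, h'.2]
      · exact absurd (h.1 ▸ h') (hx _)
      · exact absurd (h'.1 ▸ h) (hx _)
      · exact hK.agent_unique _ _ _ h h'
    · intro a a' b h h'
      rcases Finset.mem_insert.1 h with h | h <;> rcases Finset.mem_insert.1 h' with h' | h' <;>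
        (try simp only [Prod.mk.injEq] at h) <;> (try simp only [Prod.mk.injEq] at h')
      · rw [h.1, h'.1]
      · exact absurd (h.2 ▸ h') (hy _)
      · exact absurd (h'.2 ▸ h) (hy _)
      · exact hK.resource_unique _ _ _ h h'
    · rw [Finset.card_insert_of_notMem (hx y)]
      simp [Expr.val, h9]
    · intro a
      rw [Finset.image_insert, Finset.mem_insert, not_or, ← h3]
      by_cases ha : a = x <;> simp [Expr.val, h13, ha, Fin.val_inj]
    · intro b
      rw [Finset.image_insert, Finset.mem_insert, not_or, ← h4]
      by_cases ha : b = y <;> simp [Expr.val, h14, ha, Fin.val_inj]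
    · intro a b hab h
      rw [List.mem_append, List.mem_singleton] at h
      rw [Finset.image_insert, Finset.image_insert, Finset.mem_insert, Finset.mem_insert]
      rcases h with h | ⟨ha, h | h⟩
      · have := hc a b hab (Or.inl h); tauto
      · have := hc a b hab (Or.inr ⟨ha, h⟩); tauto
      · exact Or.inl (Or.inl (Fin.ext ha))

theorem greedy_ok (hN : G.Fits N) (h : Holds G σ) (h9 : σ.vars 9 = 0) (h3 : ∀ i, σ.arrs 3 i = 0)
    (h4 : ∀ i, σ.arrs 4 i = 0) :
    Ok N greedy σ fun τ => (∀ M, G.IsMatching M → M.card < τ.vars 9) ∧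
      τ.vars 9 ≤ 4 * G.stableSize + 1 := by
  refine Ok.seq (Ok.forLt (fun i τ => GreedyInv G i [] τ) (by rw [h.nA]; exact hN.nA_le)
    (by decide) (by decide) (by decide) ?_ ?_ ?_)
  · exact ⟨∅, ⟨by simp, by simp, by simp⟩, by simpa using h9, by simp [h3], by simp [h4], by simp⟩
  · rw [h.nA]
    intro i hi τ hF h5 hI
    have hH : Holds G τ := h.frame hF (by decide) (by decide)
    refine Ok.seq (Ok.set (Ok.eachA hN safe_matchStep (hH.congr (by simp) (by simp) rfl rfl rfl)
      (a := i) (by simp [Expr.val, h5]) hi (GreedyInv G i) ?_ ?_ ?_ ?_))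
    · intro l τ x v hx hI
      exact hI.setVar (by omega)
    · exact hI.setVar (by decide)
    · intro pre b hpre τ _ _ h13 h14 hI
      exact matchStep_ok (hpre.subset (by simp)) h13 h14 hI
    -- Once the whole list of agent `i` has been seen, the condition for prefixes becomes the
    -- condition for all agents before `i + 1`.
    · rintro τ _ ⟨K, h1, h2, h3, h4, hc⟩
      refine GreedyInv.setVar ⟨K, h1, h2, h3, h4, fun a b hab h => hc a b hab ?_⟩ (by decide)
      rcases h with h | ⟨-, h⟩
      · rcases Nat.lt_succ_iff_lt_or_eq.1 h with h | h
        · exact Or.inl h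
        · exact Or.inr ⟨h, G.mem_listA.2 ⟨a, b, h, rfl, hab⟩⟩
      · simp at h
  · rw [h.nA]
    rintro τ _ ⟨K, hK, hc, -, -, hmax⟩
    refine Ok.set ?_
    have hv : (τ.setVar 9 ((Expr.add (.add (.var 9) (.var 9)) (.lit 1)).val τ)).vars 9 =
        K.card + K.card + 1 := by
      simp [Expr.val, hc]
    rw [hv]
    refine ⟨fun M hM => hK.card_lt_of_maximal (fun a b hab => hmax a b hab (Or.inl a.2)) hM, ?_⟩
    have := hK.card_le_stableSize
    omega

/-! ### Deciding which edges are kept -/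

/-- Extend a relation between agents and resources to numbers. -/
def keepNat (keep : Fin G.nA → Fin G.nB → Bool) (a b : ℕ) : Bool :=
  if h : a < G.nA ∧ b < G.nB then keep ⟨a, h.1⟩ ⟨b, h.2⟩ else false

@[simp] theorem keepNat_coe (keep : Fin G.nA → Fin G.nB → Bool) (a : Fin G.nA) (b : Fin G.nB) :
    keepNat keep a b = keep a b := by simp [keepNat]

/-- The program `K` decides in variable `10` whether the edge of the agent in variable `13` and the
resource in variable `14` is kept, where the threshold is in variable `9`. -/
structure Decides (K : Prog) (keep : (G : OneOneLQ) → ℕ → Fin G.nA → Fin G.nB → Bool) : Prop where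
  vars : ∀ x ∈ K.wvars, x = 10 ∨ 30 ≤ x
  arrs : K.warrs = []
  ok : ∀ (G : OneOneLQ) (N : ℕ) (σ : State) (a b : ℕ), G.Fits N → Holds G σ → σ.vars 13 = a →
    σ.vars 14 = b → b ∈ G.listA a →
    Ok N K σ fun τ => τ.vars 10 = (keepNat (keep G (σ.vars 9)) a b).toNat

/-- Set `x` to the position of the value of `t` in the array `0`, counted from `base`. -/
def search (x : ℕ) (base t : Expr) : Prog :=
  .seq (.set x (.lit 0)) <|
  .loop (.eq (.eq (.get 0 (.add base (.var x))) t) (.lit 0)) (.set x (.add (.var x) (.lit 1)))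

/-- The loop has no bounds check: it stops because `v` occurs in `l`, and it stops at the first
occurrence. -/
theorem search_ok {x v : ℕ} {base t : Expr} {l : List ℕ} (ht : v ∈ l) (hl : l.length ≤ N)
    (hget : ∀ i < l.length, ∀ τ, (∀ y ≠ x, τ.vars y = σ.vars y) → τ.arrs = σ.arrs →
      τ.vars x = i → (Expr.get 0 (.add base (.var x))).val τ = l.getD i 0 ∧ t.val τ = v) :
    Ok N (search x base t) σ fun τ => τ.vars x = l.idxOf v := by
  have hlt := List.idxOf_lt_length_of_mem ht
  have hfr : ∀ τ, Frame (.set x (.add (.var x) (.lit 1))) (σ.setVar x 0) τ →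
      (∀ y ≠ x, τ.vars y = σ.vars y) ∧ τ.arrs = σ.arrs := fun τ hF =>
    ⟨fun y hy => by rw [hF.1 y (by simpa [Prog.wvars] using hy)]; simp [hy],
      funext fun A => by rw [hF.2 A (by simp [Prog.warrs])]; rfl⟩
  refine Ok.seq (Ok.set (Ok.loop (hlt.le.trans hl) (fun i τ => τ.vars x = i) (by simp [Expr.val])
    (fun i hi τ hF hI => ⟨?_, Ok.set (by simp [Expr.val, hI])⟩) (fun τ hF hI => ⟨?_, hI⟩)))
  · obtain ⟨h1, h2⟩ := hget i (hi.trans hlt) τ (hfr τ hF).1 (hfr τ hF).2 hI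
    have hne : l.getD i 0 ≠ v := by
      intro h
      rw [List.getD_eq_getElem _ _ (hi.trans hlt)] at h
      have := (List.mem_take_iff_idxOf_lt (n := i + 1) ht).1
        (List.mem_take_iff_getElem.2 ⟨i, by omega, h⟩)
      omega
    simp only [Expr.val] at h1 ⊢
    simp [h1, h2, -List.getD_eq_getElem?_getD, hne]
  · obtain ⟨h1, h2⟩ := hget _ hlt τ (hfr τ hF).1 (hfr τ hF).2 hI
    simp only [Expr.val] at h1 ⊢
    simp [h1, h2, hlt]

theorem idxOf_listA (a : Fin G.nA) (b : Fin G.nB) :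
    (G.listA a).idxOf (b : ℕ) = (G.prefA a).idxOf b := by
  rw [listA_coe, List.idxOf_map_of_injective' Fin.val_injective]

theorem idxOf_listB (a : Fin G.nA) (b : Fin G.nB) :
    (G.listB b).idxOf (a : ℕ) = (G.prefB b).idxOf a := by
  rw [listB_coe, List.idxOf_map_of_injective' Fin.val_injective]

/-- Set variable `30` to the position of the agent on the list of the resource. -/
def searchB : Prog := search 30 (.add (.get 2 (.var 14)) (.lit 2)) (.var 13)

/-- Set variable `31` to the position of the resource on the list of the agent. -/
def searchA : Prog := search 31 (.add (.get 1 (.var 13)) (.lit 1)) (.var 14)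

theorem searchB_ok (hN : G.Fits N) (h : Holds G σ) {a : Fin G.nA} {b : Fin G.nB}
    (h13 : σ.vars 13 = a) (h14 : σ.vars 14 = b) (hab : G.Edge a b) :
    Ok N searchB σ fun τ => τ.vars 30 = (G.prefB b).idxOf a := by
  rw [← idxOf_listB]
  refine search_ok (G.mem_listB.2 (G.mem_listA.2 ⟨a, b, rfl, rfl, hab⟩)) (hN.lenB_le b) ?_
  intro i hi τ hv ha hx
  simp only [Expr.val, ha, hx, hv 14 (by decide), h14, hv 13 (by decide), h13, and_true]
  exact h.getB b b.2 i hi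

theorem searchA_ok (hN : G.Fits N) (h : Holds G σ) {a : Fin G.nA} {b : Fin G.nB}
    (h13 : σ.vars 13 = a) (h14 : σ.vars 14 = b) (hab : G.Edge a b) :
    Ok N searchA σ fun τ => τ.vars 31 = (G.prefA a).idxOf b := by
  rw [← idxOf_listA]
  refine search_ok (G.mem_listA.2 ⟨a, b, rfl, rfl, hab⟩) (hN.lenA_le a) ?_
  intro i hi τ hv ha hx
  simp only [Expr.val, ha, hx, hv 14 (by decide), h14, hv 13 (by decide), h13, and_true]
  exact h.getA a a.2 i hi

/-- Decides `OneOneLQ.rsmKeep`. -/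
def rsmProg : Prog :=
  .seq searchB <| .seq searchA <|
  .branch (.lt (.var 30) (.var 9))
    (.branch (.add (.lt (.var 31) (.add (.var 9) (.var 9))) (.get 0 (.get 2 (.var 14))))
      (.set 10 (.lit 1)) (.set 10 (.lit 0)))
    (.set 10 (.lit 0))

theorem Holds.setVar (h : Holds G σ) {x v : ℕ} (h2 : 2 ≠ x) (h3 : 3 ≠ x) :
    Holds G (σ.setVar x v) :=
  h.congr (by simp [h2]) (by simp [h3]) rfl rfl rfl

theorem val_lt (e₁ e₂ : Expr) : (Expr.lt e₁ e₂).val σ ≠ 0 ↔ e₁.val σ < e₂.val σ := by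
  simp [Expr.val]

theorem val_eq (e₁ e₂ : Expr) : (Expr.eq e₁ e₂).val σ ≠ 0 ↔ e₁.val σ = e₂.val σ := by
  simp [Expr.val]

theorem rsmProg_decides : Decides rsmProg rsmKeep := by
  refine ⟨by decide, by decide, fun G N σ a b hN h h13 h14 hab => ?_⟩
  obtain ⟨a, b, rfl, rfl, hE⟩ := G.mem_listA.1 hab
  refine Ok.seq ((searchB_ok hN h h13 h14 hE).mono fun τ hF hB => Ok.seq ?_)
  refine (searchA_ok hN (h.frame hF (by decide) (by decide)) (by rw [hF.1 13 (by decide), h13])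
    (by rw [hF.1 14 (by decide), h14]) hE).mono fun υ hF' hA => ?_
  have e9 : υ.vars 9 = σ.vars 9 := by rw [hF'.1 9 (by decide), hF.1 9 (by decide)]
  have e30 : υ.vars 30 = (G.prefB b).idxOf a := by rw [hF'.1 30 (by decide), hB]
  have eq : υ.arrs 0 (υ.arrs 2 (υ.vars 14)) = (G.lq b).toNat := by
    rw [hF'.2 0 (by decide), hF'.2 2 (by decide), hF'.1 14 (by decide), hF.2 0 (by decide),
      hF.2 2 (by decide), hF.1 14 (by decide), h14, h.quota b b.2, quota_coe]
  have e1 : (Expr.lt (.var 30) (.var 9)).val υ ≠ 0 ↔ (G.prefB b).idxOf a < σ.vars 9 := by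
    rw [val_lt]; simp only [Expr.val, e30, e9]
  -- A disjunction is coded as a sum being nonzero.
  have e2 : (Expr.add (.lt (.var 31) (.add (.var 9) (.var 9))) (.get 0 (.get 2 (.var 14)))).val υ
      ≠ 0 ↔ (G.lq b = true ∨ (G.prefA a).idxOf b < σ.vars 9 + σ.vars 9) := by
    simp only [Expr.val, hA, e9, eq]
    cases G.lq b <;> simp
  rw [keepNat_coe, rsmKeep]
  refine Ok.branch (fun h1 => Ok.branch (fun h2 => Ok.set ?_) (fun h2 => Ok.set ?_))
    (fun h1 => Ok.set ?_)
  · rw [decide_eq_true ⟨e1.1 h1, e2.1 h2⟩]; simp [Expr.val]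
  · rw [decide_eq_false fun hc => e2.2 hc.2 h2]; simp [Expr.val]
  · rw [decide_eq_false fun hc => e1.2 hc.1 h1]; simp [Expr.val]

/-- Decides `OneOneLQ.efmKeep`. -/
def efmProg : Prog :=
  .seq searchB <| .seq searchA <|
  .seq (.set 32 (.lit 0)) <|
  .seq (.forLt 33 31 <|
    .seq (.set 34 (.get 2 (.get 0 (.add (.add (.get 1 (.var 13)) (.lit 1)) (.var 33))))) <|
    .branch (.eq (.add (.get 0 (.add (.var 34) (.lit 1)))
        (.add (.get 0 (.var 34)) (.get 0 (.var 34)))) (.lit 1))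
      (.set 32 (.lit 1)) .skip) <|
  .seq (.set 34 (.get 2 (.var 14))) <|
  .branch (.lt (.var 30) (.var 9))
    (.branch (.eq (.add (.get 0 (.add (.var 34) (.lit 1)))
        (.add (.get 0 (.var 34)) (.get 0 (.var 34)))) (.lit 1))
      (.set 10 (.sub (.lit 1) (.var 32))) (.set 10 (.lit 1)))
    (.set 10 (.lit 0))

/-- Degree plus twice the quota equals `1` exactly for degree `1` and quota `0`. Without the
doubling, an isolated LQ resource would pass the test. -/
theorem isPrivate_iff (h : Holds G σ) {b : Fin G.nB} {i : ℕ} (hi : σ.vars i = σ.arrs 2 b) :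
    (Expr.eq (.add (.get 0 (.add (.var i) (.lit 1)))
      (.add (.get 0 (.var i)) (.get 0 (.var i)))) (.lit 1)).val σ ≠ 0 ↔ G.isPrivate b = true := by
  rw [val_eq]
  simp only [Expr.val, hi, h.lenB b b.2, h.quota b b.2, quota_coe, listB_coe, List.length_map,
    isPrivate, decide_eq_true_eq]
  cases G.lq b <;> simp

theorem efmProg_decides : Decides efmProg efmKeep := by
  refine ⟨by decide, by decide, fun G N σ a b hN h h13 h14 hab => ?_⟩
  obtain ⟨a, b, rfl, rfl, hE⟩ := G.mem_listA.1 hab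
  refine Ok.seq ((searchB_ok hN h h13 h14 hE).mono fun τ hF hB => Ok.seq ?_)
  refine (searchA_ok hN (h.frame hF (by decide) (by decide)) (by rw [hF.1 13 (by decide), h13])
    (by rw [hF.1 14 (by decide), h14]) hE).mono fun υ hF' hA => ?_
  have e9 : υ.vars 9 = σ.vars 9 := by rw [hF'.1 9 (by decide), hF.1 9 (by decide)]
  have e13 : υ.vars 13 = a := by rw [hF'.1 13 (by decide), hF.1 13 (by decide), h13]
  have e14 : υ.vars 14 = b := by rw [hF'.1 14 (by decide), hF.1 14 (by decide), h14]
  have e30 : υ.vars 30 = (G.prefB b).idxOf a := by rw [hF'.1 30 (by decide), hB]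
  have hυ : Holds G υ := (h.frame hF (by decide) (by decide)).frame hF' (by decide) (by decide)
  have hlt : (G.prefA a).idxOf b < (G.prefA a).length := List.idxOf_lt_length_of_mem hE
  have hlen : (G.listA a).length = (G.prefA a).length := by rw [listA_coe, List.length_map]
  clear hF hB hF'
  -- Variable `32` flags a private resource among the first `i` entries; the loop stops just before
  -- the position of `b`, so at the end it flags a better private one.
  refine Ok.seq (Ok.set (Ok.seq (Ok.forLt (fun i τ => τ.vars 32 ≤ 1 ∧ (τ.vars 32 = 1 ↔
    ∃ b' ∈ G.prefA a, G.isPrivate b' = true ∧ (G.prefA a).idxOf b' < i))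
    ?_ (by decide) (by decide) (by decide) ?_ ?_ ?_)))
  · have := hN.lenA_le a
    simp [hA]
    omega
  · simp [Expr.val]
  · intro i hi τ hF h33 hI
    replace hi : i < (G.prefA a).length := by simp [hA] at hi; omega
    have hτ : Holds G τ := Holds.frame (hυ.setVar (x := 32) (by decide) (by decide)) hF
      (by decide) (by decide)
    have h13 : τ.vars 13 = a := by rw [hF.1 13 (by decide)]; simp [e13]
    have hval : (Expr.get 2 (.get 0 (.add (.add (.get 1 (.var 13)) (.lit 1)) (.var 33)))).val τ =
        τ.arrs 2 ((G.prefA a)[i] : ℕ) := by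
      simp only [Expr.val, h13, h33, hτ.getA a a.2 i (hlen ▸ hi)]
      simp [listA_coe, hi]
    refine Ok.seq (Ok.set ?_)
    have hτ' : Holds G (τ.setVar 34 (τ.arrs 2 ((G.prefA a)[i] : ℕ))) :=
      hτ.congr (by simp) (by simp) rfl rfl rfl
    rw [hval]
    have hiff := isPrivate_iff hτ' (b := (G.prefA a)[i]) (i := 34) (by simp)
    have hsplit : (∃ b' ∈ G.prefA a, G.isPrivate b' = true ∧ (G.prefA a).idxOf b' < i + 1) ↔
        (∃ b' ∈ G.prefA a, G.isPrivate b' = true ∧ (G.prefA a).idxOf b' < i) ∨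
          G.isPrivate (G.prefA a)[i] = true := by
      constructor
      · rintro ⟨b', h1, h2, h3⟩
        rcases Nat.lt_succ_iff_lt_or_eq.1 h3 with h3 | h3
        · exact Or.inl ⟨b', h1, h2, h3⟩
        · subst h3
          rw [List.getElem_idxOf]
          exact Or.inr h2
      · rintro (⟨b', h1, h2, h3⟩ | h1)
        · exact ⟨b', h1, h2, by omega⟩
        · exact ⟨_, List.getElem_mem hi, h1, by rw [(G.nodupA a).idxOf_getElem]; omega⟩
    rw [hsplit]
    refine Ok.branch (fun h1 => Ok.set ?_) (fun h1 => Ok.skip ?_)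
    · simp [Expr.val, hiff.1 h1]
    · have : ¬ G.isPrivate (G.prefA a)[i] = true := fun hc => hiff.2 hc h1
      simp only [this]
      simpa using hI
  · intro τ hF hI
    replace hI : τ.vars 32 ≤ 1 ∧ (τ.vars 32 = 1 ↔ ∃ b' ∈ G.prefA a, G.isPrivate b' = true ∧
        (G.prefA a).idxOf b' < (G.prefA a).idxOf b) := by simpa [hA] using hI
    have hτ : Holds G τ := Holds.frame (hυ.setVar (x := 32) (by decide) (by decide)) hF
      (by decide) (by decide)
    have h14 : τ.vars 14 = b := by rw [hF.1 14 (by decide)]; simp [e14]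
    have h9 : τ.vars 9 = σ.vars 9 := by rw [hF.1 9 (by decide)]; simp [e9]
    have h30 : τ.vars 30 = (G.prefB b).idxOf a := by rw [hF.1 30 (by decide)]; simp [e30]
    refine Ok.seq (Ok.set ?_)
    have hval : (Expr.get 2 (.var 14)).val τ = τ.arrs 2 (b : ℕ) := by simp [Expr.val, h14]
    rw [hval]
    have hτ' : Holds G (τ.setVar 34 (τ.arrs 2 (b : ℕ))) := hτ.congr (by simp) (by simp) rfl rfl rfl
    have e1 : (Expr.lt (.var 30) (.var 9)).val (τ.setVar 34 (τ.arrs 2 (b : ℕ))) ≠ 0 ↔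
        (G.prefB b).idxOf a < σ.vars 9 := by
      rw [val_lt]; simp [Expr.val, h30, h9]
    have e2 := isPrivate_iff hτ' (b := b) (i := 34) (by simp)
    rw [keepNat_coe, efmKeep]
    refine Ok.branch (fun h1 => Ok.branch (fun h2 => Ok.set ?_) (fun h2 => Ok.set ?_))
      (fun h1 => Ok.set ?_)
    · by_cases hc : τ.vars 32 = 1
      · rw [decide_eq_false fun h3 => h3.2 ⟨e2.1 h2, hI.2.1 hc⟩]; simp [Expr.val, hc]
      · rw [decide_eq_true ⟨e1.1 h1, fun h3 => hc (hI.2.2 h3.2)⟩]; simp [Expr.val]; omega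
    · rw [decide_eq_true ⟨e1.1 h1, fun h3 => e2.2 h3.1 h2⟩]; simp [Expr.val]
    · rw [decide_eq_false fun h3 => e1.2 h3.1 h1]; simp [Expr.val]

end RAM

/-! ### The word of the restricted instance -/

namespace OneOneLQ

variable (G : OneOneLQ) (kp : ℕ → ℕ → Bool)

/-- The neighbours of the agent `a` along the edges selected by `kp`. -/
def keptA (a : ℕ) : List ℕ := (G.listA a).filter (kp a)

/-- The neighbours of the resource `b` along the edges selected by `kp`. -/
def keptB (b : ℕ) : List ℕ := (G.listB b).filter fun a => kp a b

/-- The number of agents before `i` that are on a selected edge. -/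
def rankA (i : ℕ) : ℕ := ((List.range i).filter fun a => G.keptA kp a ≠ []).length

/-- The number of resources before `i` that are on a selected edge. -/
def rankB (i : ℕ) : ℕ := ((List.range i).filter fun b => G.keptB kp b ≠ []).length

/-- The part for the agent `a` of the word of the restriction. -/
def outA (a : ℕ) : List ℕ :=
  if G.keptA kp a = [] then [] else (G.keptA kp a).length :: (G.keptA kp a).map (G.rankB kp)

/-- The part for the resource `b` of the word of the restriction. -/
def outB (b : ℕ) : List ℕ :=
  if G.keptB kp b = [] then [] else
    G.quota b :: (G.keptB kp b).length :: (G.keptB kp b).map (G.rankA kp)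

/-- The word of the restriction of `G` to the edges selected by `kp`. -/
def output (k : ℕ) : List ℕ :=
  [k, G.rankA kp G.nA, G.rankB kp G.nB] ++ (List.range G.nA).flatMap (G.outA kp) ++
    (List.range G.nB).flatMap (G.outB kp)

theorem rankA_succ (i : ℕ) :
    G.rankA kp (i + 1) = G.rankA kp i + if G.keptA kp i = [] then 0 else 1 := by
  by_cases h : G.keptA kp i = [] <;> simp [rankA, List.range_succ, h]

theorem rankB_succ (i : ℕ) :
    G.rankB kp (i + 1) = G.rankB kp i + if G.keptB kp i = [] then 0 else 1 := by
  by_cases h : G.keptB kp i = [] <;> simp [rankB, List.range_succ, h]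

theorem length_outA_le (a : ℕ) : (G.outA kp a).length ≤ (G.codeA a).length := by
  unfold outA codeA
  have : (G.keptA kp a).length ≤ (G.listA a).length := List.length_filter_le _ _
  split <;> simp [this]

theorem length_outB_le (b : ℕ) : (G.outB kp b).length ≤ (G.codeB b).length := by
  unfold outB codeB
  have : (G.keptB kp b).length ≤ (G.listB b).length := List.length_filter_le _ _
  split <;> simp [this]

theorem _root_.List.length_flatMap_le_length_flatMap {α β γ : Type*} {f : α → List β}
    {g : α → List γ} (h : ∀ a, (f a).length ≤ (g a).length) (l : List α) :
    (l.flatMap f).length ≤ (l.flatMap g).length := by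
  induction l with
  | nil => simp
  | cons a l ih => simpa using Nat.add_le_add (h a) (by simpa using ih)

/-- Needed for the final copying loop, whose number of rounds is the output length. -/
theorem length_output_le (k k' : ℕ) : (G.output kp k).length ≤ (G.encode k').length := by
  rw [encode_eq, output]
  have h1 := List.length_flatMap_le_length_flatMap (G.length_outA_le kp) (List.range G.nA)
  have h2 := List.length_flatMap_le_length_flatMap (G.length_outB_le kp) (List.range G.nB)
  rw [List.length_append, List.length_append, List.length_append, List.length_append]
  simp only [List.length_cons, List.length_nil]
  omega

end OneOneLQ

namespace RAM

open OneOneLQ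

variable {G : OneOneLQ} {N L : ℕ} {σ : State} {Q : State → Prop} {K : Prog}
  {keep : (G : OneOneLQ) → ℕ → Fin G.nA → Fin G.nB → Bool}

theorem Decides.notMem (hK : Decides K keep) {x : ℕ} (h1 : x ≠ 10) (h2 : x < 30) :
    x ∉ K.wvars := fun h => by
  have := hK.vars x h
  omega

/-! ### Degrees and new numbers -/

/-- Run `p` if the edge under consideration is kept. -/
def whenKept (K p : Prog) : Prog := .seq K (.branch (.var 10) p .skip)

theorem safe_whenKept (hK : Decides K keep) {p : Prog} (hp : Safe p) : Safe (whenKept K p) := by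
  refine ⟨fun x hx => ?_, fun A hA => ?_⟩
  · simp only [whenKept, Prog.wvars, List.append_nil, List.mem_append] at hx
    rcases hx with hx | hx
    · have := hK.vars x hx; omega
    · exact hp.vars x hx
  · simp only [whenKept, Prog.warrs, List.append_nil, List.mem_append, hK.arrs] at hA
    exact hp.arrs A (by simpa using hA)

theorem whenKept_ok (hK : Decides K keep) (hN : G.Fits N) (h : Holds G σ) {a b : ℕ}
    (h13 : σ.vars 13 = a) (h14 : σ.vars 14 = b) (hab : b ∈ G.listA a) (h9 : σ.vars 9 = L)
    {p : Prog}
    (hp : keepNat (keep G L) a b = true → ∀ τ, Frame K σ τ → Ok N p τ Q)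
    (hq : keepNat (keep G L) a b = false → ∀ τ, Frame K σ τ → Q τ) :
    Ok N (whenKept K p) σ Q := by
  refine Ok.seq ((hK.ok G N σ a b hN h h13 h14 hab).mono fun τ hF h10 => ?_)
  rw [h9] at h10
  refine Ok.branch (fun hb => hp ?_ τ hF) (fun hb => Ok.skip (hq ?_ τ hF)) <;>
    simpa [Expr.val, h10] using hb

theorem _root_.List.filter_concat {α : Type*} (p : α → Bool) (l : List α) (x : α) :
    (l ++ [x]).filter p = l.filter p ++ if p x = true then [x] else [] := by
  by_cases h : p x = true <;> simp [h]

/-- Increase the degree of the agent in variable `13`. -/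
def bumpA : Prog := .put 5 (.var 13) (.add (.get 5 (.var 13)) (.lit 1))

/-- Increase the degree of the resource in variable `14`. -/
def bumpB : Prog := .put 6 (.var 14) (.add (.get 6 (.var 14)) (.lit 1))

theorem safe_bumpA : Safe bumpA := ⟨by simp [bumpA, Prog.wvars], by simp [bumpA, Prog.warrs]⟩

theorem safe_bumpB : Safe bumpB := ⟨by simp [bumpB, Prog.wvars], by simp [bumpB, Prog.warrs]⟩

theorem countA_ok (hK : Decides K keep) (hN : G.Fits N) (h : Holds G σ) {a : ℕ}
    (h13 : σ.vars 13 = a) (ha : a < G.nA) (h9 : σ.vars 9 = L) :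
    Ok N (whenKept K bumpA).eachA σ fun τ =>
      τ.arrs 5 a = σ.arrs 5 a + (G.keptA (keepNat (keep G L)) a).length ∧
        ∀ a' ≠ a, τ.arrs 5 a' = σ.arrs 5 a' := by
  refine Ok.eachA hN (safe_whenKept hK safe_bumpA) h h13 ha (fun l τ =>
      τ.arrs 5 a = σ.arrs 5 a + (l.filter (keepNat (keep G L) a)).length ∧
        ∀ a' ≠ a, τ.arrs 5 a' = σ.arrs 5 a')
    (fun _ _ _ _ _ hI => by simpa using hI) (by simp) ?_ (fun τ _ hI => hI)
  intro pre b hpre τ hF hH h13 h14 hI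
  have h9' : τ.vars 9 = L := by
    rw [hF.1 9 (by simp [mem_wvars_eachA, whenKept, bumpA, Prog.wvars, hK.notMem]), h9]
  refine whenKept_ok hK hN hH h13 h14 (hpre.subset (by simp)) h9' (fun hk υ hFK => Ok.put ?_)
    (fun hk υ hFK => ?_)
  · have h13' : υ.vars 13 = a := by rw [hFK.1 13 (by simp [hK.notMem]), h13]
    have h5 : υ.arrs 5 = τ.arrs 5 := hFK.2 5 (by simp [hK.arrs])
    rw [List.filter_concat, if_pos hk]
    refine ⟨?_, fun a' ha' => ?_⟩
    · simp [Expr.val, h13', h5, hI.1, add_assoc]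
    · simp [Expr.val, h13', h5, ha', hI.2 a' ha']
  · rw [List.filter_concat, if_neg (by simp [hk]), List.append_nil, hFK.2 5 (by simp [hK.arrs])]
    exact hI

theorem countB_ok (hK : Decides K keep) (hN : G.Fits N) (h : Holds G σ) {b : ℕ}
    (h14 : σ.vars 14 = b) (hb : b < G.nB) (h9 : σ.vars 9 = L) :
    Ok N (whenKept K bumpB).eachB σ fun τ =>
      τ.arrs 6 b = σ.arrs 6 b + (G.keptB (keepNat (keep G L)) b).length ∧
        ∀ b' ≠ b, τ.arrs 6 b' = σ.arrs 6 b' := by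
  refine Ok.eachB hN (safe_whenKept hK safe_bumpB) h h14 hb (fun l τ =>
      τ.arrs 6 b = σ.arrs 6 b + (l.filter fun a => keepNat (keep G L) a b).length ∧
        ∀ b' ≠ b, τ.arrs 6 b' = σ.arrs 6 b')
    (fun _ _ _ _ _ hI => by simpa using hI) (by simp) ?_ (fun τ _ hI => hI)
  intro pre a hpre τ hF hH h13 h14 hI
  have h9' : τ.vars 9 = L := by
    rw [hF.1 9 (by simp [mem_wvars_eachB, whenKept, bumpB, Prog.wvars, hK.notMem]), h9]
  refine whenKept_ok hK hN hH h13 h14 (G.mem_listB.1 (hpre.subset (by simp))) h9'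
    (fun hk υ hFK => Ok.put ?_) (fun hk υ hFK => ?_)
  · have h14' : υ.vars 14 = b := by rw [hFK.1 14 (by simp [hK.notMem]), h14]
    have h5 : υ.arrs 6 = τ.arrs 6 := hFK.2 6 (by simp [hK.arrs])
    rw [List.filter_concat, if_pos hk]
    refine ⟨?_, fun a' ha' => ?_⟩
    · simp [Expr.val, h14', h5, hI.1, add_assoc]
    · simp [Expr.val, h14', h5, ha', hI.2 a' ha']
  · rw [List.filter_concat, if_neg (by simp [hk]), List.append_nil, hFK.2 6 (by simp [hK.arrs])]
    exact hI

/-- Compute the degrees of the agents after the restriction in array `5`, their new numbers in array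
`7` and their number in variable `11`. -/
def renumberA (K : Prog) : Prog :=
  .forLt 5 2 <|
  .seq (.set 13 (.var 5)) <|
  .seq (.put 7 (.var 13) (.var 11)) <|
  .seq (whenKept K bumpA).eachA <|
  .branch (.get 5 (.var 13)) (.set 11 (.add (.var 11) (.lit 1))) .skip

/-- Compute the degrees of the resources after the restriction in array `6`, their new numbers in
array `8` and their number in variable `12`. -/
def renumberB (K : Prog) : Prog :=
  .forLt 5 3 <|
  .seq (.set 14 (.var 5)) <|
  .seq (.put 8 (.var 14) (.var 12)) <|
  .seq (whenKept K bumpB).eachB <|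
  .branch (.get 6 (.var 14)) (.set 12 (.add (.var 12) (.lit 1))) .skip

/-- The program `K` is a parameter, so its write set cannot be computed; it contains only variable
`10` and variables from `30` on. -/
theorem wvars_renumberA (hK : Decides K keep) {x : ℕ}
    (hx : x ∈ (renumberA K).wvars) : 5 ≤ x ∧ x ≠ 8 ∧ x ≠ 9 ∧ x ≠ 12 := by
  by_cases hk : x ∈ K.wvars
  · have := hK.vars x hk
    omega
  · simp [renumberA, Prog.forLt, Prog.eachA, whenKept, bumpA, Prog.wvars, hk] at hx
    omega

theorem warrs_renumberA (hK : Decides K keep) {A : ℕ} (hA : A ∈ (renumberA K).warrs) :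
    A = 5 ∨ A = 7 := by
  simp [renumberA, Prog.forLt, whenKept, bumpA, Prog.warrs, hK.arrs] at hA
  omega

theorem wvars_renumberB (hK : Decides K keep) {x : ℕ}
    (hx : x ∈ (renumberB K).wvars) : 5 ≤ x ∧ x ≠ 8 ∧ x ≠ 9 ∧ x ≠ 11 := by
  by_cases hk : x ∈ K.wvars
  · have := hK.vars x hk
    omega
  · simp [renumberB, Prog.forLt, Prog.eachB, whenKept, bumpB, Prog.wvars, hk] at hx
    omega

theorem warrs_renumberB (hK : Decides K keep) {A : ℕ} (hA : A ∈ (renumberB K).warrs) :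
    A = 6 ∨ A = 8 := by
  simp [renumberB, Prog.forLt, whenKept, bumpB, Prog.warrs, hK.arrs] at hA
  omega

theorem Holds.frame' (h : Holds G σ) {τ : State} {p : Prog} (hF : Frame p σ τ)
    (hv : ∀ x ∈ p.wvars, 4 ≤ x) (ha : ∀ A ∈ p.warrs, 3 ≤ A) : Holds G τ :=
  h.frame hF ⟨fun h => absurd (hv _ h) (by decide), fun h => absurd (hv _ h) (by decide)⟩
    ⟨fun h => absurd (ha _ h) (by decide), fun h => absurd (ha _ h) (by decide),
      fun h => absurd (ha _ h) (by decide)⟩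

theorem Holds.setArr (h : Holds G σ) {A i v : ℕ} (hA : 3 ≤ A) : Holds G (σ.setArr A i v) :=
  h.congr rfl rfl (State.setArr_arrs_of_ne _ _ _ (by omega))
    (State.setArr_arrs_of_ne _ _ _ (by omega)) (State.setArr_arrs_of_ne _ _ _ (by omega))

theorem renumberA_ok (hK : Decides K keep) (hN : G.Fits N) (h : Holds G σ) (h9 : σ.vars 9 = L)
    (h11 : σ.vars 11 = 0) (h5 : ∀ a, σ.arrs 5 a = 0) :
    Ok N (renumberA K) σ fun τ => (∀ a < G.nA,
      τ.arrs 5 a = (G.keptA (keepNat (keep G L)) a).length ∧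
      τ.arrs 7 a = G.rankA (keepNat (keep G L)) a) ∧
      τ.vars 11 = G.rankA (keepNat (keep G L)) G.nA := by
  -- The last clause is needed since degrees are counted by increments from `0`. The new number is
  -- stored before the degree is known, so dropped agents get a number too.
  refine Ok.forLt (fun i τ => (∀ a < i, τ.arrs 5 a = (G.keptA (keepNat (keep G L)) a).length ∧
      τ.arrs 7 a = G.rankA (keepNat (keep G L)) a) ∧
      τ.vars 11 = G.rankA (keepNat (keep G L)) i ∧ ∀ a, i ≤ a → τ.arrs 5 a = 0)
    (by rw [h.nA]; exact hN.nA_le) (by decide) ?_ ?_ ?_ ?_ ?_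
  · simp [Prog.eachA, Prog.forLt, whenKept, bumpA, Prog.wvars, hK.notMem]
  · simp [Prog.eachA, Prog.forLt, whenKept, bumpA, Prog.wvars, hK.notMem]
  · simp [rankA, h11, h5]
  · rw [h.nA]
    intro i hi τ hF hx hI
    have hH : Holds G τ := h.frame' hF
      (fun x hx => by have := wvars_renumberA hK hx; omega)
      (fun A hA => by have := warrs_renumberA hK hA; omega)
    have hL : τ.vars 9 = L := by
      rw [hF.1 9 (fun hx => absurd (wvars_renumberA hK hx) (by decide)), h9]
    refine Ok.seq (Ok.set (Ok.seq (Ok.put (Ok.seq ?_))))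
    refine (countA_ok (L := L) hK hN ((hH.setVar (by decide) (by decide)).setArr (by decide)) (a := i) (by simp [Expr.val, hx]) hi
      (by simp [hL])).mono fun υ hF' hυ => ?_
    have h13 : υ.vars 13 = i := by
      rw [hF'.1 13 (by simp [mem_wvars_eachA, whenKept, bumpA, Prog.wvars, hK.notMem])]
      simp [Expr.val, hx]
    have h11 : υ.vars 11 = G.rankA (keepNat (keep G L)) i := by
      rw [hF'.1 11 (by simp [mem_wvars_eachA, whenKept, bumpA, Prog.wvars, hK.notMem])]
      simp [hI.2.1]
    have h7 : ∀ a, υ.arrs 7 a = if a = i then G.rankA (keepNat (keep G L)) i else τ.arrs 7 a := by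
      intro a
      rw [hF'.2 7 (by simp [whenKept, bumpA, Prog.warrs, hK.arrs])]
      simp [Expr.val, hx, hI.2.1]
    have h5i : υ.arrs 5 i = (G.keptA (keepNat (keep G L)) i).length := by
      rw [hυ.1]; simp [hI.2.2 i le_rfl]
    have h5 : ∀ a ≠ i, υ.arrs 5 a = τ.arrs 5 a := fun a ha => by
      rw [hυ.2 a ha]; simp
    have key : (∀ a < i + 1, υ.arrs 5 a = (G.keptA (keepNat (keep G L)) a).length ∧
        υ.arrs 7 a = G.rankA (keepNat (keep G L)) a) ∧ ∀ a, i + 1 ≤ a → υ.arrs 5 a = 0 := by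
      refine ⟨fun a ha => ?_, fun a ha => ?_⟩
      · rcases Nat.lt_succ_iff_lt_or_eq.1 ha with ha | rfl
        · rw [h5 a ha.ne, h7, if_neg ha.ne]; exact hI.1 a ha
        · exact ⟨h5i, by rw [h7, if_pos rfl]⟩
      · rw [h5 a (by omega)]; exact hI.2.2 a (by omega)
    refine Ok.branch (fun hb => Ok.set ?_) (fun hb => Ok.skip ?_)
    · have hne : G.keptA (keepNat (keep G L)) i ≠ [] := by
        simpa [Expr.val, h13, h5i] using hb
      exact ⟨by simpa using key.1, by simp [Expr.val, h11, rankA_succ, hne], by simpa using key.2⟩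
    · have hne : G.keptA (keepNat (keep G L)) i = [] := by
        simpa [Expr.val, h13, h5i] using hb
      exact ⟨by simpa using key.1, by simp [h11, rankA_succ, hne], by simpa using key.2⟩
  · rw [h.nA]
    exact fun τ _ hI => ⟨hI.1, hI.2.1⟩

theorem renumberB_ok (hK : Decides K keep) (hN : G.Fits N) (h : Holds G σ) (h9 : σ.vars 9 = L)
    (h12 : σ.vars 12 = 0) (h6 : ∀ b, σ.arrs 6 b = 0) :
    Ok N (renumberB K) σ fun τ => (∀ b < G.nB,
      τ.arrs 6 b = (G.keptB (keepNat (keep G L)) b).length ∧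
      τ.arrs 8 b = G.rankB (keepNat (keep G L)) b) ∧
      τ.vars 12 = G.rankB (keepNat (keep G L)) G.nB := by
  refine Ok.forLt (fun i τ => (∀ b < i, τ.arrs 6 b = (G.keptB (keepNat (keep G L)) b).length ∧
      τ.arrs 8 b = G.rankB (keepNat (keep G L)) b) ∧
      τ.vars 12 = G.rankB (keepNat (keep G L)) i ∧ ∀ b, i ≤ b → τ.arrs 6 b = 0)
    (by rw [h.nB]; exact hN.nB_le) (by decide) ?_ ?_ ?_ ?_ ?_
  · simp [Prog.eachB, Prog.forLt, whenKept, bumpB, Prog.wvars, hK.notMem]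
  · simp [Prog.eachB, Prog.forLt, whenKept, bumpB, Prog.wvars, hK.notMem]
  · simp [rankB, h12, h6]
  · rw [h.nB]
    intro i hi τ hF hx hI
    have hH : Holds G τ := h.frame' hF
      (fun x hx => by have := wvars_renumberB hK hx; omega)
      (fun A hA => by have := warrs_renumberB hK hA; omega)
    have hL : τ.vars 9 = L := by
      rw [hF.1 9 (fun hx => absurd (wvars_renumberB hK hx) (by decide)), h9]
    refine Ok.seq (Ok.set (Ok.seq (Ok.put (Ok.seq ?_))))
    refine (countB_ok (L := L) hK hN ((hH.setVar (by decide) (by decide)).setArr (by decide)) (b := i) (by simp [Expr.val, hx]) hi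
      (by simp [hL])).mono fun υ hF' hυ => ?_
    have h14 : υ.vars 14 = i := by
      rw [hF'.1 14 (by simp [mem_wvars_eachB, whenKept, bumpB, Prog.wvars, hK.notMem])]
      simp [Expr.val, hx]
    have h12 : υ.vars 12 = G.rankB (keepNat (keep G L)) i := by
      rw [hF'.1 12 (by simp [mem_wvars_eachB, whenKept, bumpB, Prog.wvars, hK.notMem])]
      simp [hI.2.1]
    have h8 : ∀ a, υ.arrs 8 a = if a = i then G.rankB (keepNat (keep G L)) i else τ.arrs 8 a := by
      intro a
      rw [hF'.2 8 (by simp [whenKept, bumpB, Prog.warrs, hK.arrs])]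
      simp [Expr.val, hx, hI.2.1]
    have h6i : υ.arrs 6 i = (G.keptB (keepNat (keep G L)) i).length := by
      rw [hυ.1]; simp [hI.2.2 i le_rfl]
    have h6 : ∀ a ≠ i, υ.arrs 6 a = τ.arrs 6 a := fun a ha => by
      rw [hυ.2 a ha]; simp
    have key : (∀ a < i + 1, υ.arrs 6 a = (G.keptB (keepNat (keep G L)) a).length ∧
        υ.arrs 8 a = G.rankB (keepNat (keep G L)) a) ∧ ∀ a, i + 1 ≤ a → υ.arrs 6 a = 0 := by
      refine ⟨fun a ha => ?_, fun a ha => ?_⟩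
      · rcases Nat.lt_succ_iff_lt_or_eq.1 ha with ha | rfl
        · rw [h6 a ha.ne, h8, if_neg ha.ne]; exact hI.1 a ha
        · exact ⟨h6i, by rw [h8, if_pos rfl]⟩
      · rw [h6 a (by omega)]; exact hI.2.2 a (by omega)
    refine Ok.branch (fun hb => Ok.set ?_) (fun hb => Ok.skip ?_)
    · have hne : G.keptB (keepNat (keep G L)) i ≠ [] := by
        simpa [Expr.val, h14, h6i] using hb
      exact ⟨by simpa using key.1, by simp [Expr.val, h12, rankB_succ, hne], by simpa using key.2⟩
    · have hne : G.keptB (keepNat (keep G L)) i = [] := by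
        simpa [Expr.val, h14, h6i] using hb
      exact ⟨by simpa using key.1, by simp [h12, rankB_succ, hne], by simpa using key.2⟩
  · rw [h.nB]
    exact fun τ _ hI => ⟨hI.1, hI.2.1⟩

end RAM

namespace RAM

open OneOneLQ

variable {G : OneOneLQ} {N L : ℕ} {σ : State} {Q : State → Prop} {K : Prog}
  {keep : (G : OneOneLQ) → ℕ → Fin G.nA → Fin G.nB → Bool}

/-! ### Output -/

/-- Append a value to the word in the array `9`, with its length in variable `4`. -/
def push (e : Expr) : Prog := .seq (.put 9 (.var 4) e) (.set 4 (.add (.var 4) (.lit 1)))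

/-- The word in the array `9`, with its length in variable `4`, is `l`. -/
def Written (l : List ℕ) (τ : State) : Prop :=
  τ.vars 4 = l.length ∧ ∀ i < l.length, τ.arrs 9 i = l.getD i 0

theorem Written.congr {l : List ℕ} {τ : State} (h : Written l σ) (h4 : τ.vars 4 = σ.vars 4)
    (h9 : τ.arrs 9 = σ.arrs 9) : Written l τ :=
  ⟨h4.trans h.1, fun i hi => by rw [h9]; exact h.2 i hi⟩

theorem Written.setVar {l : List ℕ} (h : Written l σ) {x v : ℕ} (hx : 4 ≠ x) :
    Written l (σ.setVar x v) :=
  h.congr (by simp [hx]) rfl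

theorem push_ok {l : List ℕ} {e : Expr} {v : ℕ} (h : Written l σ) (hv : e.val σ = v) :
    Ok N (push e) σ (Written (l ++ [v])) := by
  refine Ok.seq (Ok.put (Ok.set ⟨by simp [Expr.val, h.1], fun i hi => ?_⟩))
  rw [List.length_append, List.length_singleton] at hi
  rcases Nat.lt_succ_iff_lt_or_eq.1 hi with hi | rfl
  · rw [List.getD_append _ _ _ _ hi, ← h.2 i hi]
    simp [Expr.val, h.1, hi.ne]
  · simp [Expr.val, h.1, hv]

theorem safe_push (e : Expr) : Safe (push e) :=
  ⟨by simp [push, Prog.wvars], by simp [push, Prog.warrs]⟩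

theorem writeA_ok (hK : Decides K keep) (hN : G.Fits N) (h : Holds G σ) {a : ℕ}
    (h13 : σ.vars 13 = a) (ha : a < G.nA) (h9 : σ.vars 9 = L) {f : ℕ → ℕ}
    (hf : ∀ b < G.nB, σ.arrs 8 b = f b) {l : List ℕ} (hl : Written l σ) :
    Ok N (whenKept K (push (.get 8 (.var 14)))).eachA σ
      (Written (l ++ (G.keptA (keepNat (keep G L)) a).map f)) := by
  refine Ok.eachA hN (safe_whenKept hK (safe_push _)) h h13 ha
    (fun pre => Written (l ++ (pre.filter (keepNat (keep G L) a)).map f))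
    (fun _ _ _ _ hx hI => hI.setVar (by omega)) (by simpa using hl) ?_ (fun τ _ hI => hI)
  intro pre b hpre τ hF hH h13 h14 hI
  have h9' : τ.vars 9 = L := by
    rw [hF.1 9 (by simp [mem_wvars_eachA, whenKept, push, Prog.wvars, hK.notMem]), h9]
  have hab : b ∈ G.listA a := hpre.subset (by simp)
  have h8 : τ.arrs 8 b = f b := by
    rw [hF.2 8 (by simp [whenKept, push, Prog.warrs, hK.arrs]), hf b (G.lt_of_mem_listA hab).2]
  refine whenKept_ok hK hN hH h13 h14 hab h9' (fun hk υ hFK => ?_) (fun hk υ hFK => ?_)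
  · have hW := hI.congr (hFK.1 4 (by simp [hK.notMem])) (hFK.2 9 (by simp [hK.arrs]))
    rw [List.filter_concat, if_pos hk, List.map_append, ← List.append_assoc]
    refine push_ok hW ?_
    simp only [Expr.val]
    rw [hFK.1 14 (by simp [hK.notMem]), hFK.2 8 (by simp [hK.arrs]), h14, h8]
  · rw [List.filter_concat, if_neg (by simp [hk]), List.append_nil]
    exact hI.congr (hFK.1 4 (by simp [hK.notMem])) (hFK.2 9 (by simp [hK.arrs]))

theorem writeB_ok (hK : Decides K keep) (hN : G.Fits N) (h : Holds G σ) {b : ℕ}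
    (h14 : σ.vars 14 = b) (hb : b < G.nB) (h9 : σ.vars 9 = L) {f : ℕ → ℕ}
    (hf : ∀ a < G.nA, σ.arrs 7 a = f a) {l : List ℕ} (hl : Written l σ) :
    Ok N (whenKept K (push (.get 7 (.var 13)))).eachB σ
      (Written (l ++ (G.keptB (keepNat (keep G L)) b).map f)) := by
  refine Ok.eachB hN (safe_whenKept hK (safe_push _)) h h14 hb
    (fun pre => Written (l ++ (pre.filter fun a => keepNat (keep G L) a b).map f))
    (fun _ _ _ _ hx hI => hI.setVar (by omega)) (by simpa using hl) ?_ (fun τ _ hI => hI)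
  intro pre a hpre τ hF hH h13 h14 hI
  have h9' : τ.vars 9 = L := by
    rw [hF.1 9 (by simp [mem_wvars_eachB, whenKept, push, Prog.wvars, hK.notMem]), h9]
  have hab : b ∈ G.listA a := G.mem_listB.1 (hpre.subset (by simp))
  have h7 : τ.arrs 7 a = f a := by
    rw [hF.2 7 (by simp [whenKept, push, Prog.warrs, hK.arrs]), hf a (G.lt_of_mem_listA hab).1]
  refine whenKept_ok hK hN hH h13 h14 hab h9' (fun hk υ hFK => ?_) (fun hk υ hFK => ?_)
  · have hW := hI.congr (hFK.1 4 (by simp [hK.notMem])) (hFK.2 9 (by simp [hK.arrs]))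
    rw [List.filter_concat, if_pos hk, List.map_append, ← List.append_assoc]
    refine push_ok hW ?_
    simp only [Expr.val]
    rw [hFK.1 13 (by simp [hK.notMem]), hFK.2 7 (by simp [hK.arrs]), h13, h7]
  · rw [List.filter_concat, if_neg (by simp [hk]), List.append_nil]
    exact hI.congr (hFK.1 4 (by simp [hK.notMem])) (hFK.2 9 (by simp [hK.arrs]))

/-- Write the part of the agents. -/
def emitA (K : Prog) : Prog :=
  .forLt 5 2 <| .seq (.set 13 (.var 5)) <|
  .branch (.get 5 (.var 13))
    (.seq (push (.get 5 (.var 13))) (whenKept K (push (.get 8 (.var 14)))).eachA) .skip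

/-- Write the part of the resources. -/
def emitB (K : Prog) : Prog :=
  .forLt 5 3 <| .seq (.set 14 (.var 5)) <|
  .branch (.get 6 (.var 14))
    (.seq (push (.get 0 (.get 2 (.var 14)))) <| .seq (push (.get 6 (.var 14)))
      (whenKept K (push (.get 7 (.var 13)))).eachB) .skip

theorem wvars_emitA (hK : Decides K keep) {x : ℕ} (hx : x ∈ (emitA K).wvars) :
    4 ≤ x ∧ x ≠ 9 := by
  by_cases hk : x ∈ K.wvars
  · have := hK.vars x hk
    omega
  · simp [emitA, Prog.forLt, Prog.eachA, whenKept, push, Prog.wvars, hk] at hx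
    omega

theorem warrs_emitA (hK : Decides K keep) {A : ℕ} (hA : A ∈ (emitA K).warrs) : A = 9 := by
  simpa [emitA, Prog.forLt, whenKept, push, Prog.warrs, hK.arrs] using hA

theorem wvars_emitB (hK : Decides K keep) {x : ℕ} (hx : x ∈ (emitB K).wvars) :
    4 ≤ x ∧ x ≠ 9 := by
  by_cases hk : x ∈ K.wvars
  · have := hK.vars x hk
    omega
  · simp [emitB, Prog.forLt, Prog.eachB, whenKept, push, Prog.wvars, hk] at hx
    omega

theorem warrs_emitB (hK : Decides K keep) {A : ℕ} (hA : A ∈ (emitB K).warrs) : A = 9 := by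
  simpa [emitB, Prog.forLt, whenKept, push, Prog.warrs, hK.arrs] using hA

theorem emitA_ok (hK : Decides K keep) (hN : G.Fits N) (h : Holds G σ) (h9 : σ.vars 9 = L)
    (h5 : ∀ a < G.nA, σ.arrs 5 a = (G.keptA (keepNat (keep G L)) a).length)
    (h8 : ∀ b < G.nB, σ.arrs 8 b = G.rankB (keepNat (keep G L)) b)
    {l : List ℕ} (hl : Written l σ) :
    Ok N (emitA K) σ
      (Written (l ++ (List.range G.nA).flatMap (G.outA (keepNat (keep G L))))) := by
  refine Ok.forLt
    (fun i => Written (l ++ (List.range i).flatMap (G.outA (keepNat (keep G L)))))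
    (by rw [h.nA]; exact hN.nA_le) (by decide) ?_ ?_ ?_ ?_ ?_
  · simp [Prog.eachA, Prog.forLt, whenKept, push, Prog.wvars, hK.notMem]
  · simp [Prog.eachA, Prog.forLt, whenKept, push, Prog.wvars, hK.notMem]
  · simpa using hl.setVar (by decide)
  · rw [h.nA]
    intro i hi τ hF hx hI
    have hH : Holds G τ := h.frame' hF (fun x hx => (wvars_emitA hK hx).1)
      (fun A hA => by have := warrs_emitA hK hA; omega)
    have hL : τ.vars 9 = L := by
      rw [hF.1 9 (fun hx => absurd (wvars_emitA hK hx) (by decide)), h9]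
    have h5' : τ.arrs 5 i = (G.keptA (keepNat (keep G L)) i).length := by
      rw [hF.2 5 (fun hA => absurd (warrs_emitA hK hA) (by decide)), h5 i hi]
    have h8' : τ.arrs 8 = σ.arrs 8 := hF.2 8 (fun hA => absurd (warrs_emitA hK hA) (by decide))
    rw [List.range_succ, List.flatMap_append, List.flatMap_singleton, ← List.append_assoc]
    refine Ok.seq (Ok.set (Ok.branch (fun hb => ?_) (fun hb => Ok.skip ?_)))
    · have hne : G.keptA (keepNat (keep G L)) i ≠ [] := by
        simpa [Expr.val, hx, h5'] using hb
      refine Ok.seq ((push_ok (hI.setVar (by decide))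
        (v := (G.keptA (keepNat (keep G L)) i).length)
        (by simp [Expr.val, hx, h5'])).mono fun υ hF' hυ => ?_)
      have hH' : Holds G υ := Holds.frame' (hH.setVar (x := 13) (by decide) (by decide)) hF'
        (by simp [push, Prog.wvars]) (by simp [push, Prog.warrs])
      refine (writeA_ok (L := L) hK hN hH' (a := i) ?_ hi ?_
        (f := G.rankB (keepNat (keep G L))) (fun b hb => ?_) hυ).mono fun ω _ hω => ?_
      · rw [hF'.1 13 (by simp [push, Prog.wvars])]; simp [Expr.val, hx]
      · rw [hF'.1 9 (by simp [push, Prog.wvars])]; simp [hL]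
      · rw [hF'.2 8 (by simp [push, Prog.warrs]), State.setVar_arrs, h8', h8 b hb]
      · refine Written.setVar ?_ (by decide)
        rw [outA, if_neg hne, List.append_cons]
        exact hω
    · have hne : G.keptA (keepNat (keep G L)) i = [] := by
        simpa [Expr.val, hx, h5'] using hb
      rw [outA, if_pos hne, List.append_nil]
      exact (hI.setVar (by decide)).setVar (by decide)
  · rw [h.nA]
    exact fun τ _ hI => hI

theorem emitB_ok (hK : Decides K keep) (hN : G.Fits N) (h : Holds G σ) (h9 : σ.vars 9 = L)
    (h6 : ∀ b < G.nB, σ.arrs 6 b = (G.keptB (keepNat (keep G L)) b).length)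
    (h7 : ∀ a < G.nA, σ.arrs 7 a = G.rankA (keepNat (keep G L)) a)
    {l : List ℕ} (hl : Written l σ) :
    Ok N (emitB K) σ
      (Written (l ++ (List.range G.nB).flatMap (G.outB (keepNat (keep G L))))) := by
  refine Ok.forLt
    (fun i => Written (l ++ (List.range i).flatMap (G.outB (keepNat (keep G L)))))
    (by rw [h.nB]; exact hN.nB_le) (by decide) ?_ ?_ ?_ ?_ ?_
  · simp [Prog.eachB, Prog.forLt, whenKept, push, Prog.wvars, hK.notMem]
  · simp [Prog.eachB, Prog.forLt, whenKept, push, Prog.wvars, hK.notMem]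
  · simpa using hl.setVar (by decide)
  · rw [h.nB]
    intro i hi τ hF hx hI
    have hH : Holds G τ := h.frame' hF (fun x hx => (wvars_emitB hK hx).1)
      (fun A hA => by have := warrs_emitB hK hA; omega)
    have hL : τ.vars 9 = L := by
      rw [hF.1 9 (fun hx => absurd (wvars_emitB hK hx) (by decide)), h9]
    have h6' : τ.arrs 6 i = (G.keptB (keepNat (keep G L)) i).length := by
      rw [hF.2 6 (fun hA => absurd (warrs_emitB hK hA) (by decide)), h6 i hi]
    have h7' : τ.arrs 7 = σ.arrs 7 := hF.2 7 (fun hA => absurd (warrs_emitB hK hA) (by decide))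
    rw [List.range_succ, List.flatMap_append, List.flatMap_singleton, ← List.append_assoc]
    refine Ok.seq (Ok.set (Ok.branch (fun hb => ?_) (fun hb => Ok.skip ?_)))
    · have hne : G.keptB (keepNat (keep G L)) i ≠ [] := by
        simpa [Expr.val, hx, h6'] using hb
      refine Ok.seq ((push_ok (hI.setVar (by decide)) (v := G.quota i)
        (by simp [Expr.val, hx, hH.quota i hi])).mono fun υ hF' hυ => Ok.seq ?_)
      refine (push_ok hυ (v := (G.keptB (keepNat (keep G L)) i).length) ?_).mono
        fun ω hF'' hω => ?_
      · simp only [Expr.val]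
        rw [hF'.1 14 (by simp [push, Prog.wvars]), hF'.2 6 (by simp [push, Prog.warrs])]
        simp [Expr.val, hx, h6']
      have hH' : Holds G ω := Holds.frame'
        (Holds.frame' (hH.setVar (x := 14) (by decide) (by decide)) hF'
        (by simp [push, Prog.wvars]) (by simp [push, Prog.warrs])) hF''
        (by simp [push, Prog.wvars]) (by simp [push, Prog.warrs])
      refine (writeB_ok (L := L) hK hN hH' (b := i) ?_ hi ?_
        (f := G.rankA (keepNat (keep G L))) (fun b hb => ?_) hω).mono fun ξ _ hξ => ?_
      · rw [hF''.1 14 (by simp [push, Prog.wvars]), hF'.1 14 (by simp [push, Prog.wvars])]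
        simp [Expr.val, hx]
      · rw [hF''.1 9 (by simp [push, Prog.wvars]), hF'.1 9 (by simp [push, Prog.wvars])]
        simp [hL]
      · rw [hF''.2 7 (by simp [push, Prog.warrs]), hF'.2 7 (by simp [push, Prog.warrs]),
          State.setVar_arrs, h7', h7 b hb]
      · refine Written.setVar ?_ (by decide)
        rw [outB, if_neg hne, List.append_cons, List.append_cons _ (List.length _)]
        exact hξ
    · have hne : G.keptB (keepNat (keep G L)) i = [] := by
        simpa [Expr.val, hx, h6'] using hb
      rw [outB, if_pos hne, List.append_nil]
      exact (hI.setVar (by decide)).setVar (by decide)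
  · rw [h.nB]
    exact fun τ _ hI => hI

/-- Write the number `min k L`, the numbers of agents and of resources, and all lists. -/
def emit (K : Prog) : Prog :=
  .seq (.set 4 (.lit 0)) <|
  .seq (push (.sub (.var 1) (.sub (.var 1) (.var 9)))) <|
  .seq (push (.var 11)) <| .seq (push (.var 12)) <|
  .seq (emitA K) <| emitB K

/-- Move the word from the array `9` to the array `0`. -/
def finish : Prog :=
  .seq (.forLt 5 4 (.put 0 (.var 5) (.get 9 (.var 5)))) (.set 0 (.var 4))

/-- The output is built in a separate array because the input in array `0` is read until the last
list is written. -/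
theorem finish_ok {l : List ℕ} (h : Written l σ) (hl : l.length ≤ N) :
    Ok N finish σ fun τ => τ.word = l := by
  refine Ok.seq (Ok.forLt (fun i τ => ∀ j < i, τ.arrs 0 j = l.getD j 0) (by rw [h.1]; exact hl)
    (by decide) (by decide) (by decide) (by simp) ?_ ?_)
  · rw [h.1]
    intro i hi τ hF h5 hI
    refine Ok.put fun j hj => ?_
    have h9 : τ.arrs 9 = σ.arrs 9 := hF.2 9 (by decide)
    rcases Nat.lt_succ_iff_lt_or_eq.1 hj with hj | rfl
    · rw [← hI j hj]
      simp [Expr.val, h5, hj.ne]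
    · rw [← h.2 j hi, ← h9]
      simp [Expr.val, h5]
  · rw [h.1]
    intro τ hF hI
    refine Ok.set ?_
    have h4 : τ.vars 4 = l.length := by rw [hF.1 4 (by decide), h.1]
    refine List.ext_getElem (by simp [State.word, Expr.val, h4]) fun i h1 h2 => ?_
    simp [State.word, hI i h2, h2]

/-- The kernelization. -/
def kernelize (K : Prog) : Prog :=
  .seq parse <| .seq greedy <| .seq (renumberA K) <| .seq (renumberB K) <| .seq (emit K) finish

/-- The threshold `L` is whatever the greedy matching yields; only its two bounds are passed on, so
the combinatorial lemmas can treat it as arbitrary. -/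
theorem kernelize_ok (hK : Decides K keep) (G : OneOneLQ) (k : ℕ) :
    Ok (G.encode k).length (kernelize K) (load (G.encode k)) fun τ => ∃ L,
      (∀ M, G.IsMatching M → M.card < L) ∧ L ≤ 4 * G.stableSize + 1 ∧
      τ.word = G.output (keepNat (keep G L)) (min k L) := by
  have hN := G.fits k
  refine Ok.seq ((parse_ok G k hN).mono fun τ₁ F₁ h₁ => Ok.seq ?_)
  obtain ⟨H₁, hk₁⟩ := h₁
  have hp : ∀ A, 3 ≤ A → ∀ i, τ₁.arrs A i = 0 := fun A hA i => by
    rw [F₁.2 A (by simp [parse, Prog.forLt, Prog.warrs]; omega)]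
    simp [load]; omega
  have hp' : ∀ x, 9 ≤ x → τ₁.vars x = 0 := fun x hx => by
    rw [F₁.1 x (by simp [parse, Prog.forLt, Prog.wvars]; omega)]
    simp [load]; omega
  refine (greedy_ok hN H₁ (hp' 9 le_rfl) (hp 3 le_rfl) (hp 4 (by decide))).mono
    fun τ₂ F₂ h₂ => Ok.seq ?_
  have H₂ : Holds G τ₂ := H₁.frame F₂ (by decide) (by decide)
  refine (renumberA_ok hK hN H₂ rfl (by rw [F₂.1 11 (by decide), hp' 11 (by decide)])
    (fun a => by rw [F₂.2 5 (by decide), hp 5 (by decide)])).mono fun τ₃ F₃ h₃ => Ok.seq ?_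
  have H₃ : Holds G τ₃ := H₂.frame' F₃
    (fun x hx => by have := wvars_renumberA hK hx; omega)
    (fun A hA => by have := warrs_renumberA hK hA; omega)
  have v₃ : ∀ x, x < 5 ∨ x = 8 ∨ x = 9 ∨ x = 12 → τ₃.vars x = τ₂.vars x := fun x hx =>
    F₃.1 x fun h => by have := wvars_renumberA hK h; omega
  have a₃ : ∀ A, A ≠ 5 → A ≠ 7 → τ₃.arrs A = τ₂.arrs A := fun A h5 h7 =>
    F₃.2 A fun h => by have := warrs_renumberA hK h; omega
  refine (renumberB_ok (L := τ₂.vars 9) hK hN H₃ (v₃ 9 (by decide))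
    (by rw [v₃ 12 (by decide), F₂.1 12 (by decide), hp' 12 (by decide)])
    (fun a => by rw [a₃ 6 (by decide) (by decide), F₂.2 6 (by decide), hp 6 (by decide)])).mono
    fun τ₄ F₄ h₄ => Ok.seq ?_
  have H₄ : Holds G τ₄ := H₃.frame' F₄
    (fun x hx => by have := wvars_renumberB hK hx; omega)
    (fun A hA => by have := warrs_renumberB hK hA; omega)
  have v₄ : ∀ x, x < 5 ∨ x = 8 ∨ x = 9 ∨ x = 11 → τ₄.vars x = τ₃.vars x := fun x hx =>
    F₄.1 x fun h => by have := wvars_renumberB hK h; omega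
  have a₄ : ∀ A, A ≠ 6 → A ≠ 8 → τ₄.arrs A = τ₃.arrs A := fun A h5 h7 =>
    F₄.2 A fun h => by have := warrs_renumberB hK h; omega
  have hk₄ : τ₄.vars 1 = k := by
    rw [v₄ 1 (by decide), v₃ 1 (by decide), F₂.1 1 (by decide), hk₁]
  have hL₄ : τ₄.vars 9 = τ₂.vars 9 := by rw [v₄ 9 (by decide), v₃ 9 (by decide)]
  refine Ok.mono (Q := Written (G.output (keepNat (keep G (τ₂.vars 9))) (min k (τ₂.vars 9)))) ?_
    fun τ₅ F₅ h₅ => (finish_ok h₅ (G.length_output_le _ _ _)).mono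
      fun τ₆ _ h₆ => ⟨τ₂.vars 9, h₂.1, h₂.2, h₆⟩
  generalize τ₂.vars 9 = L at *
  have hpush : ∀ {e : Expr} {τ υ : State}, Frame (push e) τ υ →
      (∀ x, x ≠ 4 → υ.vars x = τ.vars x) ∧ ∀ A, A ≠ 9 → υ.arrs A = τ.arrs A :=
    fun F => ⟨fun x hx => F.1 x (by simpa [push, Prog.wvars] using hx),
      fun A hA => F.2 A (by simpa [push, Prog.warrs] using hA)⟩
  refine Ok.seq (Ok.set (Ok.seq ?_))
  -- With truncated subtraction, `k - (k - L)` is `min k L`.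
  refine (push_ok (l := []) (v := min k L) ⟨by simp [Expr.val], by simp⟩
    (by simp [Expr.val, hk₄, hL₄]; omega)).mono fun υ₁ E₁ w₁ => Ok.seq ?_
  have E₁ := hpush E₁
  refine (push_ok w₁ (v := G.rankA (keepNat (keep G L)) G.nA)
    (by simp [Expr.val, E₁.1 11, v₄ 11, h₃.2])).mono fun υ₂ E₂ w₂ => Ok.seq ?_
  have E₂ := hpush E₂
  refine (push_ok w₂ (v := G.rankB (keepNat (keep G L)) G.nB)
    (by simp [Expr.val, E₁.1 12, E₂.1 12, h₄.2])).mono fun υ₃ E₃ w₃ => Ok.seq ?_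
  have E₃ := hpush E₃
  have v₅ : ∀ x, x ≠ 4 → υ₃.vars x = τ₄.vars x := fun x hx => by
    rw [E₃.1 x hx, E₂.1 x hx, E₁.1 x hx]; simp [hx]
  have a₅ : ∀ A, A ≠ 9 → υ₃.arrs A = τ₄.arrs A := fun A hA => by
    rw [E₃.2 A hA, E₂.2 A hA, E₁.2 A hA]; rfl
  have H₅ : Holds G υ₃ := H₄.congr (v₅ 2 (by decide)) (v₅ 3 (by decide)) (a₅ 0 (by decide))
    (a₅ 1 (by decide)) (a₅ 2 (by decide))
  refine (emitA_ok (L := L) hK hN H₅ (by rw [v₅ 9 (by decide), hL₄])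
    (fun a ha => by rw [a₅ 5 (by decide), a₄ 5 (by decide) (by decide), (h₃.1 a ha).1])
    (fun b hb => by rw [a₅ 8 (by decide), (h₄.1 b hb).2]) w₃).mono fun υ₄ E₄ w₄ => ?_
  have H₆ : Holds G υ₄ := H₅.frame' E₄ (fun x hx => (wvars_emitA hK hx).1)
      (fun A hA => by have := warrs_emitA hK hA; omega)
  have a₆ : ∀ A, A ≠ 9 → υ₄.arrs A = τ₄.arrs A := fun A hA => by
    rw [E₄.2 A fun h => hA (warrs_emitA hK h), a₅ A hA]
  refine (emitB_ok (L := L) hK hN H₆ ?_ (fun b hb => by rw [a₆ 6 (by decide), (h₄.1 b hb).1])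
    (fun a ha => by
      rw [a₆ 7 (by decide), a₄ 7 (by decide) (by decide), (h₃.1 a ha).2]) w₄).mono
    fun υ₅ _ w₅ => ?_
  · rw [E₄.1 9 (fun hx => absurd (wvars_emitA hK hx) (by decide)), v₅ 9 (by decide), hL₄]
  · simpa [output] using w₅

end RAM

/-! ### The restriction as an instance -/

namespace List

theorem flatMap_filter_of_eq_nil {α β : Type*} {p : α → Bool} {f : α → List β}
    (h : ∀ a, p a = false → f a = []) (l : List α) : (l.filter p).flatMap f = l.flatMap f := by
  induction l with
  | nil => simp
  | cons a l ih =>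
    by_cases ha : p a = true
    · simp [List.filter_cons_of_pos ha, ih]
    · simp [List.filter_cons_of_neg ha, ih, h a (by simpa using ha)]

theorem map_val_filter_finRange (p : ℕ → Bool) (n : ℕ) :
    ((finRange n).filter fun a : Fin n => p a).map Fin.val = (range n).filter p := by
  rw [← List.map_coe_finRange_eq_range, List.filter_map]
  rfl

/-- The position of an element of `(range n).filter p` is the number of smaller elements. -/
theorem length_filter_range_getElem (p : ℕ → Bool) {n : ℕ}
    (i : Fin ((finRange n).filter fun a : Fin n => p a).length) :
    ((range (((finRange n).filter fun a : Fin n => p a).get i)).filter p).length = i := by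
  have hmem : p (((finRange n).filter fun a : Fin n => p a).get i) = true :=
    (List.mem_filter.1 (List.get_mem _ i)).2
  have hval : ((range n).filter p)[(i : ℕ)]'(by
      rw [← map_val_filter_finRange, List.length_map]; exact i.2) =
      (((finRange n).filter fun a : Fin n => p a).get i : ℕ) := by
    simp only [← map_val_filter_finRange, List.getElem_map]
    rfl
  generalize ((finRange n).filter fun a : Fin n => p a).get i = x at hmem hval
  obtain ⟨m, hm⟩ := Nat.exists_eq_add_of_le (Nat.succ_le_of_lt x.2)
  -- Cut the range at `x`: the filtered list has `x` right after its smaller elements, and without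
  -- repetitions this position is unique.
  have hsplit : (range n).filter p =
      (range x).filter p ++ (x : ℕ) :: ((range m).map ((x + 1 : ℕ) + ·)).filter p := by
    conv_lhs => rw [hm, List.range_add, Nat.succ_eq_add_one, List.range_succ]
    simp [hmem]
  have hlt : ((range x).filter p).length < ((range n).filter p).length := by rw [hsplit]; simp
  have h2 : ((range n).filter p)[((range x).filter p).length] = x := by
    simp only [hsplit]
    simp
  exact (((List.nodup_range (n := n)).filter p).getElem_inj_iff).1 (h2.trans hval.symm)

end List

namespace OneOneLQ

open RAM

variable {G : OneOneLQ} (keep : Fin G.nA → Fin G.nB → Bool)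

theorem keptA_coe (a : Fin G.nA) :
    G.keptA (keepNat keep) a = ((G.prefA a).filter (keep a)).map (↑) := by
  rw [keptA, listA_coe, List.filter_map]
  congr 2
  funext b
  simp

theorem keptB_coe (b : Fin G.nB) :
    G.keptB (keepNat keep) b = ((G.prefB b).filter fun a => keep a b).map (↑) := by
  rw [keptB, listB_coe, List.filter_map]
  congr 2
  funext b
  simp

/-- The new vertices are the positions in the lists `VA`, `VB` of non-isolated vertices. `get` is
the embedding, and the rank computed by the program is its inverse, which makes the two words agree.
-/
theorem exists_isRestriction (k : ℕ) : ∃ (G' : OneOneLQ) (eA : Fin G'.nA → Fin G.nA)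
    (eB : Fin G'.nB → Fin G.nB), IsRestriction G G' keep eA eB ∧
      G'.encode k = G.output (keepNat keep) k := by
  let pA : ℕ → Bool := fun a => G.keptA (keepNat keep) a ≠ []
  let pB : ℕ → Bool := fun b => G.keptB (keepNat keep) b ≠ []
  let VA := (List.finRange G.nA).filter fun a : Fin G.nA => pA a
  let VB := (List.finRange G.nB).filter fun b : Fin G.nB => pB b
  have hpA : ∀ a : Fin G.nA, pA a = true ↔ ∃ b, G.Edge a b ∧ keep a b = true := by
    intro a
    simp only [pA, keptA_coe, decide_eq_true_eq, ne_eq, List.map_eq_nil_iff,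
      List.filter_eq_nil_iff, not_forall, not_not, exists_prop]
    rfl
  have hpB : ∀ b : Fin G.nB, pB b = true ↔ ∃ a, G.Edge a b ∧ keep a b = true := by
    intro b
    simp only [pB, keptB_coe, decide_eq_true_eq, ne_eq, List.map_eq_nil_iff,
      List.filter_eq_nil_iff, not_forall, not_not, exists_prop, edge_iff_mem_prefB]
  have hnA : VA.Nodup := (List.nodup_finRange _).filter _
  have hnB : VB.Nodup := (List.nodup_finRange _).filter _
  have injA : Function.Injective VA.get := List.nodup_iff_injective_get.1 hnA
  have injB : Function.Injective VB.get := List.nodup_iff_injective_get.1 hnB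
  have surjA : ∀ a b, G.Edge a b → keep a b = true → ∃ i, VA.get i = a := fun a b h1 h2 =>
    List.mem_iff_get.1 (List.mem_filter.2 ⟨List.mem_finRange a, (hpA a).2 ⟨b, h1, h2⟩⟩)
  have surjB : ∀ a b, G.Edge a b → keep a b = true → ∃ i, VB.get i = b := fun a b h1 h2 =>
    List.mem_iff_get.1 (List.mem_filter.2 ⟨List.mem_finRange b, (hpB b).2 ⟨a, h1, h2⟩⟩)
  -- A kept list contains only surviving resources, so it lifts along the embedding.
  have exA : ∀ i, ∃ l : List (Fin VB.length),
      l.map VB.get = (G.prefA (VA.get i)).filter (keep (VA.get i)) := by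
    intro i
    have : (G.prefA (VA.get i)).filter (keep (VA.get i)) ∈ Set.range (List.map VB.get) := by
      rw [Set.range_list_map]
      intro b hb
      rw [List.mem_filter] at hb
      exact surjB _ b hb.1 hb.2
    exact this
  have exB : ∀ j, ∃ l : List (Fin VA.length),
      l.map VA.get = (G.prefB (VB.get j)).filter fun a => keep a (VB.get j) := by
    intro j
    have : ((G.prefB (VB.get j)).filter fun a => keep a (VB.get j)) ∈
        Set.range (List.map VA.get) := by
      rw [Set.range_list_map]
      intro a ha
      rw [List.mem_filter] at ha
      exact surjA a _ (edge_iff_mem_prefB.2 ha.1) ha.2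
    exact this
  choose fA hfA using exA
  choose fB hfB using exB
  let G' : OneOneLQ :=
    { nA := VA.length
      nB := VB.length
      prefA := fA
      prefB := fB
      nodupA := fun i => List.Nodup.of_map VB.get (by rw [hfA]; exact (G.nodupA _).filter _)
      nodupB := fun j => List.Nodup.of_map VA.get (by rw [hfB]; exact (G.nodupB _).filter _)
      mutual_iff := fun i j => by
        rw [← List.mem_map_of_injective injB, hfA, ← List.mem_map_of_injective injA, hfB,
          List.mem_filter, List.mem_filter, G.mutual_iff]
      lq := fun j => G.lq (VB.get j) }
  refine ⟨G', VA.get, VB.get, ⟨injA, injB, hfA, hfB, fun _ => rfl, surjA, surjB, ?_, ?_⟩, ?_⟩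
  · intro i h
    obtain ⟨b, h1, h2⟩ := (hpA _).1 (List.mem_filter.1 (List.get_mem VA i)).2
    have h3 : b ∈ (fA i).map VB.get := by rw [hfA]; exact List.mem_filter.2 ⟨h1, h2⟩
    rw [show fA i = [] from h] at h3
    simp at h3
  · intro j h
    obtain ⟨a, h1, h2⟩ := (hpB _).1 (List.mem_filter.1 (List.get_mem VB j)).2
    have h3 : a ∈ (fB j).map VA.get := by
      rw [hfB]; exact List.mem_filter.2 ⟨edge_iff_mem_prefB.1 h1, h2⟩
    rw [show fB j = [] from h] at h3
    simp at h3
  · have rA : ∀ i : Fin VA.length, G.rankA (keepNat keep) (VA.get i) = i :=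
      fun i => List.length_filter_range_getElem pA i
    have rB : ∀ j : Fin VB.length, G.rankB (keepNat keep) (VB.get j) = j :=
      fun j => List.length_filter_range_getElem pB j
    have lA : G.rankA (keepNat keep) G.nA = VA.length := by
      rw [rankA, ← List.map_val_filter_finRange, List.length_map]
    have lB : G.rankB (keepNat keep) G.nB = VB.length := by
      rw [rankB, ← List.map_val_filter_finRange, List.length_map]
    have cA : ∀ i : Fin VA.length, G'.codeA i = G.outA (keepNat keep) (VA.get i) := by
      intro i
      have hne : G.keptA (keepNat keep) (VA.get i) ≠ [] := by
        simpa [pA] using (List.mem_filter.1 (List.get_mem VA i)).2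
      have h1 : G'.listA i = (fA i).map (↑) := G'.listA_coe i
      rw [outA, if_neg hne, codeA, h1, keptA_coe, ← hfA, List.map_map, List.map_map,
        List.length_map, List.length_map]
      congr 1
      exact List.map_congr_left fun j _ => (rB j).symm
    have cB : ∀ j : Fin VB.length, G'.codeB j = G.outB (keepNat keep) (VB.get j) := by
      intro j
      have hne : G.keptB (keepNat keep) (VB.get j) ≠ [] := by
        simpa [pB] using (List.mem_filter.1 (List.get_mem VB j)).2
      have h1 : G'.listB j = (fB j).map (↑) := G'.listB_coe j
      have h2 : G'.quota j = (G.lq (VB.get j)).toNat := G'.quota_coe j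
      rw [outB, if_neg hne, codeB, h1, h2, quota_coe, keptB_coe, ← hfB, List.map_map,
        List.map_map, List.length_map, List.length_map]
      congr 2
      exact List.map_congr_left fun i _ => (rA i).symm
    have mA : (List.range VA.length).flatMap G'.codeA =
        (List.range G.nA).flatMap (G.outA (keepNat keep)) := by
      rw [← List.map_coe_finRange_eq_range, ← List.map_coe_finRange_eq_range, List.flatMap_map,
        List.flatMap_map]
      -- Isolated agents write nothing, so the concatenation over all agents equals the one over the
      -- surviving ones.
      refine Eq.trans ?_ (List.flatMap_filter_of_eq_nil (p := fun i : Fin G.nA => pA i)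
        (f := fun i => G.outA (keepNat keep) i) (fun i hi => if_pos (by simpa [pA] using hi)) _)
      change _ = VA.flatMap _
      conv_rhs => rw [← List.map_get_finRange VA, List.flatMap_map]
      exact congrArg (List.flatMap · _) (funext cA)
    have mB : (List.range VB.length).flatMap G'.codeB =
        (List.range G.nB).flatMap (G.outB (keepNat keep)) := by
      rw [← List.map_coe_finRange_eq_range, ← List.map_coe_finRange_eq_range, List.flatMap_map,
        List.flatMap_map]
      refine Eq.trans ?_ (List.flatMap_filter_of_eq_nil (p := fun i : Fin G.nB => pB i)
        (f := fun i => G.outB (keepNat keep) i) (fun i hi => if_pos (by simpa [pB] using hi)) _)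
      change _ = VB.flatMap _
      conv_rhs => rw [← List.map_get_finRange VB, List.flatMap_map]
      exact congrArg (List.flatMap · _) (funext cB)
    rw [encode_eq, output, lA, lB]
    exact congrArg₂ (· ++ ·) (congrArg (_ ++ ·) mA) mB

/-- Isolates the machine: what remains is a statement about restrictions and an arbitrary threshold
`L` that exceeds all matchings and is at most `4 * s + 1`. -/
theorem admitsPolyKernel_of_decides {r : ℕ} {C : OneOneLQ → Prop} {Q : OneOneLQ → ℕ → Prop}
    {κ : OneOneLQ → Fin r → ℕ} {K : Prog}
    {keep : (G : OneOneLQ) → ℕ → Fin G.nA → Fin G.nB → Bool} (hK : Decides K keep)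
    (p : MvPolynomial (Fin r) ℕ)
    (h : ∀ (G G' : OneOneLQ) (L : ℕ) (eA : Fin G'.nA → Fin G.nA) (eB : Fin G'.nB → Fin G.nB),
      IsRestriction G G' (keep G L) eA eB → (∀ M, G.IsMatching M → M.card < L) →
      L ≤ 4 * G.stableSize + 1 → C G →
      (∀ k, C G' ∧ (Q G k ↔ Q G' (min k L))) ∧ G'.size + L ≤ MvPolynomial.eval (κ G) p) :
    AdmitsPolyKernel C Q κ := by
  refine ⟨kernelize K, (kernelize K).time, p, fun G k hC => ?_⟩
  obtain ⟨n, τ, hexec, hn, L, hL, hLs, hw⟩ := kernelize_ok hK G k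
  obtain ⟨G', eA, eB, hG', henc⟩ := exists_isRestriction (keep G L) (min k L)
  obtain ⟨h1, h2⟩ := h G G' L eA eB hG' hL hLs hC
  exact ⟨n, G', min k L, ⟨τ, hexec, hw.trans henc.symm⟩, hn, (h1 k).1, (h1 k).2,
    (Nat.add_le_add_left (min_le_right _ _) _).trans h2⟩

theorem size_le_of_le {x y : ℕ} (hx : G.nA ≤ x) (hy : G.nB ≤ y) : G.size ≤ x + y + x * y :=
  G.size_le.trans (by gcongr)

end OneOneLQ

open OneOneLQ RAM in
/-- On `ONE-ONE-LQ` instances that admit a feasible envy-free matching, `MAXEFM` admits a polynomial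
kernel in `(s, t)`; on those that admit a feasible stable matching, `MAXRSM` admits a polynomial
kernel in `s`. -/
theorem theorem2 :
    AdmitsPolyKernel (fun G => ∃ M, G.IsFeasible M ∧ G.IsEnvyFree M)
      OneOneLQ.MaxEFM (fun G => ![G.stableSize, G.commonParam]) ∧
    AdmitsPolyKernel (fun G => ∃ M, G.IsFeasible M ∧ G.IsStable M)
      OneOneLQ.MaxRSM (fun G => ![G.stableSize]) := by
  constructor
  · let s : MvPolynomial (Fin 2) ℕ := MvPolynomial.X 0
    let t : MvPolynomial (Fin 2) ℕ := MvPolynomial.X 1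
    -- The polynomials `L`, `x`, `y` bound the threshold, the agents and the resources; edges are
    -- bounded by `x * y`, and the new target by `L`.
    let L : MvPolynomial (Fin 2) ℕ := 4 * s + 1
    let x : MvPolynomial (Fin 2) ℕ := s + s * L
    let y : MvPolynomial (Fin 2) ℕ := s + L + s + s * s * t
    refine admitsPolyKernel_of_decides efmProg_decides (x + y + x * y + L)
      fun G G' L' eA eB h hL hLs hC => ⟨fun k => h.efm_kernel hL hC k, ?_⟩
    obtain ⟨M, hF, hE⟩ := hC
    have h1 := (h.nA_le _ fun a b hk => (of_decide_eq_true hk).1).trans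
      (show _ ≤ MvPolynomial.eval ![G.stableSize, G.commonParam] x by
        simp only [x, L, s, map_add, map_mul, map_one, map_ofNat, MvPolynomial.eval_X,
          Matrix.cons_val_zero]
        gcongr)
    have h2 := (h.nB_le_efm hL ⟨M, hF, hE.1⟩).trans
      (show _ ≤ MvPolynomial.eval ![G.stableSize, G.commonParam] y by
        simp only [y, L, s, t, map_add, map_mul, map_one, map_ofNat, MvPolynomial.eval_X,
          Matrix.cons_val_zero, Matrix.cons_val_one]
        gcongr)
    rw [map_add, map_add, map_add, map_mul]
    refine Nat.add_le_add (size_le_of_le h1 h2) ?_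
    simpa [L, s] using hLs
  · let s : MvPolynomial (Fin 1) ℕ := MvPolynomial.X 0
    let L : MvPolynomial (Fin 1) ℕ := 4 * s + 1
    let x : MvPolynomial (Fin 1) ℕ := s + s * L
    let y : MvPolynomial (Fin 1) ℕ := s + L + s * (L + L)
    refine admitsPolyKernel_of_decides rsmProg_decides (x + y + x * y + L)
      fun G G' L' eA eB h hL hLs hC => ⟨fun k => h.rsm_kernel hL hC k, ?_⟩
    obtain ⟨M, hF, hS⟩ := hC
    have h1 := (h.nA_le _ fun a b hk => (of_decide_eq_true hk).1).trans
      (show _ ≤ MvPolynomial.eval ![G.stableSize] x by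
        simp only [x, L, s, map_add, map_mul, map_one, map_ofNat, MvPolynomial.eval_X,
          Matrix.cons_val_zero]
        gcongr)
    have h2 := (h.nB_le_rsm hL ⟨M, hF, hS.1⟩).trans
      (show _ ≤ MvPolynomial.eval ![G.stableSize] y by
        simp only [y, L, s, map_add, map_mul, map_one, map_ofNat, MvPolynomial.eval_X,
          Matrix.cons_val_zero]
        gcongr)
    rw [map_add, map_add, map_add, map_mul]
    refine Nat.add_le_add (size_le_of_le h1 h2) ?_
    simpa [L, s] using hLs
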